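/- **Setting.** Let $d=n+1$ and label coordinates of $\mathbb R^d$ by $0,\dots,n$. Consider a diagonal Gaussian mixture with weights $\omega_i>0$, $\sum_{i=1}^r\omega_i=1$, means $\mu_i\in\mathbb R^d$ and covariances $\Sigma_i=\operatorname{diag}(\sigma_{i0}^2,\dots,\sigma_{in}^2)$, $\sigma_{ij}^2>0$ $(i=1,\dots,r)$. For a random vector $y$ with this law let $M_s=\mathbb E[y^{\otimes s}]$, and put $\mathcal F_m=\sum_{i=1}^r\omega_i\mu_i^{\otimes m}$. Norms are Euclidean (Frobenius). For a tensor $T$ of order $s$, $T_{\Omega_s}$ is the family of its entries $T_{i_1\dots i_s}$ with pairwise distinct labels. Square-free monomials in $x_1,\dots,x_n$ of degree $m-1$ or $m$ label entries of symmetric tensors of order $m$ through $x_0:=1$; for a set $\mathcal M$ of monomials, $[x]_{\mathcal M}$ is the vector of their values at $x$. Let $1\le p\le m-2$ and $k$ be integers with $r\le\min\left\{\binom kp,\binom{n-k-1}{m-p-1}\right\}$, and let $t\ge 0$ be the smallest integer with $\binom dt\ge r$. Let $J_1$ be the set of square-free monomials of degree $p$ in $x_1,\dots,x_k$, $J_1^{-j}$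 its members not divisible by $x_j$, $\mathscr B_0$ the first $r$ elements of $J_1$ in graded lexicographic order ($x_1x_2,x_1x_3,\dots$), $J_2$ the set of square-free monomials of degree $m-p-1$ in $x_{k+1},\dots,x_n$, $\mathscr B_1=\{\nu x_l:\nu\in J_1,\ k<l\le n\}$, and, for $\alpha=\nu x_l\in\mathscr B_1$, $\mathcal O_\alpha$ the set of elements of $J_2$ not divisible by $x_l$. For a symmetric $T$ of order $m$ let $A[\alpha,T]=(T_{\beta\gamma})_{\gamma\in\mathcal O_\alpha,\beta\in\mathscr B_0}$ and $b[\alpha,T]=(T_{\alpha\gamma})_{\gamma\in\mathcal O_\alpha}$. For $G\in\mathbb C^{\mathscr B_0\times\mathscr B_1}$ and $\xi=(\xi_{k+1},\dots,\xi_n)\in\mathbb C^{n-k}$ let $N_l(G)_{\nu,\beta}=G(\beta,\nu x_l)$ $(\nu,\beta\in\mathscr B_0)$ and $N(\xi)=\sum_{l=k+1}^n\xi_lN_l(G)$. **Algorithm** (input: symmetric real tensors $\widehat M_m,\widehat M_t$ of orders $m,t$, such as the sample moments; $r,p,k,\xi$). Each $\min$ is solved by a global minimizer (any one, if there are several). 1.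 (a) For each $\alpha\in\mathscr B_1$ let $\widehat G(:,\alpha)$ minimize $\|A[\alpha,\widehat M_m]g-b[\alpha,\widehat M_m]\|^2$ over $g\in\mathbb C^{\mathscr B_0}$. (b) Let $e_1,\dots,e_r$ be linearly independent unit eigenvectors of $N(\xi)$ formed with $\widehat G$, and $\hat w_i=(e_i^HN_l(\widehat G)e_i)_{k<l\le n}$. (c) Let $(\hat\gamma_i)$ minimize $\|(\widehat M_m)_{J_1\cdot J_2}-\sum_i\gamma_i\otimes[\hat w_i]_{J_2}\|^2$ over $\gamma_i\in\mathbb C^{J_1}$; for $j=1,\dots,k$ let $((\hat v_i)_j)_{i}$ minimize $\|(\widehat M_m)_{x_j\cdot J_1^{-j}\cdot J_2}-\sum_ic_i\,(\hat\gamma_i)_{J_1^{-j}}\otimes[\hat w_i]_{J_2}\|^2$ over $c\in\mathbb C^r$; let $(\hat\lambda_i)$ minimize $\|(\widehat M_m)_{\Omega_m}-\sum_i\lambda_i((1,\hat v_i,\hat w_i)^{\otimes m})_{\Omega_m}\|^2$ over $\mathbb C^r$. (d) Starting from $\hat q_i=\hat\lambda_i^{1/m}(1,\hat v_i,\hat w_i)$,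 minimize $\|(\widehat M_m)_{\Omega_m}-\sum_i(q_i^{\otimes m})_{\Omega_m}\|^2$ over $q_i\in\mathbb C^d$, obtaining $q_1^*,\dots,q_r^*$. 2. Choose $\eta_i$ with $\eta_i^m=1$ minimizing $\|\operatorname{Im}(\eta_iq_i^*)\|$; put $\check q_i=\operatorname{Re}(\eta_iq_i^*)$. 3. Let $(\beta_i^*)$ minimize $\|(\widehat M_t)_{\Omega_t}-\sum_i\beta_i(\check q_i^{\otimes t})_{\Omega_t}\|^2$ over $\beta_i\ge0$; put $\hat\omega_i=(\beta_i^*)^{m/(m-t)}$, $\hat\mu_i=\check q_i/(\beta_i^*)^{1/(m-t)}$. 4. Starting from $(\hat\omega_i,\hat\mu_i)$, minimize $\|(\widehat M_m)_{\Omega_m}-\sum_i\omega_i(\mu_i^{\otimes m})_{\Omega_m}\|^2+\|(\widehat M_t)_{\Omega_t}-\sum_i\omega_i(\mu_i^{\otimes t})_{\Omega_t}\|^2$ over $\omega_i\ge0$, $\sum_i\omega_i=1$, $\mu_i\in\mathbb R^d$, obtaining $(\omega_i^*,\mu_i^*)$. 5. Let $\widehat{\mathcal A}=\widehat M_m-\sum_i\check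 q_i^{\otimes m}$. For each coordinate $j$ let $(\theta_{ij}^*)_i$ minimize $\sum\big|\widehat{\mathcal A}_{jji_1\dots i_{m-2}}-\sum_i\theta_i\,\omega_i^*(\mu_i^*)_{i_1}\cdots(\mu_i^*)_{i_{m-2}}\big|^2$ over $\theta_i\ge0$, the outer sum being over $i_1<\dots<i_{m-2}$ all different from $j$. Put $\Sigma_i^*=\operatorname{diag}(\theta_{i0}^*,\dots,\theta_{in}^*)$. Output: $(\omega_i^*,\mu_i^*,\Sigma_i^*)$, $i=1,\dots,r$. **Theorem 5.1.** Assume that (i) the leading entry $(\mu_i)_0$ of each $\mu_i$ is nonzero; (ii) the vectors $[\mu_1]_{\mathscr B_0},\dots,[\mu_r]_{\mathscr B_0}$ are linearly independent; (iii) for every $\alpha\in\mathscr B_1$ the vectors $[\mu_1]_{\mathcal O_\alpha},\dots,[\mu_r]_{\mathcal O_\alpha}$ are linearly independent; (iv) the eigenvalues of $N(\xi)$, formed with the solution $G$ of the systems $A[\alpha,\mathcal F_m]\,G(:,\alpha)=b[\alpha,\mathcal F_m]$ $(\alpha\in\mathscr B_1)$, are pairwise distinct; (v) the vectors $(\mu_1^{\otimes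 t})_{\Omega_t},\dots,(\mu_r^{\otimes t})_{\Omega_t}$ are linearly independent. Then there are constants $C,\epsilon_0>0$, depending only on the mixture parameters, on $\xi$ and on the integers $n,m,r,p,k,t$, such that for all symmetric real tensors $\widehat M_m,\widehat M_t$ with $\epsilon:=\max(\|\widehat M_m-M_m\|,\|\widehat M_t-M_t\|)<\epsilon_0$ the algorithm has an output, and every output satisfies, after a permutation of its components and for some real scalars $s_i$ with $s_i^m=s_i^t=1$, $$\|s_i\mu_i^*-\mu_i\|\le C\epsilon,\qquad |\omega_i^*-\omega_i|\le C\epsilon,\qquad \|\Sigma_i^*-\Sigma_i\|\le C\epsilon\qquad(i=1,\dots,r).$$ (So $s_i=1$ unless $m$ and $t$ are both even, in which case $s_i=\pm1$.) -/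

import Mathlib

open MeasureTheory ProbabilityTheory
open scoped NNReal

noncomputable section

namespace GMM

/-! ## Tensors -/

/-- Tensors of order `m` over `𝕜 ^ d`; labels start with `0`. -/
abbrev Tensor (𝕜 : Type*) (m d : ℕ) : Type _ := (Fin m → Fin d) → 𝕜

/-- The tensor power `x ^ ⊗m`. -/
def tpow {𝕜 : Type*} [CommRing 𝕜] {d : ℕ} (x : Fin d → 𝕜) (m : ℕ) : Tensor 𝕜 m d :=
  fun i => ∏ a, x (i a)

/-- Invariance of the entries under permutations of the labels. -/
def IsSymmTensor {𝕜 : Type*} {m d : ℕ} (T : Tensor 𝕜 m d) : Prop :=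
  ∀ (s : Equiv.Perm (Fin m)) (i : Fin m → Fin d), T (i ∘ s) = T i

/-- The Euclidean (Frobenius, Hilbert–Schmidt) norm of a finite family of numbers. -/
def l2norm {ι E : Type*} [Fintype ι] [NormedAddCommGroup E] (x : ι → E) : ℝ :=
  ‖(WithLp.toLp 2 x : PiLp 2 (fun _ : ι => E))‖

/-- The Frobenius norm of a square real matrix. -/
def frobNorm {d : ℕ} (A : Matrix (Fin d) (Fin d) ℝ) : ℝ :=
  l2norm (fun ij : Fin d × Fin d => A ij.1 ij.2)

/-- The subtensor of the entries whose labels `i₁, …, iₘ` are pairwise distinct. -/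
def onOmega {𝕜 : Type*} {m d : ℕ} (T : Tensor 𝕜 m d) : (Fin m ↪ Fin d) → 𝕜 :=
  fun e => T e

/-- The entry of a symmetric tensor of order `m` labelled by the `m` distinct elements of `S`
(taken in increasing order). It is only used for sets `S` of cardinality `m`. -/
def entry {𝕜 : Type*} [Zero 𝕜] {m d : ℕ} (T : Tensor 𝕜 m d) (S : Finset (Fin d)) : 𝕜 :=
  if h : S.card = m then T (S.orderEmbOfFin h) else 0

/-! ## Square-free monomials

A square-free monomial in `x₀, …, xₙ` is the finite set of the labels of its variables. The
convention `x₀ = 1`, by which a monomial in `x₁, …, xₙ` of degree `m - 1` labels an entry of a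
tensor of order `m`, is written out as `insert 0`. -/

/-- The value at `x` of the monomial with label set `S`. -/
def evalMon {𝕜 : Type*} [CommRing 𝕜] {d : ℕ} (S : Finset (Fin d)) (x : Fin d → 𝕜) : 𝕜 :=
  ∏ j ∈ S, x j

/-- The labels `1, …, k`. -/
def low (n k : ℕ) : Finset (Fin (n + 1)) :=
  Finset.univ.filter (fun j => 1 ≤ (j : ℕ) ∧ (j : ℕ) ≤ k)

/-- The labels `k + 1, …, n`. -/
def high (n k : ℕ) : Finset (Fin (n + 1)) :=
  Finset.univ.filter (fun j => k + 1 ≤ (j : ℕ))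

/-- For square-free monomials of equal degree: `S` comes before `S'` in the graded lexicographic
order (`x₁x₂, x₁x₃, …, x₂x₃, …`), i.e. at the first variable where they differ, `S` has it. -/
def GrlexBefore {d : ℕ} (S S' : Finset (Fin d)) : Prop :=
  ∃ x ∈ S, x ∉ S' ∧ ∀ y, y < x → (y ∈ S ↔ y ∈ S')

instance {d : ℕ} (S S' : Finset (Fin d)) : Decidable (GrlexBefore S S') := by
  unfold GrlexBefore; infer_instance

/-- The square-free monomials of degree `p` in `x₁, …, x_k`. -/
def J1 (n k p : ℕ) : Finset (Finset (Fin (n + 1))) := (low n k).powersetCard p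

/-- The square-free monomials of degree `q` in `x_{k+1}, …, x_n`. -/
def J2 (n k q : ℕ) : Finset (Finset (Fin (n + 1))) := (high n k).powersetCard q

/-- The first `r` elements of `J1` in the graded lexicographic order. -/
def B0 (n k p r : ℕ) : Finset (Finset (Fin (n + 1))) :=
  (J1 n k p).filter (fun S => ((J1 n k p).filter (fun S' => GrlexBefore S' S)).card < r)

lemma mem_J1_of_mem_B0 {n k p r : ℕ} {S : Finset (Fin (n + 1))} (h : S ∈ B0 n k p r) :
    S ∈ J1 n k p := (Finset.mem_filter.1 h).1

/-- The monomials `x_{j₁} ⋯ x_{j_p} x_{j_{p+1}}` with `1 ≤ j₁ < ⋯ < j_p ≤ k < j_{p+1} ≤ n`; the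
pair `(S, l)` stands for the monomial with label set `insert l S`. -/
abbrev B1 (n k p : ℕ) : Type := ↥(J1 n k p) × ↥(high n k)

/-- The set `O_α` for `α = (S, l)`, with `q = m - p - 1`: square-free monomials of degree `q` in
the variables `x_{k+1}, …, x_n` other than `x_l`. -/
def Oset (n k q : ℕ) (l : Fin (n + 1)) : Finset (Finset (Fin (n + 1))) :=
  ((high n k).erase l).powersetCard q

/-! ## Generating matrices -/

section Generating

variable {n m : ℕ} (r p k : ℕ)

/-- The matrix `A[α, T]`. -/
def matA (T : Tensor ℝ m (n + 1)) (α : B1 n k p) :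
    Matrix ↥(Oset n k (m - p - 1) α.2.1) ↥(B0 n k p r) ℂ :=
  fun γ β => ((entry T (insert 0 (β.1 ∪ γ.1)) : ℝ) : ℂ)

/-- The vector `b[α, T]`. -/
def vecb (T : Tensor ℝ m (n + 1)) (α : B1 n k p) : ↥(Oset n k (m - p - 1) α.2.1) → ℂ :=
  fun γ => ((entry T (insert α.2.1 α.1.1 ∪ γ.1) : ℝ) : ℂ)

/-- `G` solves the linear systems `A[α, T] G(:, α) = b[α, T]` for all `α`. -/
def SolvesG (T : Tensor ℝ m (n + 1)) (G : Matrix ↥(B0 n k p r) (B1 n k p) ℂ) : Prop :=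
  ∀ α, (matA r p k T α).mulVec (fun β => G β α) = vecb p k T α

variable {r p k}

/-- The matrix `N_l(G)`, with entries `N_l(G)_{ν, β} = G(β, ν + e_l)`. -/
def Nmat (G : Matrix ↥(B0 n k p r) (B1 n k p) ℂ) (l : ↥(high n k)) :
    Matrix ↥(B0 n k p r) ↥(B0 n k p r) ℂ :=
  fun ν β => G β (⟨ν.1, mem_J1_of_mem_B0 ν.2⟩, l)

/-- `N(ξ) = ξ_{k+1} N_{k+1}(G) + ⋯ + ξ_n N_n(G)`. -/
def Nxi (ξ : ↥(high n k) → ℂ) (G : Matrix ↥(B0 n k p r) (B1 n k p) ℂ) :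
    Matrix ↥(B0 n k p r) ↥(B0 n k p r) ℂ :=
  ∑ l, ξ l • Nmat G l

/-- The numbers `eᴴ N_l(G) e` for the labels `l = k+1, …, n` (and `0` at the other labels). -/
def wVec (G : Matrix ↥(B0 n k p r) (B1 n k p) ℂ) (e : ↥(B0 n k p r) → ℂ) : Fin (n + 1) → ℂ :=
  fun j => if h : j ∈ high n k then star e ⬝ᵥ (Nmat G ⟨j, h⟩).mulVec e else 0

/-- The vector `(1, v, w)`: label `0`, labels `1, …, k`, labels `k+1, …, n`. -/
def joinVec (v : ↥(low n k) → ℂ) (w : Fin (n + 1) → ℂ) : Fin (n + 1) → ℂ :=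
  fun j => if h : j ∈ low n k then v ⟨j, h⟩ else if j ∈ high n k then w j else 1

end Generating

/-! ## Incomplete symmetric tensor approximation -/

/-- The data computed in a run of the incomplete symmetric tensor approximation algorithm on the
entries of `T` with distinct labels, for the rank `r`, the constants `p, k` and the vector `ξ`.
A least squares problem is solved by any one of its minimizers. The final nonlinear problem is
also solved to a (global) minimizer; `qHat` is the starting point given to the solver. -/
structure ApproxRun {n m : ℕ} (r p k : ℕ) (T : Tensor ℝ m (n + 1)) (ξ : ↥(high n k) → ℂ) where
  /-- Step 1: the approximate generating matrix, column by column. -/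
  G : Matrix ↥(B0 n k p r) (B1 n k p) ℂ
  G_min : ∀ α, IsMinOn
    (fun g : ↥(B0 n k p r) → ℂ => l2norm ((matA r p k T α).mulVec g - vecb p k T α) ^ 2)
    Set.univ (fun β => G β α)
  /-- Step 2: unit eigenvectors of `N(ξ)`, and the vectors `w`. -/
  e : Fin r → ↥(B0 n k p r) → ℂ
  e_unit : ∀ i, l2norm (e i) = 1
  e_indep : LinearIndependent ℂ e
  e_eigen : ∀ i, ∃ c : ℂ, (Nxi ξ G).mulVec (e i) = c • e i
  w : Fin r → Fin (n + 1) → ℂ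
  w_eq : ∀ i, w i = wVec G (e i)
  /-- Step 3: three linear least squares problems. -/
  gam : Fin r → ↥(J1 n k p) → ℂ
  gam_min : IsMinOn
    (fun g : Fin r → ↥(J1 n k p) → ℂ =>
      l2norm (fun SU : ↥(J1 n k p) × ↥(J2 n k (m - p - 1)) =>
        ((entry T (insert 0 (SU.1.1 ∪ SU.2.1)) : ℝ) : ℂ)
          - ∑ i, g i SU.1 * evalMon SU.2.1 (w i)) ^ 2)
    Set.univ gam
  v : Fin r → ↥(low n k) → ℂ
  v_min : ∀ j : ↥(low n k), IsMinOn
    (fun c : Fin r → ℂ =>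
      l2norm (fun SU : {S : ↥(J1 n k p) // j.1 ∉ S.1} × ↥(J2 n k (m - p - 1)) =>
        ((entry T (insert j.1 (SU.1.1.1 ∪ SU.2.1)) : ℝ) : ℂ)
          - ∑ i, c i * (gam i SU.1.1 * evalMon SU.2.1 (w i))) ^ 2)
    Set.univ (fun i => v i j)
  lam : Fin r → ℂ
  lam_min : IsMinOn
    (fun c : Fin r → ℂ =>
      l2norm (fun a : Fin m ↪ Fin (n + 1) =>
        ((onOmega T a : ℝ) : ℂ) - ∑ i, c i * onOmega (tpow (joinVec (v i) (w i)) m) a) ^ 2)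
    Set.univ lam
  /-- Step 4: the starting point (with principal `m`-th roots) and the nonlinear optimization. -/
  qHat : Fin r → Fin (n + 1) → ℂ
  qHat_eq : ∀ i, qHat i = (lam i) ^ (1 / (m : ℂ)) • joinVec (v i) (w i)
  q : Fin r → Fin (n + 1) → ℂ
  q_min : IsMinOn
    (fun x : Fin r → Fin (n + 1) → ℂ =>
      l2norm (fun a : Fin m ↪ Fin (n + 1) =>
        ((onOmega T a : ℝ) : ℂ) - ∑ i, onOmega (tpow (x i) m) a) ^ 2)
    Set.univ q

/-! ## Learning diagonal Gaussian mixtures -/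

/-- Pairs (weights, means): the weights form a probability vector, the means are arbitrary. -/
def feasible (r d : ℕ) : Set ((Fin r → ℝ) × (Fin r → Fin d → ℝ)) :=
  {x | ∑ i, x.1 i = 1 ∧ ∀ i, 0 ≤ x.1 i}

/-- The objective function of the nonlinear least squares problem for weights and means. -/
def nlsObj {r m t d : ℕ} (Mm : Tensor ℝ m d) (Mt : Tensor ℝ t d)
    (x : (Fin r → ℝ) × (Fin r → Fin d → ℝ)) : ℝ :=
  l2norm (fun a : Fin m ↪ Fin d => onOmega Mm a - ∑ i, x.1 i * onOmega (tpow (x.2 i) m) a) ^ 2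
  + l2norm (fun a : Fin t ↪ Fin d => onOmega Mt a - ∑ i, x.1 i * onOmega (tpow (x.2 i) t) a) ^ 2

/-- The label `(j, j, i₁, …, i_{m-2})` for `U = {i₁ < ⋯ < i_{m-2}}`. -/
def labelL {m d : ℕ} (j : Fin d) (U : {U : Finset (Fin d) // U.card = m - 2 ∧ j ∉ U}) :
    Fin m → Fin d :=
  fun a => if h : (a : ℕ) < 2 then j
    else U.1.orderEmbOfFin U.2.1 ⟨(a : ℕ) - 2, by have := a.2; omega⟩

/-- The data computed in a run of the algorithm learning a diagonal Gaussian mixture with `r`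
components from the estimates `Mm`, `Mt` of the moment tensors of orders `m` and `t`. The output
consists of the weights `omega`, the means `mu` and the diagonals `theta` of the covariance
matrices. Every optimization problem is solved to a (global) minimizer; `omegaHat`, `muHat` are
the starting points given to the solver of the nonlinear problem. -/
structure LearnRun {n m t : ℕ} (r p k : ℕ) (Mm : Tensor ℝ m (n + 1)) (Mt : Tensor ℝ t (n + 1))
    (ξ : ↥(high n k) → ℂ) where
  /-- Step 1. -/
  approx : ApproxRun r p k Mm ξ
  /-- Step 2: the rotations by `m`-th roots of unity that minimize the imaginary parts. -/
  eta : Fin r → ℂ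
  eta_root : ∀ i, eta i ^ m = 1
  eta_min : ∀ i, ∀ z : ℂ, z ^ m = 1 →
    l2norm (fun j => (eta i * approx.q i j).im) ≤ l2norm (fun j => (z * approx.q i j).im)
  qCheck : Fin r → Fin (n + 1) → ℝ
  qCheck_eq : ∀ i j, qCheck i j = (eta i * approx.q i j).re
  /-- Step 3: nonnegative least squares, and first estimates of weights and means. -/
  beta : Fin r → ℝ
  beta_nonneg : ∀ i, 0 ≤ beta i
  beta_min : IsMinOn
    (fun b : Fin r → ℝ =>
      l2norm (fun a : Fin t ↪ Fin (n + 1) =>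
        onOmega Mt a - ∑ i, b i * onOmega (tpow (qCheck i) t) a) ^ 2)
    {b | ∀ i, 0 ≤ b i} beta
  omegaHat : Fin r → ℝ
  omegaHat_eq : ∀ i, omegaHat i = beta i ^ ((m : ℝ) / ((m : ℝ) - (t : ℝ)))
  muHat : Fin r → Fin (n + 1) → ℝ
  muHat_eq : ∀ i j, muHat i j = qCheck i j / beta i ^ (1 / ((m : ℝ) - (t : ℝ)))
  /-- Step 4: nonlinear least squares for weights and means. -/
  omega : Fin r → ℝ
  mu : Fin r → Fin (n + 1) → ℝ
  feas : (omega, mu) ∈ feasible r (n + 1)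
  nls_min : IsMinOn (nlsObj Mm Mt) (feasible r (n + 1)) (omega, mu)
  /-- Step 5: nonnegative least squares for the variances. -/
  theta : Fin r → Fin (n + 1) → ℝ
  theta_nonneg : ∀ i j, 0 ≤ theta i j
  theta_min : ∀ j, IsMinOn
    (fun c : Fin r → ℝ =>
      l2norm (fun U : {U : Finset (Fin (n + 1)) // U.card = m - 2 ∧ j ∉ U} =>
        (Mm (labelL j U) - ∑ i, tpow (qCheck i) m (labelL j U))
          - ∑ i, c i * (omega i * tpow (mu i) (m - 2) (U.1.orderEmbOfFin U.2.1))) ^ 2)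
    {c | ∀ i, 0 ≤ c i} (fun i => theta i j)

/-! ## The model -/

/-- The law of the diagonal Gaussian mixture: the convex combination with weights `ω i` of the
Gaussian laws with mean `μ i` and covariance `diag (v i 0, …, v i (d-1))` (the product of the
one-dimensional Gaussian laws). -/
def mixture {r d : ℕ} (ω : Fin r → ℝ) (μ : Fin r → Fin d → ℝ) (v : Fin r → Fin d → ℝ≥0) :
    Measure (Fin d → ℝ) :=
  ∑ i, ENNReal.ofReal (ω i) • Measure.pi (fun j => gaussianReal (μ i j) (v i j))

/-- The moment tensor `E[y ^ ⊗m]` of a law on `ℝ ^ d`. -/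
def moment {d : ℕ} (P : Measure (Fin d → ℝ)) (m : ℕ) : Tensor ℝ m d :=
  fun i => ∫ y, tpow y m i ∂P

/-- The tensor `∑ ω_i μ_i ^ ⊗m`. -/
def tensorF {r d : ℕ} (ω : Fin r → ℝ) (μ : Fin r → Fin d → ℝ) (m : ℕ) : Tensor ℝ m d :=
  fun a => ∑ i, ω i * tpow (μ i) m a

end GMM

end

/-! Entries of `M_m` with distinct labels involve every Gaussian coordinate at most once, so there
`M_m` coincides with `F_m = ∑ y_i^{⊗m}`, where `y_i = ρ_i μ_i` and `ρ_i = ω_i^{1/m}`. The same holds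
in order `t`. The estimate of an output uses only global minimality: the minimizers of steps 1(d)
and 4 have residuals no larger than that of the truth, hence `O(ε)`. Steps 1(a)–(c) and 3 merely
have to be executable.

The core is `exists_stability`: if `∑ q_i^{⊗m}` agrees with `∑ y_i^{⊗m}` up to `ε` on distinct
labels, then `q_i = y_i + O(ε)` up to order and `m`-th roots of unity. Contracting with dual
families of `[y_i]_{B0}` and `[y_i]_{O_l}` gives matrices close to `diag(y_{i0})` and
`diag(y_{il})`, both factored through the same matrix `A` built from the `q_i`. So the
`diag(q_{il}/q_{i0})` are conjugated by `A` to matrices near `diag(y_{il}/y_{i0})`. Since the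
combination with `ξ` has simple spectrum, the eigenvalues are controlled to first order. Linear
systems then recover the remaining ratios and `q_{i0}^m`.

As the `y_i` are real with nonzero leading entry, the rotation of step 2 leaves only a sign
(`exists_bound_rotated`). In step 4 stability controls `ρ'_i μ'_i`, and the moments of order `t`,
through (v), separate `ρ'_i` from `μ'_i` and force the sign to satisfy `s^t = 1`
(`near_weights_means`). In step 5 subtracting `∑ y_i^{⊗m}` from the entries `jji₁…` leaves a linear
system in the variances with independent columns, and the true variances are an admissible
competitor (`exists_bound_variances`).

For existence of a run, (iv) yields the eigenvectors by perturbation of the characteristic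
polynomial. Linear and nonnegative least squares are projections onto closed sets, and stability
bounds the sublevel sets of the nonlinear problems.

Uniformity comes from `Near`: its parameter type `Q` is taken to be the set of all admissible
perturbed data, including the chosen minimizers, with `e` the size of the error. A single `O(e)`
statement then yields constants valid for every output. -/

namespace GMM

open Filter Topology Asymptotics

/-! ## First order closeness -/

/-- `f = f0 + O(e)` as `e → 0`. -/
def Near {Q E : Type*} [NormedAddCommGroup E] (e : Q → ℝ) (f : Q → E) (f0 : E) : Prop :=
  (fun q => f q - f0) =O[comap e (𝓝 0)] e

section Near

variable {Q E E' : Type*} [NormedAddCommGroup E] [NormedAddCommGroup E'] {e : Q → ℝ}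

lemma eventually_comap_zero {P : Q → Prop} :
    (∀ᶠ q in comap e (𝓝 0), P q) ↔ ∃ δ > 0, ∀ q, |e q| < δ → P q := by
  rw [(Metric.nhds_basis_ball.comap e).eventually_iff]
  simp [Set.mem_preimage, Metric.mem_ball, dist_zero_right]

/-- The constants do not depend on `q`; this is how asymptotic statements become bounds uniform over
all perturbed data. -/
lemma near_iff {f : Q → E} {f0 : E} :
    Near e f f0 ↔ ∃ C > 0, ∃ δ > 0, ∀ q, |e q| < δ → ‖f q - f0‖ ≤ C * |e q| := by
  unfold Near
  rw [isBigO_iff']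
  simp only [eventually_comap_zero, Real.norm_eq_abs]

lemma near_of_le {f : Q → E} {f0 : E} (C : ℝ) (h : ∀ q, ‖f q - f0‖ ≤ C * |e q|) :
    Near e f f0 :=
  IsBigO.of_bound C (Eventually.of_forall h)

lemma Near.tendsto {f : Q → E} {f0 : E} (h : Near e f f0) :
    Tendsto f (comap e (𝓝 0)) (𝓝 f0) := by
  have h1 := h.trans_tendsto tendsto_comap
  simpa using h1.add_const f0

lemma near_const (c : E) : Near e (fun _ => c) c := by
  simp only [Near, sub_self]; exact isBigO_zero _ _

lemma Near.congr' {f g : Q → E} {f0 : E} (h : Near e f f0)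
    (hfg : ∀ᶠ q in comap e (𝓝 0), f q = g q) : Near e g f0 :=
  IsBigO.congr' h (hfg.mono fun q hq => by simp [hq]) EventuallyEq.rfl

lemma Near.congr {f g : Q → E} {f0 : E} (h : Near e f f0) (hfg : ∀ q, f q = g q) : Near e g f0 :=
  h.congr' (Eventually.of_forall hfg)

lemma Near.sub {f g : Q → E} {f0 g0 : E} (hf : Near e f f0) (hg : Near e g g0) :
    Near e (fun q => f q - g q) (f0 - g0) :=
  (IsBigO.sub hf hg).congr_left fun _ => sub_sub_sub_comm _ _ _ _

lemma Near.sum {ι : Type*} {s : Finset ι} {f : Q → ι → E} {f0 : ι → E}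
    (h : ∀ i ∈ s, Near e (fun q => f q i) (f0 i)) :
    Near e (fun q => ∑ i ∈ s, f q i) (∑ i ∈ s, f0 i) :=
  (IsBigO.fun_sum (A := fun i q => f q i - f0 i) h).congr_left fun q => by
    simp [Finset.sum_sub_distrib]

/-- Only the limit point is compared with, so differentiability there suffices. -/
lemma Near.map (𝕜 : Type*) [NontriviallyNormedField 𝕜] [NormedSpace 𝕜 E] [NormedSpace 𝕜 E']
    {f : Q → E} {f0 : E} {F : E → E'} (hf : Near e f f0) (hF : DifferentiableAt 𝕜 F f0) :
    Near e (fun q => F (f q)) (F f0) :=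
  (hF.isBigO_sub.comp_tendsto hf.tendsto).trans hf

lemma near_pi {ι : Type*} [Fintype ι] {f : Q → ι → E} {f0 : ι → E} :
    Near e f f0 ↔ ∀ i, Near e (fun q => f q i) (f0 i) := by
  unfold Near; rw [isBigO_pi]; rfl

lemma Near.prodMk {f : Q → E} {f0 : E} {g : Q → E'} {g0 : E'} (hf : Near e f f0)
    (hg : Near e g g0) : Near e (fun q => (f q, g q)) (f0, g0) :=
  IsBigO.prod_left hf hg

variable {𝕜 : Type*} [NontriviallyNormedField 𝕜] {f g : Q → 𝕜} {f0 g0 : 𝕜}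

lemma Near.mul (hf : Near e f f0) (hg : Near e g g0) :
    Near e (fun q => f q * g q) (f0 * g0) :=
  (hf.prodMk hg).map 𝕜 (F := fun p : 𝕜 × 𝕜 => p.1 * p.2) (by fun_prop)

lemma Near.div (hf : Near e f f0) (hg : Near e g g0) (h0 : g0 ≠ 0) :
    Near e (fun q => f q / g q) (f0 / g0) := by
  simp only [div_eq_mul_inv]
  exact hf.mul (hg.map 𝕜 (F := fun x : 𝕜 => x⁻¹) (differentiableAt_inv h0))

lemma Near.pow (hf : Near e f f0) (n : ℕ) : Near e (fun q => f q ^ n) (f0 ^ n) :=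
  hf.map 𝕜 (F := fun x : 𝕜 => x ^ n) (by fun_prop)

lemma Near.prod {ι : Type*} {s : Finset ι} {f : Q → ι → 𝕜} {f0 : ι → 𝕜}
    (h : ∀ i ∈ s, Near e (fun q => f q i) (f0 i)) :
    Near e (fun q => ∏ i ∈ s, f q i) (∏ i ∈ s, f0 i) := by
  classical
  induction s using Finset.induction_on with
  | empty => simpa using near_const (1 : 𝕜)
  | insert a s ha ih =>
    simp only [Finset.prod_insert ha]
    exact (h a (by simp)).mul (ih fun i hi => h i (by simp [hi]))

lemma Near.eventually_ne (hf : Near e f f0) (h0 : f0 ≠ 0) :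
    ∀ᶠ q in comap e (𝓝 0), f q ≠ 0 :=
  hf.tendsto.eventually_ne h0

lemma near_ofReal {f : Q → ℝ} {f0 : ℝ} :
    Near e (fun q => ((f q : ℝ) : ℂ)) (f0 : ℂ) ↔ Near e f f0 := by
  unfold Near
  rw [← isBigO_norm_left, ← isBigO_norm_left (f' := fun q => f q - f0)]
  simp only [← Complex.ofReal_sub, Complex.norm_real]

lemma Near.tpow {d m : ℕ} {x : Q → Fin d → 𝕜} {x0 : Fin d → 𝕜}
    (h : ∀ j, Near e (fun q => x q j) (x0 j)) (a : Fin m → Fin d) :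
    Near e (fun q => tpow (x q) m a) (tpow x0 m a) :=
  Near.prod fun i _ => h (a i)

lemma Near.evalMon {d : ℕ} {x : Q → Fin d → 𝕜} {x0 : Fin d → 𝕜} (S : Finset (Fin d))
    (h : ∀ j ∈ S, Near e (fun q => x q j) (x0 j)) :
    Near e (fun q => evalMon S (x q)) (evalMon S x0) :=
  Near.prod h

end Near

/-! ## Linear systems -/

/-- A linearly independent family of coordinate vectors has a dual family. -/
lemma exists_dual {𝕜 ι κ : Type*} [Field 𝕜] [Fintype ι] [DecidableEq ι] [Fintype κ]
    {v : ι → κ → 𝕜} (h : LinearIndependent 𝕜 v) :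
    ∃ B : ι → κ → 𝕜, ∀ i j, ∑ k, B i k * v j k = if i = j then 1 else 0 := by
  classical
  have hinj : LinearMap.ker (Fintype.linearCombination 𝕜 v) = ⊥ :=
    LinearMap.ker_eq_bot.2 (linearIndependent_iff_injective_fintypeLinearCombination.1 h)
  obtain ⟨g, hg⟩ := LinearMap.exists_leftInverse_of_injective _ hinj
  -- The dual family is the matrix of a linear left inverse of `c ↦ ∑ c_i v_i`.
  refine ⟨fun i k => g (Pi.single k 1) i, fun i j => ?_⟩
  have h1 : g (v j) = Pi.single j 1 := by
    have := LinearMap.congr_fun hg (Pi.single j 1)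
    simpa [Fintype.linearCombination_apply_single] using this
  have h2 : v j = ∑ k, v j k • (Pi.single k (1 : 𝕜) : κ → 𝕜) := by
    ext k; simp [Finset.sum_apply, Pi.single_apply]
  rw [h2, map_sum] at h1
  have h3 := congrFun h1 i
  simp only [map_smul, Finset.sum_apply, Pi.smul_apply, smul_eq_mul, Pi.single_apply] at h3
  rw [← h3]
  exact Finset.sum_congr rfl fun k _ => mul_comm _ _

/-- First order perturbation of the solution of a linear system with independent columns. -/
lemma near_of_approx_solve {Q 𝕜 ι κ : Type*} [RCLike 𝕜] [Fintype ι] [Fintype κ] {e : Q → ℝ}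
    {a : Q → κ → ι → 𝕜} {a0 : κ → ι → 𝕜} {x : Q → ι → 𝕜} {x0 : ι → 𝕜}
    (hLI : LinearIndependent 𝕜 (fun i k => a0 k i))
    (ha : ∀ k i, Near e (fun q => a q k i) (a0 k i))
    (hx : ∀ k, Near e (fun q => ∑ i, a q k i * x q i) (∑ i, a0 k i * x0 i)) (i : ι) :
    Near e (fun q => x q i) (x0 i) := by
  classical
  obtain ⟨B, hB⟩ := exists_dual hLI
  have key : ∀ q i, x q i - x0 i = ∑ k, B i k * ((∑ j, a q k j * x q j - ∑ j, a0 k j * x0 j)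
      - ∑ j, (a q k j - a0 k j) * x q j) := by
    intro q i
    have h1 : ∀ k, (∑ j, a q k j * x q j - ∑ j, a0 k j * x0 j) - ∑ j, (a q k j - a0 k j) * x q j
        = ∑ j, a0 k j * (x q j - x0 j) := by
      intro k
      rw [← Finset.sum_sub_distrib, ← Finset.sum_sub_distrib]
      exact Finset.sum_congr rfl fun j _ => by ring
    simp only [h1, Finset.mul_sum]
    rw [Finset.sum_comm]
    have h2 : ∀ j, ∑ k, B i k * (a0 k j * (x q j - x0 j))
        = (if i = j then 1 else 0) * (x q j - x0 j) := by
      intro j; rw [← hB i j, Finset.sum_mul]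
      exact Finset.sum_congr rfl fun k _ => by ring
    simp [h2]
  set D : Q → ι → 𝕜 := fun q i => x q i - x0 i with hD
  -- No bound on `x` is assumed, so the error is first estimated with the factor `1 + ‖x‖`.
  have hDO : D =O[comap e (𝓝 0)] (fun q => e q * (1 + ‖x q‖)) := by
    rw [isBigO_pi]
    intro i
    simp only [hD, key]
    refine IsBigO.fun_sum fun k _ => IsBigO.const_mul_left ?_ _
    have he1 : e =O[comap e (𝓝 0)] (fun q => e q * (1 + ‖x q‖)) := by
      refine IsBigO.of_bound 1 (Eventually.of_forall fun q => ?_)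
      rw [norm_mul, one_mul]
      refine le_mul_of_one_le_right (norm_nonneg _) ?_
      rw [Real.norm_of_nonneg (by positivity)]
      linarith [norm_nonneg (x q)]
    refine ((hx k).trans he1).sub (IsBigO.fun_sum fun j _ => ?_)
    refine IsBigO.mul (ha k j) (IsBigO.of_bound 1 (Eventually.of_forall fun q => ?_))
    rw [one_mul, Real.norm_of_nonneg (by positivity)]
    linarith [norm_le_pi_norm (x q) j]
  obtain ⟨C, hC0, hC⟩ := hDO.exists_pos
  have hsmall : ∀ᶠ q in comap e (𝓝 0), |e q| < 1 / (2 * C) :=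
    eventually_comap_zero.2 ⟨1 / (2 * C), by positivity, fun q h => h⟩
  -- From `‖D‖ ≤ C|e|(1 + ‖D‖ + ‖x0‖)` and `C|e| ≤ 1/2` the term in `‖D‖` is absorbed on the left.
  refine IsBigO.of_bound (2 * C * (1 + ‖x0‖)) ?_
  filter_upwards [hC.bound, hsmall] with q h1 h2
  have h3 : ‖x q‖ ≤ ‖D q‖ + ‖x0‖ := by
    have : x q = D q + x0 := by ext i; simp [hD]
    rw [this]; exact norm_add_le _ _
  rw [norm_mul, Real.norm_of_nonneg (by positivity : 0 ≤ 1 + ‖x q‖), Real.norm_eq_abs] at h1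
  rw [Real.norm_eq_abs]
  have h4 : C * |e q| ≤ 1 / 2 := by
    rw [lt_div_iff₀ (by positivity)] at h2; linarith
  have h5 : ‖x q i - x0 i‖ ≤ ‖D q‖ := norm_le_pi_norm (D q) i
  nlinarith [norm_nonneg (D q), abs_nonneg (e q), mul_le_mul_of_nonneg_left h3
    (mul_nonneg hC0.le (abs_nonneg (e q))), mul_le_mul_of_nonneg_right h4 (norm_nonneg (D q))]

/-! ### Euclidean norm versus entries -/

lemma norm_le_l2norm {ι E : Type*} [Fintype ι] [NormedAddCommGroup E] (x : ι → E) (i : ι) :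
    ‖x i‖ ≤ l2norm x :=
  PiLp.norm_apply_le (WithLp.toLp 2 x : PiLp 2 (fun _ : ι => E)) i

lemma l2norm_nonneg {ι E : Type*} [Fintype ι] [NormedAddCommGroup E] (x : ι → E) :
    0 ≤ l2norm x := norm_nonneg _

lemma l2norm_le_sum {ι E : Type*} [Fintype ι] [NormedAddCommGroup E] (x : ι → E) :
    l2norm x ≤ ∑ i, ‖x i‖ := by
  unfold l2norm
  rw [PiLp.norm_eq_of_L2]
  refine Real.sqrt_le_iff.2 ⟨Finset.sum_nonneg fun i _ => norm_nonneg _, ?_⟩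
  exact Finset.sum_sq_le_sq_sum_of_nonneg fun i _ => norm_nonneg _

/-! ## Perturbation of eigenvectors -/

/-- If all factors were at least `δ`, so would the product be at least `δ ^ card`. Applied to a
characteristic polynomial, a small value at `c` produces a root near `c`. -/
lemma exists_mem_norm_sub_lt {s : Multiset ℂ} {c : ℂ} {δ : ℝ} (hδ : 0 < δ)
    (h : ‖(s.map fun a => c - a).prod‖ < δ ^ Multiset.card s) : ∃ a ∈ s, ‖c - a‖ < δ := by
  by_contra! hcon
  refine absurd h (not_lt.2 ?_)
  clear h
  induction s using Multiset.induction_on with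
  | empty => simp
  | cons a s ih =>
    simp only [Multiset.map_cons, Multiset.prod_cons, Multiset.card_cons, norm_mul, pow_succ']
    exact mul_le_mul (hcon a (by simp)) (ih fun b hb => hcon b (by simp [hb])) (by positivity)
      (norm_nonneg _)

lemma exists_separation {r : ℕ} {z0 : Fin r → ℂ} (h : Function.Injective z0) :
    ∃ δ > 0, ∀ i j, i ≠ j → 2 * δ ≤ ‖z0 i - z0 j‖ := by
  obtain ⟨δ, hδ, hs⟩ : ∃ δ > 0, ∀ ij : Fin r × Fin r, ij.1 ≠ ij.2 →
      δ ≤ ‖z0 ij.1 - z0 ij.2‖ := by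
    by_cases hne : (Finset.univ.filter fun ij : Fin r × Fin r => ij.1 ≠ ij.2).Nonempty
    · obtain ⟨ij, hij, hmin⟩ := Finset.exists_min_image _ (fun ij => ‖z0 ij.1 - z0 ij.2‖) hne
      refine ⟨‖z0 ij.1 - z0 ij.2‖, ?_, fun kl hkl => hmin kl (by simp [hkl])⟩
      exact norm_pos_iff.2 (sub_ne_zero.2 fun hc => (Finset.mem_filter.1 hij).2 (h hc))
    · rw [Finset.not_nonempty_iff_eq_empty, Finset.filter_eq_empty_iff] at hne
      exact ⟨1, one_pos, fun ij hij => absurd hij (hne (Finset.mem_univ ij))⟩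
  exact ⟨δ / 2, by positivity, fun i j hij => by linarith [hs (i, j) hij]⟩

lemma injective_of_close {r : ℕ} {z0 : Fin r → ℂ} {δ : ℝ}
    (hsep : ∀ i j, i ≠ j → 2 * δ ≤ ‖z0 i - z0 j‖) {κ : Type*} {z : κ → ℂ} {f : Fin r → κ}
    (hf : ∀ j, ‖z0 j - z (f j)‖ < δ) : Function.Injective f := by
  intro i j hij
  by_contra hne
  have h1 := hsep i j hne
  have h2 := hf i
  have h3 := hf j
  rw [← hij, norm_sub_rev] at h3
  have := norm_add_le (z0 i - z (f i)) (z (f i) - z0 j)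
  rw [sub_add_sub_cancel] at this
  linarith

/-- Each `z0 j` has some `z i` within `δ`; by separation no `z i` serves two of them, and an
injective self-map of `Fin r` is a permutation. -/
lemma exists_perm_close {r : ℕ} {z0 z : Fin r → ℂ} {δ : ℝ} (hδ : 0 < δ)
    (hsep : ∀ i j, i ≠ j → 2 * δ ≤ ‖z0 i - z0 j‖)
    (h : ∀ j, ‖∏ i, (z0 j - z i)‖ < δ ^ r) :
    ∃ τ : Equiv.Perm (Fin r), ∀ j, ‖z0 j - z (τ j)‖ < δ := by
  have h1 : ∀ j, ∃ i, ‖z0 j - z i‖ < δ := by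
    intro j
    obtain ⟨a, ha, haδ⟩ := exists_mem_norm_sub_lt (s := Finset.univ.val.map z) (c := z0 j) hδ
      (by
        rw [Multiset.map_map, Multiset.card_map, Finset.card_val, Finset.card_univ,
          Fintype.card_fin]
        exact h j)
    obtain ⟨i, -, rfl⟩ := Multiset.mem_map.1 ha
    exact ⟨i, haδ⟩
  choose f hf using h1
  exact ⟨Equiv.ofBijective f (Finite.injective_iff_bijective.1 (injective_of_close hsep hf)), hf⟩

lemma Near.det {Q ι : Type*} [Fintype ι] [DecidableEq ι] {e : Q → ℝ} {M : Q → Matrix ι ι ℂ}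
    {M0 : Matrix ι ι ℂ} (h : ∀ j k, Near e (fun q => M q j k) (M0 j k)) :
    Near e (fun q => (M q).det) M0.det := by
  simp only [Matrix.det_apply']
  exact Near.sum fun σ _ => (near_const _).mul (Near.prod fun i _ => h _ _)

/-- Eigenvectors of a matrix close to a diagonal matrix with separated entries are close to
multiples of coordinate vectors. -/
lemma near_eigenvector_ratio {Q : Type*} {e : Q → ℝ} {r : ℕ}
    {A M : Q → Matrix (Fin r) (Fin r) ℂ} {z : Q → Fin r → ℂ} {z0 : Fin r → ℂ} {δ : ℝ}
    (hδ : 0 < δ) (hsep : ∀ i j, i ≠ j → 2 * δ ≤ ‖z0 i - z0 j‖)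
    (hM : ∀ j k, Near e (fun q => M q j k) (Matrix.diagonal z0 j k))
    (hA : ∀ᶠ q in comap e (𝓝 0), (A q).det ≠ 0)
    (hMA : ∀ᶠ q in comap e (𝓝 0), M q * A q = A q * Matrix.diagonal (z q))
    (hz : ∀ q i, ‖z0 i - z q i‖ < δ) (i : Fin r) :
    (∀ᶠ q in comap e (𝓝 0), A q i i ≠ 0) ∧
      ∀ j, Near e (fun q => A q j i / A q i i) (if j = i then 1 else 0) := by
  have hE : (fun q => ∑ jk : Fin r × Fin r, ‖M q jk.1 jk.2 - Matrix.diagonal z0 jk.1 jk.2‖)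
      =O[comap e (𝓝 0)] e :=
    IsBigO.fun_sum fun jk _ => (hM jk.1 jk.2).norm_left
  obtain ⟨K, hK0, hK⟩ := hE.exists_pos
  have hsmall : ∀ᶠ q in comap e (𝓝 0), |e q| < δ / K :=
    eventually_comap_zero.2 ⟨δ / K, by positivity, fun q h => h⟩
  have key : ∀ᶠ q in comap e (𝓝 0), A q i i ≠ 0 ∧
      ∀ j, j ≠ i → ‖A q j i‖ * δ ≤ K * |e q| * ‖A q i i‖ := by
    filter_upwards [hA, hMA, hsmall, hK.bound] with q h1 h2 h3 h4
    rw [Real.norm_of_nonneg (by positivity), Real.norm_eq_abs] at h4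
    rw [lt_div_iff₀ hK0, mul_comm] at h3
    -- Work with the largest entry of column `i`, at first in an unknown row `k`. Row `j` of `M A =
    -- A diag z` bounds the entry in row `j ≠ i` by this maximum times `K|e|/δ`.
    obtain ⟨k, -, hk⟩ := Finset.exists_max_image Finset.univ (fun j => ‖A q j i‖) ⟨i, by simp⟩
    have hk0 : A q k i ≠ 0 := by
      intro h0
      refine h1 (Matrix.det_eq_zero_of_column_eq_zero i fun j => ?_)
      have := hk j (by simp)
      rw [h0, norm_zero] at this
      exact norm_le_zero_iff.1 this
    have hrow : ∀ j, j ≠ i → ‖A q j i‖ * δ ≤ K * |e q| * ‖A q k i‖ := by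
      intro j hj
      have e1 := congrFun (congrFun h2 j) i
      rw [Matrix.mul_diagonal, Matrix.mul_apply] at e1
      have e2 : (z0 j - z q i) * A q j i
          = -∑ l, (M q j l - Matrix.diagonal z0 j l) * A q l i := by
        simp only [sub_mul, Finset.sum_sub_distrib, e1, Matrix.diagonal_apply, ite_mul, zero_mul,
          Finset.sum_ite_eq, Finset.mem_univ, if_true]
        ring
      have e3 : ‖∑ l, (M q j l - Matrix.diagonal z0 j l) * A q l i‖
          ≤ K * |e q| * ‖A q k i‖ := by
        calc _ ≤ ∑ l, ‖M q j l - Matrix.diagonal z0 j l‖ * ‖A q k i‖ := by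
              refine norm_sum_le_of_le _ fun l _ => ?_
              rw [norm_mul]
              exact mul_le_mul_of_nonneg_left (hk l (by simp)) (norm_nonneg _)
          _ = (∑ l, ‖M q j l - Matrix.diagonal z0 j l‖) * ‖A q k i‖ := by rw [Finset.sum_mul]
          _ ≤ _ := by
              refine mul_le_mul_of_nonneg_right (le_trans ?_ h4) (norm_nonneg _)
              rw [Fintype.sum_prod_type]
              exact Finset.single_le_sum (f := fun j => ∑ l, ‖M q j l - Matrix.diagonal z0 j l‖)
                (fun j _ => Finset.sum_nonneg fun l _ => norm_nonneg _) (Finset.mem_univ j)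
      have e4 : δ ≤ ‖z0 j - z q i‖ := by
        have := norm_add_le (z0 j - z q i) (z q i - z0 i)
        rw [sub_add_sub_cancel, norm_sub_rev (z q i)] at this
        linarith [hsep j i hj, hz q i]
      calc ‖A q j i‖ * δ ≤ ‖A q j i‖ * ‖z0 j - z q i‖ :=
            mul_le_mul_of_nonneg_left e4 (norm_nonneg _)
        _ = ‖(z0 j - z q i) * A q j i‖ := by rw [norm_mul, mul_comm]
        _ ≤ _ := by rw [e2, norm_neg]; exact e3
    -- Otherwise the maximal entry would be bounded by itself times `K|e|/δ < 1`.
    have hki : k = i := by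
      by_contra hne
      have h5 := hrow k hne
      have h6 := norm_pos_iff.2 hk0
      nlinarith
    rw [hki] at hk0 hrow
    exact ⟨hk0, hrow⟩
  refine ⟨key.mono fun q h => h.1, fun j => ?_⟩
  by_cases hj : j = i
  · subst hj
    simp only [if_true]
    exact (near_const 1).congr' (key.mono fun q h => (div_self h.1).symm)
  · simp only [if_neg hj, Near, sub_zero]
    refine IsBigO.of_bound (K / δ) (key.mono fun q h => ?_)
    have h1 := norm_pos_iff.2 h.1
    rw [norm_div, Real.norm_eq_abs, div_le_iff₀ h1, div_mul_eq_mul_div, div_mul_eq_mul_div,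
      le_div_iff₀ hδ]
    exact h.2 j hj

/-- Eigenvalues of simultaneously diagonalizable perturbations. -/
lemma near_eigenvalue {Q : Type*} {e : Q → ℝ} {r : ℕ}
    {A M : Q → Matrix (Fin r) (Fin r) ℂ} {w : Q → Fin r → ℂ} {w0 : Fin r → ℂ} {i : Fin r}
    (hM : ∀ j k, Near e (fun q => M q j k) (Matrix.diagonal w0 j k))
    (hMA : ∀ᶠ q in comap e (𝓝 0), M q * A q = A q * Matrix.diagonal (w q))
    (hAi : ∀ᶠ q in comap e (𝓝 0), A q i i ≠ 0)
    (hA : ∀ j, Near e (fun q => A q j i / A q i i) (if j = i then 1 else 0)) :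
    Near e (fun q => w q i) (w0 i) := by
  -- Entry `(i, i)` of `M A = A diag w`, divided by `A_ii`, expresses `w_i` by quantities already
  -- controlled.
  have h1 : Near e (fun q => ∑ k, M q i k * (A q k i / A q i i))
      (∑ k, Matrix.diagonal w0 i k * (if k = i then 1 else 0)) :=
    Near.sum fun k _ => (hM i k).mul (hA k)
  simp only [mul_ite, mul_one, mul_zero, Finset.sum_ite_eq', Finset.mem_univ, if_true,
    Matrix.diagonal_apply_eq] at h1
  refine h1.congr' ?_
  filter_upwards [hMA, hAi] with q h2 h3
  have e1 := congrFun (congrFun h2 i) i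
  rw [Matrix.mul_diagonal, Matrix.mul_apply] at e1
  simp only [← mul_div_assoc]
  rw [← Finset.sum_div, e1, mul_div_cancel_left₀ _ h3]

/-! ## Square-free monomials -/

lemma zero_notMem_low {n k : ℕ} : (0 : Fin (n + 1)) ∉ low n k := by simp [low]

lemma zero_notMem_high {n k : ℕ} : (0 : Fin (n + 1)) ∉ high n k := by simp [high]

lemma disjoint_low_high {n k : ℕ} : Disjoint (low n k) (high n k) := by
  rw [Finset.disjoint_left]
  intro j h1 h2
  simp only [low, high, Finset.mem_filter, Finset.mem_univ, true_and] at h1 h2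
  omega

lemma B0_subset_low {n k p r : ℕ} (β : ↥(B0 n k p r)) : β.1 ⊆ low n k :=
  (Finset.mem_powersetCard.1 (mem_J1_of_mem_B0 β.2)).1

lemma B0_card {n k p r : ℕ} (β : ↥(B0 n k p r)) : β.1.card = p :=
  (Finset.mem_powersetCard.1 (mem_J1_of_mem_B0 β.2)).2

lemma Oset_subset {n k q : ℕ} {l : Fin (n + 1)} (γ : ↥(Oset n k q l)) :
    γ.1 ⊆ (high n k).erase l :=
  (Finset.mem_powersetCard.1 γ.2).1

lemma Oset_card {n k q : ℕ} {l : Fin (n + 1)} (γ : ↥(Oset n k q l)) : γ.1.card = q :=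
  (Finset.mem_powersetCard.1 γ.2).2

section evalMon

variable {𝕜 : Type*} [CommRing 𝕜] {d : ℕ}

lemma evalMon_insert_union {j : Fin d} {Y U : Finset (Fin d)} (x : Fin d → 𝕜) (hjY : j ∉ Y)
    (hjU : j ∉ U) (hYU : Disjoint Y U) :
    evalMon (insert j (Y ∪ U)) x = x j * evalMon Y x * evalMon U x := by
  unfold evalMon
  rw [Finset.prod_insert (by simp [hjY, hjU]), Finset.prod_union hYU, mul_assoc]

lemma card_insert_union {j : Fin d} {Y U : Finset (Fin d)} (hjY : j ∉ Y)
    (hjU : j ∉ U) (hYU : Disjoint Y U) :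
    (insert j (Y ∪ U)).card = Y.card + U.card + 1 := by
  rw [Finset.card_insert_of_notMem (by simp [hjY, hjU]), Finset.card_union_of_disjoint hYU]

lemma evalMon_smul (S : Finset (Fin d)) (c : 𝕜) (x : Fin d → 𝕜) :
    evalMon S (fun j => c * x j) = c ^ S.card * evalMon S x := by
  simp [evalMon, Finset.prod_mul_distrib]

lemma tpow_orderEmbOfFin {m : ℕ} {S : Finset (Fin d)} (h : S.card = m) (x : Fin d → 𝕜) :
    tpow x m (S.orderEmbOfFin h) = evalMon S x := by
  unfold tpow evalMon
  conv_rhs => rw [← Finset.image_orderEmbOfFin_univ S h]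
  rw [Finset.prod_image fun a _ b _ hab => (S.orderEmbOfFin h).injective hab]

lemma tpow_smul {m : ℕ} (c : 𝕜) (x : Fin d → 𝕜) (a : Fin m → Fin d) :
    tpow (fun j => c * x j) m a = c ^ m * tpow x m a := by
  simp [tpow, Finset.prod_mul_distrib]

end evalMon

/-! ## Stability of incomplete decompositions -/

section Stability

variable {Q : Type*} {e : Q → ℝ} {n m r p k : ℕ} {x : Q → Fin r → Fin (n + 1) → ℂ}
  {y : Fin r → Fin (n + 1) → ℂ}

/-- The labels `j`, `Y`, `γ` are disjoint and number `1 + p + (m - p - 1) = m`, so the sum is an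
entry with distinct labels. Its splitting into three factors is what allows a reading as a product
of matrices. -/
lemma near_sum_triple (hpm : p + 2 ≤ m)
    (hX : ∀ S : Finset (Fin (n + 1)), S.card = m →
      Near e (fun q => ∑ i, evalMon S (x q i)) (∑ i, evalMon S (y i)))
    {j l : Fin (n + 1)} {Y : Finset (Fin (n + 1))} (hY : Y.card = p) (hjY : j ∉ Y)
    (hjl : j ∉ (high n k).erase l) (hYl : Disjoint Y ((high n k).erase l))
    (γ : ↥(Oset n k (m - p - 1) l)) :
    Near e (fun q => ∑ i, x q i j * evalMon Y (x q i) * evalMon γ.1 (x q i))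
      (∑ i, y i j * evalMon Y (y i) * evalMon γ.1 (y i)) := by
  have h1 : j ∉ γ.1 := fun h => hjl (Oset_subset γ h)
  have h2 : Disjoint Y γ.1 := hYl.mono_right (Oset_subset γ)
  have h3 := hX (insert j (Y ∪ γ.1)) (by
    rw [card_insert_union hjY h1 h2, hY, Oset_card γ]; omega)
  simpa only [evalMon_insert_union _ hjY h1 h2] using h3

/-- Contracting the entries with dual families of the exact monomial vectors gives `A diag(x_c) B_lᵀ
≈ diag(y_c)` for `c = 0` and `c = l`. The right factor is common to both and cancels in the
quotient, while `A` does not depend on `l`. -/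
lemma exists_simultaneous_diagonalization (hpm : p + 2 ≤ m)
    (hX : ∀ S : Finset (Fin (n + 1)), S.card = m →
      Near e (fun q => ∑ i, evalMon S (x q i)) (∑ i, evalMon S (y i)))
    (h0 : ∀ i, y i 0 ≠ 0)
    (hB0 : LinearIndependent ℂ (fun i (β : ↥(B0 n k p r)) => evalMon β.1 (y i)))
    (hO : ∀ l : ↥(high n k), LinearIndependent ℂ
      (fun i (γ : ↥(Oset n k (m - p - 1) l.1)) => evalMon γ.1 (y i)))
    (hne : (high n k).Nonempty) :
    ∃ A : Q → Matrix (Fin r) (Fin r) ℂ,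
      (∀ᶠ q in comap e (𝓝 0), (A q).det ≠ 0 ∧ ∀ i, x q i 0 ≠ 0) ∧
      ∀ l : ↥(high n k), ∃ M : Q → Matrix (Fin r) (Fin r) ℂ,
        (∀ j c, Near e (fun q => M q j c) (Matrix.diagonal (fun i => y i l.1 / y i 0) j c)) ∧
        ∀ᶠ q in comap e (𝓝 0),
          M q * A q = A q * Matrix.diagonal (fun i => x q i l.1 / x q i 0) := by
  obtain ⟨φ, hφ⟩ := exists_dual hB0
  choose ψ hψ using fun l => exists_dual (hO l)
  set A : Q → Matrix (Fin r) (Fin r) ℂ :=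
    fun q j i => ∑ β, φ j β * evalMon β.1 (x q i) with hA
  set B : ↥(high n k) → Q → Matrix (Fin r) (Fin r) ℂ :=
    fun l q j i => ∑ γ, ψ l j γ * evalMon γ.1 (x q i) with hB
  have hP : ∀ (l : ↥(high n k)) (c : Fin (n + 1)), c ∉ low n k → c ∉ (high n k).erase l.1 →
      ∀ j i, Near e (fun q => (A q * Matrix.diagonal (fun i => x q i c) * (B l q).transpose) j i)
        (Matrix.diagonal (fun i => y i c) j i) := by
    intro l c hcl hch j i
    have h1 : Near e (fun q => ∑ β, ∑ γ, φ j β * ψ l i γ *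
          ∑ s, x q s c * evalMon β.1 (x q s) * evalMon γ.1 (x q s))
        (∑ β, ∑ γ, φ j β * ψ l i γ * ∑ s, y s c * evalMon β.1 (y s) * evalMon γ.1 (y s)) := by
      refine Near.sum fun β _ => Near.sum fun γ _ => (near_const _).mul ?_
      exact near_sum_triple hpm hX (B0_card β) (fun h => hcl (B0_subset_low β h)) hch
        ((disjoint_low_high.mono_left (B0_subset_low β)).mono_right (Finset.erase_subset _ _)) γ
    have h2 : ∀ u : Fin r → Fin (n + 1) → ℂ, ∑ β, ∑ γ, φ j β * ψ l i γ *
          ∑ s, u s c * evalMon β.1 (u s) * evalMon γ.1 (u s)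
        = ∑ s, (∑ β, φ j β * evalMon β.1 (u s)) * u s c * ∑ γ, ψ l i γ * evalMon γ.1 (u s) := by
      intro u
      simp only [Finset.sum_mul, Finset.mul_sum]
      rw [Finset.sum_comm]
      conv_rhs => rw [Finset.sum_comm]; enter [2, γ]; rw [Finset.sum_comm]
      exact Finset.sum_congr rfl fun _ _ => Finset.sum_congr rfl fun _ _ =>
        Finset.sum_congr rfl fun _ _ => by ring
    have h3 : ∑ β, ∑ γ, φ j β * ψ l i γ * ∑ s, y s c * evalMon β.1 (y s) * evalMon γ.1 (y s)
        = Matrix.diagonal (fun i => y i c) j i := by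
      rw [h2]
      simp only [hφ, hψ, ite_mul, one_mul, zero_mul, mul_ite, mul_one, mul_zero,
        Finset.sum_ite_eq, Finset.mem_univ, if_true, Matrix.diagonal_apply]
      by_cases hij : j = i
      · simp [hij]
      · simp [hij]
    rw [h3] at h1
    refine h1.congr fun q => ?_
    rw [h2, Matrix.mul_apply]
    exact Finset.sum_congr rfl fun s _ => by rw [Matrix.mul_diagonal]; rfl
  -- For `c = 0` the product is near an invertible diagonal matrix, so each of its three factors is
  -- invertible.
  have hev : ∀ᶠ q in comap e (𝓝 0), (A q).det ≠ 0 ∧ ∀ i, x q i 0 ≠ 0 := by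
    obtain ⟨l, hl⟩ := hne
    have h1 := (Near.det (hP ⟨l, hl⟩ 0 zero_notMem_low
      fun h => zero_notMem_high (Finset.mem_of_mem_erase h))).eventually_ne
      (by rw [Matrix.det_diagonal]; exact Finset.prod_ne_zero_iff.2 fun i _ => h0 i)
    refine h1.mono fun q hq => ?_
    rw [Matrix.det_mul, Matrix.det_mul, Matrix.det_diagonal] at hq
    have h2 := left_ne_zero_of_mul hq
    exact ⟨left_ne_zero_of_mul h2, fun i =>
      Finset.prod_ne_zero_iff.1 (right_ne_zero_of_mul h2) i (Finset.mem_univ i)⟩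
  refine ⟨A, hev, fun l => ⟨fun q => A q * Matrix.diagonal (fun i => x q i l.1 / x q i 0) *
    (A q)⁻¹, fun j => ?_, ?_⟩⟩
  -- Row `j` of `M = A diag(x_l/x_0) A⁻¹` solves the linear system `M P_0 = P_l` with `P_c = A
  -- diag(x_c) B_lᵀ`. Solving for it avoids any bound on `A⁻¹`.
  · refine near_of_approx_solve
      (a := fun q c i => (A q * Matrix.diagonal (fun i => x q i 0) * (B l q).transpose) i c)
      (a0 := fun c i => Matrix.diagonal (fun i => y i 0) i c) ?_
      (fun c i => hP l 0 zero_notMem_low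
        (fun h => zero_notMem_high (Finset.mem_of_mem_erase h)) i c) fun c => ?_
    · refine Matrix.linearIndependent_rows_of_det_ne_zero (A := Matrix.diagonal fun i => y i 0) ?_
      rw [Matrix.det_diagonal]; exact Finset.prod_ne_zero_iff.2 fun i _ => h0 i
    · have h1 := hP l l.1 (Finset.disjoint_right.1 disjoint_low_high l.2)
        (Finset.notMem_erase _ _) j c
      have h2 : ∑ i, Matrix.diagonal (fun i => y i 0) i c *
          Matrix.diagonal (fun i => y i l.1 / y i 0) j i
            = Matrix.diagonal (fun i => y i l.1) j c := by
        have h3 := Matrix.diagonal_mul_diagonal (fun i => y i l.1 / y i 0) (fun i => y i 0)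
        have h4 := congrFun (congrFun h3 j) c
        simp only [div_mul_cancel₀ _ (h0 _)] at h4
        rw [← h4, Matrix.mul_apply]
        exact Finset.sum_congr rfl fun _ _ => mul_comm _ _
      rw [h2]
      refine h1.congr' (hev.mono fun q hq => ?_)
      have h3 : A q * Matrix.diagonal (fun i => x q i l.1) * (B l q).transpose
          = (A q * Matrix.diagonal (fun i => x q i l.1 / x q i 0) * (A q)⁻¹) *
            (A q * Matrix.diagonal (fun i => x q i 0) * (B l q).transpose) := by
        have h4 : (A q)⁻¹ * A q = 1 := Matrix.nonsing_inv_mul _ (isUnit_iff_ne_zero.2 hq.1)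
        have h5 := Matrix.diagonal_mul_diagonal (fun i => x q i l.1 / x q i 0)
          (fun i => x q i 0)
        simp only [div_mul_cancel₀ _ (hq.2 _)] at h5
        rw [← h5]
        simp only [Matrix.mul_assoc]
        rw [← Matrix.mul_assoc (A q)⁻¹ (A q), h4, Matrix.one_mul]
      rw [h3, Matrix.mul_apply]
      exact Finset.sum_congr rfl fun _ _ => mul_comm _ _
  · refine hev.mono fun q hq => ?_
    rw [Matrix.mul_assoc, Matrix.nonsing_inv_mul _ (isUnit_iff_ne_zero.2 hq.1), Matrix.mul_one]

lemma near_combination {L : Type*} [Fintype L] {A : Q → Matrix (Fin r) (Fin r) ℂ}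
    {M : L → Q → Matrix (Fin r) (Fin r) ℂ} {w : L → Q → Fin r → ℂ} {w0 : L → Fin r → ℂ}
    (ξ : L → ℂ)
    (hM : ∀ l j c, Near e (fun q => M l q j c) (Matrix.diagonal (w0 l) j c))
    (hMA : ∀ l, ∀ᶠ q in comap e (𝓝 0), M l q * A q = A q * Matrix.diagonal (w l q)) :
    (∀ j c, Near e (fun q => (∑ l, ξ l • M l q) j c)
      (Matrix.diagonal (fun i => ∑ l, ξ l * w0 l i) j c)) ∧
    ∀ᶠ q in comap e (𝓝 0),
      (∑ l, ξ l • M l q) * A q = A q * Matrix.diagonal (fun i => ∑ l, ξ l * w l q i) := by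
  constructor
  · intro j c
    have h3 : Near e (fun q => ∑ l, ξ l * M l q j c) (∑ l, ξ l * Matrix.diagonal (w0 l) j c) :=
      Near.sum fun l _ => (near_const _).mul (hM l j c)
    have h4 : ∑ l, ξ l * Matrix.diagonal (w0 l) j c
        = Matrix.diagonal (fun i => ∑ l, ξ l * w0 l i) j c := by
      by_cases hjc : j = c
      · subst hjc; simp
      · simp [hjc]
    rw [← h4]
    exact h3.congr fun q => by simp [Matrix.sum_apply]
  · filter_upwards [eventually_all.2 hMA] with q hq
    rw [Finset.sum_mul]
    simp only [Matrix.smul_mul, hq]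
    ext j c
    simp only [Matrix.sum_apply, Matrix.smul_apply, Matrix.mul_diagonal, smul_eq_mul,
      Finset.mul_sum]
    exact Finset.sum_congr rfl fun l _ => by ring

/-- To recover coordinate `j` of component `i`, a monomial `Y` is needed that does not vanish at `y
i` and such that both `x_j Y γ` and `x_0 Y γ` are square-free for every `γ` in `O_l`. For `j` high,
take `l = j`; otherwise an element of `B0` works, modified when it contains `j`. -/
lemma exists_monomial_ne_zero (hpm : p + 2 ≤ m)
    (hB0 : LinearIndependent ℂ (fun i (β : ↥(B0 n k p r)) => evalMon β.1 (y i)))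
    (hO : ∀ l : ↥(high n k), LinearIndependent ℂ
      (fun i (γ : ↥(Oset n k (m - p - 1) l.1)) => evalMon γ.1 (y i)))
    (hne : (high n k).Nonempty) (i : Fin r) (j : Fin (n + 1)) :
    ∃ (l : ↥(high n k)) (Y : Finset (Fin (n + 1))), Y.card = p ∧ 0 ∉ Y ∧ j ∉ Y ∧
      j ∉ (high n k).erase l.1 ∧ Disjoint Y ((high n k).erase l.1) ∧ evalMon Y (y i) ≠ 0 := by
  obtain ⟨ν, hν⟩ := Function.ne_iff.1 (hB0.ne_zero i)
  have hlow := B0_subset_low ν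
  have hdis : ∀ l, Disjoint ν.1 ((high n k).erase l) := fun l =>
    (disjoint_low_high.mono_left hlow).mono_right (Finset.erase_subset _ _)
  have h0ν : (0 : Fin (n + 1)) ∉ ν.1 := fun h => zero_notMem_low (hlow h)
  by_cases hjh : j ∈ high n k
  · exact ⟨⟨j, hjh⟩, ν, B0_card ν, h0ν,
      fun h => Finset.disjoint_left.1 disjoint_low_high (hlow h) hjh, Finset.notMem_erase _ _,
      hdis j, hν⟩
  · obtain ⟨l₁, hl₁⟩ := hne
    obtain ⟨γ, hγ⟩ := Function.ne_iff.1 ((hO ⟨l₁, hl₁⟩).ne_zero i)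
    obtain ⟨l, hl⟩ : γ.1.Nonempty := Finset.card_pos.1 (by rw [Oset_card γ]; omega)
    have hlh := Finset.mem_of_mem_erase (Oset_subset γ hl)
    have hyl : y i l ≠ 0 := Finset.prod_ne_zero_iff.1 hγ l hl
    have hje : j ∉ (high n k).erase l := fun h => hjh (Finset.mem_of_mem_erase h)
    by_cases hjν : j ∈ ν.1
    · have hlν : l ∉ ν.1 := fun h => Finset.disjoint_left.1 disjoint_low_high (hlow h) hlh
      have hle : l ∉ ν.1.erase j := fun h => hlν (Finset.mem_of_mem_erase h)
      -- Trade `x_j` for a high variable `x_l` with `y i l ≠ 0`; the set `O_l` excludes exactly this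
      -- variable.
      refine ⟨⟨l, hlh⟩, insert l (ν.1.erase j), ?_, ?_, ?_, hje, ?_, ?_⟩
      · rw [Finset.card_insert_of_notMem hle, Finset.card_erase_of_mem hjν, B0_card ν]
        have := Finset.card_pos.2 ⟨j, hjν⟩
        rw [B0_card ν] at this
        omega
      · rw [Finset.mem_insert, not_or]
        exact ⟨fun h => zero_notMem_high (h ▸ hlh), fun h => h0ν (Finset.mem_of_mem_erase h)⟩
      · rw [Finset.mem_insert, not_or]
        exact ⟨fun h => hjh (h ▸ hlh), Finset.notMem_erase _ _⟩
      · rw [Finset.disjoint_insert_left]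
        exact ⟨Finset.notMem_erase _ _, (hdis l).mono_left (Finset.erase_subset _ _)⟩
      · rw [evalMon, Finset.prod_insert hle]
        exact mul_ne_zero hyl (Finset.prod_ne_zero_iff.2 fun b hb =>
          Finset.prod_ne_zero_iff.1 hν b (Finset.mem_of_mem_erase hb))
    · exact ⟨⟨l, hlh⟩, ν, B0_card ν, h0ν, hjν, hje, hdis l, hν⟩

/-- The components of an incomplete decomposition whose normalized combinations `z` stay in the
right order are determined up to `m`-th roots of unity. -/
lemma near_components (hpm : p + 2 ≤ m)
    (hX : ∀ S : Finset (Fin (n + 1)), S.card = m →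
      Near e (fun q => ∑ i, evalMon S (x q i)) (∑ i, evalMon S (y i)))
    (h0 : ∀ i, y i 0 ≠ 0)
    (hB0 : LinearIndependent ℂ (fun i (β : ↥(B0 n k p r)) => evalMon β.1 (y i)))
    (hO : ∀ l : ↥(high n k), LinearIndependent ℂ
      (fun i (γ : ↥(Oset n k (m - p - 1) l.1)) => evalMon γ.1 (y i)))
    (hne : (high n k).Nonempty) (ξ : ↥(high n k) → ℂ) {δ : ℝ} (hδ : 0 < δ)
    (hsep : ∀ i j, i ≠ j → 2 * δ ≤
      ‖∑ l, ξ l * (y i l.1 / y i 0) - ∑ l, ξ l * (y j l.1 / y j 0)‖)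
    (hz : ∀ q i, ‖∑ l, ξ l * (y i l.1 / y i 0) - ∑ l, ξ l * (x q i l.1 / x q i 0)‖ < δ)
    (i : Fin r) :
    ∃ ζ : Q → ℂ, (∀ᶠ q in comap e (𝓝 0), ζ q ^ m = 1) ∧
      ∀ j, Near e (fun q => ζ q * x q i j) (y i j) := by
  obtain ⟨A, hA, hM⟩ := exists_simultaneous_diagonalization hpm hX h0 hB0 hO hne
  choose M hMn hMA using hM
  have hx0 : ∀ᶠ q in comap e (𝓝 0), ∀ i, x q i 0 ≠ 0 := hA.mono fun q h => h.2
  have hw : ∀ (l : ↥(high n k)) i, Near e (fun q => x q i l.1 / x q i 0) (y i l.1 / y i 0) := by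
    intro l i
    obtain ⟨hMξ, hMAξ⟩ := near_combination ξ hMn hMA
    obtain ⟨h1, h2⟩ := near_eigenvector_ratio hδ hsep hMξ (hA.mono fun q h => h.1) hMAξ hz i
    exact near_eigenvalue (hMn l) (hMA l) h1 h2
  -- With the high ratios known, the sums over components become linear systems with coefficients
  -- `γ(x_i/x_{i0})`, which isolate the individual terms. The power `x_0^(m-p-1)` compensates the
  -- degree of `γ`.
  have hcoef : ∀ (l : ↥(high n k)) (c : Fin (n + 1)) (Y : Finset (Fin (n + 1))),
      Y.card = p → c ∉ Y → c ∉ (high n k).erase l.1 → Disjoint Y ((high n k).erase l.1) →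
      ∀ i, Near e (fun q => x q i 0 ^ (m - p - 1) * (x q i c * evalMon Y (x q i)))
        (y i 0 ^ (m - p - 1) * (y i c * evalMon Y (y i))) := by
    intro l c Y hY hcY hcl hYl
    have hmon : ∀ (u : Fin (n + 1) → ℂ) (γ : ↥(Oset n k (m - p - 1) l.1)),
        evalMon γ.1 (fun j => u j / u 0) = (u 0)⁻¹ ^ (m - p - 1) * evalMon γ.1 u := by
      intro u γ
      simp only [div_eq_inv_mul]
      rw [evalMon_smul, Oset_card γ]
    have hsum : ∀ (u : Fin r → Fin (n + 1) → ℂ) (γ : ↥(Oset n k (m - p - 1) l.1)),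
        (∀ i, u i 0 ≠ 0) → ∑ i, evalMon γ.1 (fun j => u i j / u i 0) *
          (u i 0 ^ (m - p - 1) * (u i c * evalMon Y (u i)))
        = ∑ i, u i c * evalMon Y (u i) * evalMon γ.1 (u i) := by
      intro u γ hu
      refine Finset.sum_congr rfl fun i _ => ?_
      rw [hmon, inv_pow]
      field_simp [hu i]
    refine near_of_approx_solve
      (a := fun q (γ : ↥(Oset n k (m - p - 1) l.1)) i =>
        evalMon γ.1 (fun j => x q i j / x q i 0))
      (a0 := fun γ i => evalMon γ.1 (fun j => y i j / y i 0)) ?_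
      (fun γ i => Near.evalMon γ.1 fun j hj =>
        hw ⟨j, Finset.mem_of_mem_erase (Oset_subset γ hj)⟩ i) fun γ => ?_
    · have h1 : (fun i (γ : ↥(Oset n k (m - p - 1) l.1)) =>
            evalMon γ.1 (fun j => y i j / y i 0))
          = (fun i => Units.mk0 ((y i 0)⁻¹ ^ (m - p - 1))
              (pow_ne_zero _ (inv_ne_zero (h0 i)))) • fun i γ => evalMon γ.1 (y i) := by
        ext i γ
        exact hmon _ _
      rw [h1]
      exact (hO l).units_smul _
    · rw [hsum y γ h0]
      exact (near_sum_triple hpm hX hY hcY hcl hYl γ).congr'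
        (hx0.mono fun q hq => (hsum (x q) γ hq).symm)
  -- The quotient of the terms for `x_j Y` and `x_0 Y` is the ratio `x_j / x_0`.
  have hu : ∀ j, Near e (fun q => x q i j / x q i 0) (y i j / y i 0) := by
    intro j
    by_cases hj : j = 0
    · subst hj
      rw [div_self (h0 i)]
      exact (near_const 1).congr' (hx0.mono fun q hq => (div_self (hq i)).symm)
    · obtain ⟨l, Y, hY, h0Y, hjY, hjl, hYl, hne0⟩ :=
        exists_monomial_ne_zero hpm hB0 hO hne i j
      have h1 := hcoef l j Y hY hjY hjl hYl i
      have h2 := hcoef l 0 Y hY h0Y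
        (fun h => zero_notMem_high (Finset.mem_of_mem_erase h)) hYl i
      have hd : y i 0 ^ (m - p - 1) * (y i 0 * evalMon Y (y i)) ≠ 0 :=
        mul_ne_zero (pow_ne_zero _ (h0 i)) (mul_ne_zero (h0 i) hne0)
      have h3 := h1.div h2 hd
      have hcancel : ∀ u : Fin (n + 1) → ℂ,
          u 0 ^ (m - p - 1) * (u 0 * evalMon Y u) ≠ 0 →
          u 0 ^ (m - p - 1) * (u j * evalMon Y u) / (u 0 ^ (m - p - 1) * (u 0 * evalMon Y u))
            = u j / u 0 := by
        intro u hu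
        rw [mul_div_mul_left _ _ (left_ne_zero_of_mul hu),
          mul_div_mul_right _ _ (right_ne_zero_of_mul (right_ne_zero_of_mul hu))]
      rw [hcancel _ hd] at h3
      exact h3.congr' ((h2.eventually_ne hd).mono fun q hq => hcancel _ hq)
  -- Dividing the term for `x_0 Y` by the value of `Y` at the ratios leaves `x_0` to the power `(m -
  -- p - 1) + 1 + p = m`.
  have hpow : Near e (fun q => x q i 0 ^ m) (y i 0 ^ m) := by
    obtain ⟨l, hl⟩ := hne
    obtain ⟨l, Y, hY, h0Y, -, -, hYl, hne0⟩ :=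
      exists_monomial_ne_zero hpm hB0 hO ⟨l, hl⟩ i 0
    have h2 := hcoef l 0 Y hY h0Y
      (fun h => zero_notMem_high (Finset.mem_of_mem_erase h)) hYl i
    have h3 := Near.evalMon Y fun j _ => hu j
    have hmon : ∀ u : Fin (n + 1) → ℂ, u 0 ≠ 0 → evalMon Y u ≠ 0 →
        u 0 ^ (m - p - 1) * (u 0 * evalMon Y u) / evalMon Y (fun j => u j / u 0) = u 0 ^ m := by
      intro u hu huY
      simp only [div_eq_inv_mul (b := u 0)]
      rw [evalMon_smul, hY, inv_pow]
      have : m = (m - p - 1) + 1 + p := by omega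
      conv_rhs => rw [this]
      rw [pow_add, pow_succ]
      field_simp
    have hd : evalMon Y (fun j => y i j / y i 0) ≠ 0 := by
      simp only [div_eq_inv_mul]
      rw [evalMon_smul]
      exact mul_ne_zero (pow_ne_zero _ (inv_ne_zero (h0 i))) hne0
    have h4 := h2.div h3 hd
    rw [hmon _ (h0 i) hne0] at h4
    refine h4.congr' ?_
    filter_upwards [hx0, h3.eventually_ne hd] with q hq hq2
    refine hmon _ (hq i) ?_
    simp only [div_eq_inv_mul] at hq2
    rw [evalMon_smul] at hq2
    exact right_ne_zero_of_mul hq2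
  have hm0 : m ≠ 0 := by omega
  -- The principal root is smooth near `1`, where `x_0^m / y_0^m` lies. Hence `ζ = ρ y_0 / x_0` is a
  -- root of unity and `ζ x_j = ρ y_0 (x_j / x_0)` is close to `y_j`.
  set ρ : Q → ℂ := fun q => (x q i 0 ^ m / y i 0 ^ m) ^ (1 / (m : ℂ)) with hρ
  have hρm : ∀ q, ρ q ^ m = x q i 0 ^ m / y i 0 ^ m := by
    intro q
    rw [hρ]
    simp only [one_div]
    exact Complex.cpow_nat_inv_pow _ hm0
  have hρn : Near e ρ 1 := by
    have h1 := hpow.div (near_const (y i 0 ^ m)) (pow_ne_zero m (h0 i))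
    rw [div_self (pow_ne_zero m (h0 i))] at h1
    have h2 := h1.map ℂ (F := fun z : ℂ => z ^ (1 / (m : ℂ)))
      (DifferentiableAt.cpow_const (by fun_prop) (by simp [Complex.slitPlane]))
    rwa [Complex.one_cpow] at h2
  refine ⟨fun q => ρ q * y i 0 / x q i 0, ?_, fun j => ?_⟩
  · filter_upwards [hx0] with q hq
    rw [div_pow, mul_pow, hρm, div_mul_cancel₀ _ (pow_ne_zero m (h0 i)),
      div_self (pow_ne_zero m (hq i))]
  · have h1 := (hρn.mul (near_const (y i 0))).mul (hu j)
    rw [one_mul, mul_div_cancel₀ _ (h0 i)] at h1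
    exact h1.congr fun q => by ring

end Stability

/-! ### Uniform constants and matching of components -/

lemma exists_bound_of_near {Q E ι : Type*} [NormedAddCommGroup E] [Fintype ι] {e : Q → ℝ}
    {f : ι → Q → E} {f0 : ι → E} (h : ∀ i, Near e (f i) (f0 i)) :
    ∃ C > 0, ∃ δ > 0, ∀ q, |e q| < δ → ∀ i, ‖f i q - f0 i‖ ≤ C * |e q| := by
  obtain ⟨C, hC, δ, hδ, hfin⟩ := near_iff.1 (near_pi (f := fun q i => f i q).2 h)
  exact ⟨C, hC, δ, hδ, fun q hq i =>
    (norm_le_pi_norm ((fun i => f i q) - f0) i).trans (hfin q hq)⟩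

/-- Conjugation by `A` gives `det(z0_j - M) = ∏ (z0_j - z_i)`, and this determinant tends to `0`
because `z0_j` is an eigenvalue of the limit of `M`. -/
lemma eventually_exists_perm {Q : Type*} {e : Q → ℝ} {r : ℕ}
    {A M : Q → Matrix (Fin r) (Fin r) ℂ} {z : Q → Fin r → ℂ} {z0 : Fin r → ℂ} {δ : ℝ}
    (hδ : 0 < δ) (hsep : ∀ i j, i ≠ j → 2 * δ ≤ ‖z0 i - z0 j‖)
    (hM : ∀ j k, Near e (fun q => M q j k) (Matrix.diagonal z0 j k))
    (hA : ∀ᶠ q in comap e (𝓝 0), (A q).det ≠ 0)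
    (hMA : ∀ᶠ q in comap e (𝓝 0), M q * A q = A q * Matrix.diagonal (z q)) :
    ∀ᶠ q in comap e (𝓝 0), ∃ τ : Equiv.Perm (Fin r), ∀ j, ‖z0 j - z q (τ j)‖ < δ := by
  have hsmall : ∀ j, ∀ᶠ s in comap e (𝓝 0), ‖∏ i, (z0 j - z s i)‖ < δ ^ r := by
    intro j
    have h1 : Near e (fun s => (Matrix.diagonal (fun _ => z0 j) - M s).det)
        (Matrix.diagonal (fun _ => z0 j) - Matrix.diagonal z0).det :=
      Near.det fun a b => by
        simp only [Matrix.sub_apply]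
        exact (near_const _).sub (hM a b)
    have h0 : (Matrix.diagonal (fun _ => z0 j) - Matrix.diagonal z0).det = 0 := by
      rw [Matrix.diagonal_sub, Matrix.det_diagonal]
      exact Finset.prod_eq_zero (Finset.mem_univ j) (sub_self _)
    rw [h0] at h1
    have h2 := (tendsto_zero_iff_norm_tendsto_zero.1 h1.tendsto).eventually_lt_const
      (pow_pos hδ r)
    filter_upwards [h2, hA, hMA] with s hs1 hs2 hs3
    have h4 : (Matrix.diagonal (fun _ => z0 j) - M s) * A s
        = A s * Matrix.diagonal (fun i => z0 j - z s i) := by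
      rw [sub_mul, hs3, ← Matrix.diagonal_sub, mul_sub]
      congr 1
      ext a b
      rw [Matrix.diagonal_mul, Matrix.mul_diagonal, mul_comm]
    have h5 := congrArg Matrix.det h4
    rw [Matrix.det_mul, Matrix.det_mul, Matrix.det_diagonal, mul_comm] at h5
    rwa [← mul_left_cancel₀ hs2 h5]
  exact (eventually_all.2 hsmall).mono fun s hs => exists_perm_close hδ hsep hs

lemma near_sum_evalMon {Q : Type*} {e : Q → ℝ} {d m r : ℕ} {x : Q → Fin r → Fin d → ℂ}
    {y : Fin r → Fin d → ℂ}
    (h : ∀ s (a : Fin m ↪ Fin d), ‖∑ i, tpow (x s i) m a - ∑ i, tpow (y i) m a‖ ≤ |e s|)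
    (S : Finset (Fin d)) (hS : S.card = m) :
    Near e (fun q => ∑ i, evalMon S (x q i)) (∑ i, evalMon S (y i)) := by
  refine near_of_le 1 fun s => ?_
  have h1 := h s (S.orderEmbOfFin hS).toEmbedding
  have h2 := fun u : Fin d → ℂ => tpow_orderEmbOfFin hS u
  simp only [RelEmbedding.coe_toEmbedding, h2] at h1
  rwa [one_mul]

/-- Stability of incomplete symmetric tensor decompositions. -/
theorem exists_stability {n m r p k : ℕ} (hpm : p + 2 ≤ m) {y : Fin r → Fin (n + 1) → ℂ}
    (h0 : ∀ i, y i 0 ≠ 0)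
    (hB0 : LinearIndependent ℂ (fun i (β : ↥(B0 n k p r)) => evalMon β.1 (y i)))
    (hO : ∀ l : ↥(high n k), LinearIndependent ℂ
      (fun i (γ : ↥(Oset n k (m - p - 1) l.1)) => evalMon γ.1 (y i)))
    (hne : (high n k).Nonempty) (ξ : ↥(high n k) → ℂ)
    (hz : Function.Injective fun i => ∑ l, ξ l * (y i l.1 / y i 0)) :
    ∃ C > 0, ∃ δ > 0, ∀ (q : Fin r → Fin (n + 1) → ℂ) (ε : ℝ), 0 ≤ ε → ε < δ →
      (∀ a : Fin m ↪ Fin (n + 1), ‖∑ i, tpow (q i) m a - ∑ i, tpow (y i) m a‖ ≤ ε) →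
      ∃ (τ : Equiv.Perm (Fin r)) (ζ : Fin r → ℂ), (∀ i, ζ i ^ m = 1) ∧
        ∀ i j, ‖ζ i * q (τ i) j - y i j‖ ≤ C * ε := by
  obtain ⟨δ, hδ, hsep⟩ := exists_separation hz
  -- First pass, over all pairs of an approximate decomposition and an error bound: it only finds
  -- the matching permutation.
  obtain ⟨A, hA, hM⟩ := exists_simultaneous_diagonalization
    (Q := {s : (Fin r → Fin (n + 1) → ℂ) × ℝ // ∀ a : Fin m ↪ Fin (n + 1),
      ‖∑ i, tpow (s.1 i) m a - ∑ i, tpow (y i) m a‖ ≤ |s.2|}) (e := fun s => s.1.2)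
    (x := fun s => s.1.1) hpm (near_sum_evalMon fun s => s.2) h0 hB0 hO hne
  choose M hMn hMA using hM
  obtain ⟨hMξ, hMAξ⟩ := near_combination ξ hMn hMA
  have hperm := eventually_exists_perm hδ hsep hMξ (hA.mono fun q h => h.1) hMAξ
  obtain ⟨δ₁, hδ₁, hperm⟩ := eventually_comap_zero.1 hperm
  -- Second pass, with the correct order built into the parameter type; it is applied to the
  -- permuted decomposition.
  have hcomp := near_components
    (Q := {s : (Fin r → Fin (n + 1) → ℂ) × ℝ // (∀ a : Fin m ↪ Fin (n + 1),
      ‖∑ i, tpow (s.1 i) m a - ∑ i, tpow (y i) m a‖ ≤ |s.2|) ∧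
      ∀ i, ‖∑ l, ξ l * (y i l.1 / y i 0) - ∑ l, ξ l * (s.1 i l.1 / s.1 i 0)‖ < δ})
    (e := fun s => s.1.2) (x := fun s => s.1.1) hpm (near_sum_evalMon fun s => s.2.1) h0 hB0 hO
    hne ξ hδ hsep (fun s => s.2.2)
  choose ζ hζ hζn using hcomp
  obtain ⟨C, hC, δ₂, hδ₂, hfin⟩ := exists_bound_of_near
    (fun ij : Fin r × Fin (n + 1) => hζn ij.1 ij.2)
  obtain ⟨δ₃, hδ₃, hroot⟩ := eventually_comap_zero.1 (eventually_all.2 hζ)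
  refine ⟨C, hC, min δ₁ (min δ₂ δ₃), by positivity, fun q ε hε hεδ hq => ?_⟩
  simp only [lt_min_iff] at hεδ
  rw [← abs_of_nonneg hε] at hq hεδ ⊢
  obtain ⟨τ, hτ⟩ := hperm ⟨(q, ε), hq⟩ hεδ.1
  have hq' : ∀ a : Fin m ↪ Fin (n + 1),
      ‖∑ i, tpow (q (τ i)) m a - ∑ i, tpow (y i) m a‖ ≤ |ε| := fun a => by
    rw [Equiv.sum_comp τ fun i => tpow (q i) m a]
    exact hq a
  refine ⟨τ, fun i => ζ i ⟨(fun i => q (τ i), ε), hq', hτ⟩, hroot _ hεδ.2.2, fun i j => ?_⟩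
  exact hfin ⟨(fun i => q (τ i), ε), hq', hτ⟩ hεδ.2.1 (i, j)

/-! ## The first monomials in graded lexicographic order -/

/-- Counting predecessors is injective on a finite strict total order and maps onto `0, …, card -
1`. -/
lemma Finset.card_filter_rank_lt {α : Type*} [DecidableEq α] (s : Finset α) (R : α → α → Prop)
    [DecidableRel R] (hirr : ∀ a, ¬ R a a) (htrans : ∀ a b c, R a b → R b c → R a c)
    (htri : ∀ a ∈ s, ∀ b ∈ s, a ≠ b → R a b ∨ R b a) {r : ℕ} (hr : r ≤ s.card) :
    (s.filter fun a => (s.filter fun b => R b a).card < r).card = r := by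
  set f : α → ℕ := fun a => (s.filter fun b => R b a).card with hf
  have hmono : ∀ a ∈ s, ∀ b, R a b → f a < f b := by
    intro a ha b hab
    refine Finset.card_lt_card ((Finset.ssubset_iff_of_subset fun c hc => ?_).2 ⟨a, ?_, ?_⟩)
    · rw [Finset.mem_filter] at hc ⊢
      exact ⟨hc.1, htrans _ _ _ hc.2 hab⟩
    · exact Finset.mem_filter.2 ⟨ha, hab⟩
    · simp [hirr]
  have hinj : Set.InjOn f s := by
    intro a ha b hb hab
    by_contra hne
    rcases htri a ha b hb hne with h | h
    · exact absurd hab (hmono a ha b h).ne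
    · exact absurd hab (hmono b hb a h).ne'
  have himg : s.image f = Finset.range s.card := by
    refine Finset.eq_of_subset_of_card_le (fun c hc => ?_) ?_
    · obtain ⟨a, ha, rfl⟩ := Finset.mem_image.1 hc
      refine Finset.mem_range.2 (Finset.card_lt_card (Finset.filter_ssubset.2 ⟨a, ha, hirr a⟩))
    · rw [Finset.card_range, Finset.card_image_of_injOn hinj]
  have h1 : (s.filter fun a => f a < r).image f = Finset.range r := by
    ext c
    simp only [Finset.mem_image, Finset.mem_filter, Finset.mem_range]
    constructor
    · rintro ⟨a, ⟨-, ha⟩, rfl⟩; exact ha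
    · intro hc
      have : c ∈ s.image f := by rw [himg]; exact Finset.mem_range.2 (hc.trans_le hr)
      obtain ⟨a, ha, rfl⟩ := Finset.mem_image.1 this
      exact ⟨a, ⟨ha, hc⟩, rfl⟩
  have h2 := Finset.card_image_of_injOn (s := s.filter fun a => f a < r)
    (hinj.mono fun a ha => (Finset.mem_filter.1 ha).1)
  rw [h1, Finset.card_range] at h2
  exact h2.symm

lemma GrlexBefore.trans {d : ℕ} {S S' S'' : Finset (Fin d)} (h : GrlexBefore S S')
    (h' : GrlexBefore S' S'') : GrlexBefore S S'' := by
  obtain ⟨x, hx, hx', hxy⟩ := h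
  obtain ⟨y, hy, hy', hyz⟩ := h'
  rcases lt_trichotomy x y with hlt | heq | hlt
  · exact ⟨x, hx, fun hc => hx' ((hyz x hlt).2 hc),
      fun z hz => (hxy z hz).trans (hyz z (hz.trans hlt))⟩
  · exact absurd (heq ▸ hy) hx'
  · exact ⟨y, (hxy y hlt).2 hy, hy', fun z hz => (hxy z (hz.trans hlt)).trans (hyz z hz)⟩

/-- The least element of the symmetric difference decides. -/
lemma GrlexBefore.total {d : ℕ} {S S' : Finset (Fin d)} (h : S ≠ S') :
    GrlexBefore S S' ∨ GrlexBefore S' S := by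
  have hne : (symmDiff S S').Nonempty := by
    rw [Finset.nonempty_iff_ne_empty]
    exact fun hc => h (symmDiff_eq_bot.1 hc)
  have hmin : ∀ y, y < (symmDiff S S').min' hne → (y ∈ S ↔ y ∈ S') := by
    intro y hy
    have : y ∉ symmDiff S S' := fun hc => absurd (Finset.min'_le _ _ hc) (not_le.2 hy)
    rw [Finset.mem_symmDiff] at this
    tauto
  rcases Finset.mem_symmDiff.1 (Finset.min'_mem _ hne) with h1 | h1
  · exact Or.inl ⟨_, h1.1, h1.2, hmin⟩
  · exact Or.inr ⟨_, h1.1, h1.2, fun y hy => (hmin y hy).symm⟩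

lemma card_low {n k : ℕ} (hk : k ≤ n) : (low n k).card = k := by
  have : (low n k).map Fin.valEmbedding = Finset.Icc 1 k := by
    ext j
    simp only [low, Finset.mem_map, Finset.mem_filter, Finset.mem_univ, true_and,
      Fin.valEmbedding_apply, Finset.mem_Icc]
    constructor
    · rintro ⟨a, ha, rfl⟩; exact ha
    · intro hj; exact ⟨⟨j, by omega⟩, hj, rfl⟩
  rw [← Finset.card_map Fin.valEmbedding, this, Nat.card_Icc, Nat.add_sub_cancel]

lemma card_B0 {n k p r : ℕ} (hkn : k ≤ n) (hr : r ≤ k.choose p) : (B0 n k p r).card = r :=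
  Finset.card_filter_rank_lt _ GrlexBefore (fun _ ⟨_, h1, h2, _⟩ => h2 h1)
    (fun _ _ _ => GrlexBefore.trans) (fun _ _ _ _ => GrlexBefore.total)
    (by rwa [J1, Finset.card_powersetCard, card_low hkn])

/-! ## Least squares -/

/-- The range of `L` is a finite-dimensional, hence closed, subspace, so a nearest point exists. -/
lemma exists_isMinOn_affine {V κ : Type*} [AddCommGroup V] [Module ℂ V] [Fintype κ]
    (L : V →ₗ[ℂ] (κ → ℂ)) (b : κ → ℂ) :
    ∃ x, IsMinOn (fun c => l2norm (fun u => b u + L c u) ^ 2) Set.univ x := by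
  set W : Submodule ℂ (EuclideanSpace ℂ κ) :=
    LinearMap.range ((WithLp.linearEquiv 2 ℂ (κ → ℂ)).symm.toLinearMap ∘ₗ L) with hW
  obtain ⟨w, ⟨x, rfl⟩, hw⟩ := W.closed_of_finiteDimensional.exists_infDist_eq_dist
    ⟨0, W.zero_mem⟩ (-(WithLp.toLp 2 b))
  have hdist : ∀ c, l2norm (fun u => b u + L c u)
      = dist (-(WithLp.toLp 2 b : EuclideanSpace ℂ κ))
        (((WithLp.linearEquiv 2 ℂ (κ → ℂ)).symm.toLinearMap ∘ₗ L) c) := by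
    intro c
    rw [dist_eq_norm, ← norm_neg, neg_sub, sub_neg_eq_add, add_comm]
    rfl
  refine ⟨x, fun c _ => ?_⟩
  refine pow_le_pow_left₀ (l2norm_nonneg _) ?_ 2
  rw [hdist, hdist, ← hw]
  exact Metric.infDist_le_dist_of_mem ⟨c, rfl⟩

lemma exists_isMinOn_sub {V κ : Type*} [AddCommGroup V] [Module ℂ V] [Fintype κ]
    (L : V →ₗ[ℂ] (κ → ℂ)) (b : κ → ℂ) :
    ∃ x, IsMinOn (fun c => l2norm (fun u => b u - L c u) ^ 2) Set.univ x := by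
  obtain ⟨x, hx⟩ := exists_isMinOn_affine (-L) b
  refine ⟨x, ?_⟩
  simpa [sub_eq_add_neg] using hx

lemma l2norm_le_of_isMinOn {V κ E : Type*} [Fintype κ] [NormedAddCommGroup E]
    {f : V → κ → E} {K : Set V} {x x0 : V}
    (h : IsMinOn (fun c => l2norm (f c) ^ 2) K x) (hx0 : x0 ∈ K) :
    l2norm (f x) ≤ l2norm (f x0) :=
  le_of_sq_le_sq (h hx0) (l2norm_nonneg _)

/-- The residual at `x0` is `O(e)`, so the one at `x` is too, and `x` solves the limiting system
approximately. Only comparison with `x0` is needed, so constrained problems are covered whenever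
`x0` is admissible. -/
lemma near_of_minimizer {Q 𝕜 ι κ : Type*} [RCLike 𝕜] [Fintype ι] [Fintype κ] {e : Q → ℝ}
    {a : Q → κ → ι → 𝕜} {a0 : κ → ι → 𝕜} {b : Q → κ → 𝕜} {x : Q → ι → 𝕜} {x0 : ι → 𝕜}
    (hLI : LinearIndependent 𝕜 (fun i k => a0 k i))
    (ha : ∀ k i, Near e (fun q => a q k i) (a0 k i))
    (hb : ∀ k, Near e (fun q => b q k) (∑ i, a0 k i * x0 i))
    (hmin : ∀ q, l2norm (fun k => b q k - ∑ i, a q k i * x q i)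
      ≤ l2norm (fun k => b q k - ∑ i, a q k i * x0 i)) (i : ι) :
    Near e (fun q => x q i) (x0 i) := by
  refine near_of_approx_solve hLI ha (fun k => ?_) i
  have h1 : ∀ k, (fun q => b q k - ∑ i, a q k i * x0 i) =O[comap e (𝓝 0)] e := by
    intro k
    have := (hb k).sub (Near.sum fun i (_ : i ∈ Finset.univ) => (ha k i).mul (near_const (x0 i)))
    simpa [Near] using this
  have h2 : (fun q => b q k - ∑ i, a q k i * x q i) =O[comap e (𝓝 0)] e := by
    refine IsBigO.trans ?_ (IsBigO.fun_sum (s := Finset.univ) fun k _ => (h1 k).norm_left)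
    refine IsBigO.of_bound 1 (Eventually.of_forall fun q => ?_)
    rw [one_mul, Real.norm_of_nonneg (Finset.sum_nonneg fun _ _ => norm_nonneg _)]
    exact ((norm_le_l2norm _ k).trans (hmin q)).trans (l2norm_le_sum _)
  have h3 : Near e (fun q => b q k - ∑ i, a q k i * x q i) 0 := by simpa [Near] using h2
  have h4 := (hb k).sub h3
  rw [sub_zero] at h4
  exact h4.congr fun q => sub_sub_cancel _ _

/-! ## Eigenvectors near a matrix with simple spectrum -/

lemma exists_unit_eigenvectors {β : Type*} [Fintype β] [DecidableEq β] {r : ℕ}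
    {N : Matrix β β ℂ} {z : Fin r → ℂ} (hz : Function.Injective z)
    (hroot : ∀ i, N.charpoly.IsRoot (z i)) :
    ∃ v : Fin r → β → ℂ, (∀ i, l2norm (v i) = 1) ∧ LinearIndependent ℂ v ∧
      ∀ i, ∃ c : ℂ, N.mulVec (v i) = c • v i := by
  have h1 : ∀ i, ∃ v, Module.End.HasEigenvector (Matrix.toLin' N) (z i) v := fun i =>
    ((Module.End.hasEigenvalue_iff_isRoot_charpoly _ _).2
      (by rw [Matrix.charpoly_toLin']; exact hroot i)).exists_hasEigenvector
  choose v hv using h1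
  have hpos : ∀ i, l2norm (v i) ≠ 0 := fun i hc => (hv i).2 (by
    have : (WithLp.toLp 2 (v i) : PiLp 2 (fun _ : β => ℂ)) = 0 := norm_eq_zero.1 hc
    simpa using this)
  have hv' : ∀ i, Module.End.HasEigenvector (Matrix.toLin' N) (z i)
      (((l2norm (v i) : ℂ)⁻¹) • v i) :=
    fun i => ⟨Submodule.smul_mem _ _ (hv i).1,
      smul_ne_zero (inv_ne_zero (Complex.ofReal_ne_zero.2 (hpos i))) (hv i).2⟩
  refine ⟨fun i => ((l2norm (v i) : ℂ)⁻¹) • v i, fun i => ?_,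
    Module.End.eigenvectors_linearIndependent' _ z hz _ hv', fun i => ⟨z i, ?_⟩⟩
  · unfold l2norm
    rw [WithLp.toLp_smul, norm_smul, norm_inv, Complex.norm_real, norm_norm]
    exact inv_mul_cancel₀ (hpos i)
  · have := (hv' i).apply_eq_smul
    rwa [Matrix.toLin'_apply] at this

/-- Near each of the distinct roots `z j` the perturbed characteristic polynomial has a root. These
roots remain distinct, and eigenvectors for distinct eigenvalues are independent. -/
lemma eventually_exists_unit_eigenvectors {Q β : Type*} [Fintype β] [DecidableEq β] {r : ℕ}
    {e : Q → ℝ} {N : Q → Matrix β β ℂ} {N0 : Matrix β β ℂ}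
    (hN : ∀ i j, Near e (fun q => N q i j) (N0 i j)) {z : Fin r → ℂ}
    (hz : Function.Injective z) (hroot : ∀ i, N0.charpoly.IsRoot (z i)) :
    ∀ᶠ q in comap e (𝓝 0), ∃ v : Fin r → β → ℂ, (∀ i, l2norm (v i) = 1) ∧
      LinearIndependent ℂ v ∧ ∀ i, ∃ c : ℂ, (N q).mulVec (v i) = c • v i := by
  obtain ⟨δ, hδ, hsep⟩ := exists_separation hz
  have hsmall : ∀ j, ∀ᶠ q in comap e (𝓝 0),
      ‖(N q).charpoly.eval (z j)‖ < δ ^ Fintype.card β := by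
    intro j
    have h1 : Near e (fun q => (Matrix.scalar β (z j) - N q).det)
        (Matrix.scalar β (z j) - N0).det := Near.det fun a b => by
      simp only [Matrix.sub_apply]
      exact (near_const _).sub (hN a b)
    rw [← Matrix.eval_charpoly, (hroot j).eq_zero] at h1
    simp only [Matrix.eval_charpoly]
    exact (tendsto_zero_iff_norm_tendsto_zero.1 h1.tendsto).eventually_lt_const (pow_pos hδ _)
  filter_upwards [eventually_all.2 hsmall] with q hq
  have h2 : ∀ j, ∃ c, (N q).charpoly.IsRoot c ∧ ‖z j - c‖ < δ := by
    intro j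
    have hs := IsAlgClosed.splits (N q).charpoly
    have h3 := hq j
    rw [hs.eval_eq_prod_roots_of_monic (Matrix.charpoly_monic _),
      ← Matrix.charpoly_natDegree_eq_dim (N q), hs.natDegree_eq_card_roots] at h3
    obtain ⟨c, hc, hcδ⟩ := exists_mem_norm_sub_lt hδ h3
    exact ⟨c, Polynomial.isRoot_of_mem_roots hc, hcδ⟩
  choose c hc hcδ using h2
  refine exists_unit_eigenvectors (z := c) (fun i j hij => ?_) hc
  refine injective_of_close (z := id) hsep (f := c) ?_ hij
  exact hcδ

/-! ## The generating matrix -/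

section Generating

variable {n m r p k : ℕ} {y : Fin r → Fin (n + 1) → ℂ} {T0 : Tensor ℝ m (n + 1)}

lemma matA_eq (hpm : p + 2 ≤ m)
    (hT0 : ∀ S, S.card = m → ((entry T0 S : ℝ) : ℂ) = ∑ i, evalMon S (y i)) (α : B1 n k p)
    (γ : ↥(Oset n k (m - p - 1) α.2.1)) (β : ↥(B0 n k p r)) :
    matA r p k T0 α γ β = ∑ i, y i 0 * evalMon β.1 (y i) * evalMon γ.1 (y i) := by
  have h1 : (0 : Fin (n + 1)) ∉ β.1 := fun h => zero_notMem_low (B0_subset_low β h)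
  have h2 : (0 : Fin (n + 1)) ∉ γ.1 := fun h =>
    zero_notMem_high (Finset.mem_of_mem_erase (Oset_subset γ h))
  have h3 : Disjoint β.1 γ.1 := (disjoint_low_high.mono_left (B0_subset_low β)).mono_right
    ((Oset_subset γ).trans (Finset.erase_subset _ _))
  rw [matA, hT0 _ (by rw [card_insert_union h1 h2 h3, B0_card, Oset_card]; omega)]
  simp only [evalMon_insert_union _ h1 h2 h3]

lemma vecb_eq (hpm : p + 2 ≤ m)
    (hT0 : ∀ S, S.card = m → ((entry T0 S : ℝ) : ℂ) = ∑ i, evalMon S (y i)) (α : B1 n k p)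
    (γ : ↥(Oset n k (m - p - 1) α.2.1)) :
    vecb p k T0 α γ = ∑ i, y i α.2.1 * evalMon α.1.1 (y i) * evalMon γ.1 (y i) := by
  obtain ⟨hα, hαc⟩ := Finset.mem_powersetCard.1 α.1.2
  have h1 : α.2.1 ∉ α.1.1 := fun h => Finset.disjoint_left.1 disjoint_low_high (hα h) α.2.2
  have h2 : α.2.1 ∉ γ.1 := fun h => Finset.notMem_erase _ _ (Oset_subset γ h)
  have h3 : Disjoint α.1.1 γ.1 := (disjoint_low_high.mono_left hα).mono_right
    ((Oset_subset γ).trans (Finset.erase_subset _ _))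
  rw [vecb, Finset.insert_union,
    hT0 _ (by rw [card_insert_union h1 h2 h3, hαc, Oset_card]; omega)]
  simp only [evalMon_insert_union _ h1 h2 h3]

/-- With `φ` dual to `[y_i]_{B0}`, the matrix `G` interpolates: `∑_β G(β, νx_l) β(y_i) =
(y_{il}/y_{i0}) ν(y_i)`. Then `N(ξ) = V diag(z) Φ` with `Φ V = 1`. -/
lemma exists_solvesG (hpm : p + 2 ≤ m) (hcard : (B0 n k p r).card = r)
    (hT0 : ∀ S, S.card = m → ((entry T0 S : ℝ) : ℂ) = ∑ i, evalMon S (y i))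
    (h0 : ∀ i, y i 0 ≠ 0)
    (hB0 : LinearIndependent ℂ (fun i (β : ↥(B0 n k p r)) => evalMon β.1 (y i)))
    (ξ : ↥(high n k) → ℂ) :
    ∃ G : Matrix ↥(B0 n k p r) (B1 n k p) ℂ, SolvesG r p k T0 G ∧
      (Nxi ξ G).charpoly
        = ∏ i, (Polynomial.X - Polynomial.C (∑ l, ξ l * (y i l.1 / y i 0))) := by
  obtain ⟨φ, hφ⟩ := exists_dual hB0
  refine ⟨fun β α => ∑ i, φ i β * (y i α.2.1 / y i 0 * evalMon α.1.1 (y i)),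
    fun α => ?_, ?_⟩
  · ext γ
    rw [vecb_eq hpm hT0, Matrix.mulVec, dotProduct]
    simp only [matA_eq hpm hT0, Finset.sum_mul, Finset.mul_sum]
    have h1 : ∀ i j : Fin r, ∑ β : ↥(B0 n k p r), y i 0 * evalMon β.1 (y i) * evalMon γ.1 (y i)
          * (φ j β * (y j α.2.1 / y j 0 * evalMon α.1.1 (y j)))
        = if j = i then y i α.2.1 * evalMon α.1.1 (y i) * evalMon γ.1 (y i) else 0 := by
      intro i j
      have h2 : ∑ β : ↥(B0 n k p r), y i 0 * evalMon β.1 (y i) * evalMon γ.1 (y i)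
          * (φ j β * (y j α.2.1 / y j 0 * evalMon α.1.1 (y j)))
        = (∑ β : ↥(B0 n k p r), φ j β * evalMon β.1 (y i)) * (y i 0 * evalMon γ.1 (y i) *
          (y j α.2.1 / y j 0 * evalMon α.1.1 (y j))) := by
        rw [Finset.sum_mul]
        exact Finset.sum_congr rfl fun β _ => by ring
      rw [h2, hφ]
      split_ifs with hji
      · subst hji
        field_simp [h0 j]
      · rw [zero_mul]
    rw [Finset.sum_comm]
    conv_lhs => enter [2, j]; rw [Finset.sum_comm]
    simp only [h1, Finset.sum_ite_eq, Finset.mem_univ, if_true]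
  · set V : Matrix ↥(B0 n k p r) (Fin r) ℂ := fun ν i => evalMon ν.1 (y i) with hV
    set Φ : Matrix (Fin r) ↥(B0 n k p r) ℂ := fun i β => φ i β with hΦ
    set z : Fin r → ℂ := fun i => ∑ l, ξ l * (y i l.1 / y i 0) with hz
    have h1 : Nxi ξ (fun β α => ∑ i, φ i β * (y i α.2.1 / y i 0 * evalMon α.1.1 (y i)))
        = V * (Matrix.diagonal z * Φ) := by
      ext ν β
      simp only [Nxi, Matrix.sum_apply, Matrix.smul_apply, Nmat, smul_eq_mul]
      rw [Matrix.mul_apply]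
      simp only [Finset.mul_sum]
      rw [Finset.sum_comm]
      refine Finset.sum_congr rfl fun i _ => ?_
      rw [Matrix.diagonal_mul]
      change _ = evalMon ν.1 (y i) * ((∑ l, ξ l * (y i l.1 / y i 0)) * φ i β)
      rw [Finset.sum_mul, Finset.mul_sum]
      exact Finset.sum_congr rfl fun l _ => by ring
    have h2 : Φ * V = 1 := by
      ext i j
      rw [Matrix.mul_apply, Matrix.one_apply]
      exact hφ i j
    rw [h1]
    -- Cyclic exchange gives the characteristic polynomial of `diag z`; as `B0` has exactly `r`
    -- elements, no power of `X` is left over.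
    have h3 := Matrix.charpoly_mul_comm_of_le V (Matrix.diagonal z * Φ) (by simp [hcard])
    rw [Matrix.mul_assoc, h2, Matrix.mul_one, Matrix.charpoly_diagonal] at h3
    rw [h3, Fintype.card_coe, hcard, Fintype.card_fin, Nat.sub_self, pow_zero, one_mul]

/-- `A[α, F]` factors as `[y]_{O_α}`, then `diag(y_0)`, then the transpose of `[y]_{B0}`. The last
factor is square, so its one-sided inverse is two-sided and all three are injective. -/
lemma linearIndependent_matA (hpm : p + 2 ≤ m) (hcard : (B0 n k p r).card = r)
    (hT0 : ∀ S, S.card = m → ((entry T0 S : ℝ) : ℂ) = ∑ i, evalMon S (y i))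
    (h0 : ∀ i, y i 0 ≠ 0)
    (hB0 : LinearIndependent ℂ (fun i (β : ↥(B0 n k p r)) => evalMon β.1 (y i)))
    (α : B1 n k p) (hO : LinearIndependent ℂ
      (fun i (γ : ↥(Oset n k (m - p - 1) α.2.1)) => evalMon γ.1 (y i))) :
    LinearIndependent ℂ (fun β γ => matA r p k T0 α γ β) := by
  obtain ⟨φ, hφ⟩ := exists_dual hB0
  have hdual : ∀ β ν : ↥(B0 n k p r), ∑ i, evalMon β.1 (y i) * φ i ν = if β = ν then 1 else 0 := by
    have h2 : (Matrix.of fun i β => φ i β) *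
        (Matrix.of fun (ν : ↥(B0 n k p r)) i => evalMon ν.1 (y i)) = 1 := by
      ext i j
      rw [Matrix.mul_apply, Matrix.one_apply]
      exact hφ i j
    have h3 := (Matrix.mul_eq_one_comm_of_card_eq _ _ _ (by simp [hcard])).1 h2
    intro β ν
    have h4 := congrFun (congrFun h3 β) ν
    rwa [Matrix.mul_apply, Matrix.one_apply] at h4
  rw [Fintype.linearIndependent_iff] at hO ⊢
  intro c hc
  have h1 : ∀ i, y i 0 * ∑ β, c β * evalMon β.1 (y i) = 0 := by
    refine hO _ ?_
    ext γ
    have h2 := congrFun hc γ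
    simp only [Finset.sum_apply, Pi.smul_apply, smul_eq_mul, matA_eq hpm hT0, Finset.mul_sum,
      Finset.sum_mul, Pi.zero_apply] at h2 ⊢
    rw [Finset.sum_comm] at h2
    rw [← h2]
    exact Finset.sum_congr rfl fun _ _ => Finset.sum_congr rfl fun _ _ => by ring
  intro ν
  have h2 : ∑ i, (∑ β, c β * evalMon β.1 (y i)) * φ i ν = c ν := by
    simp only [Finset.sum_mul]
    rw [Finset.sum_comm]
    simp [mul_assoc, ← Finset.mul_sum, hdual]
  rw [← h2]
  refine Finset.sum_eq_zero fun i _ => ?_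
  rw [(mul_eq_zero.1 (h1 i)).resolve_left (h0 i), zero_mul]

/-- Close to an exact decomposition, the approximate generating matrix has the eigenvectors that
the algorithm asks for. -/
lemma exists_forall_unit_eigenvectors (hpm : p + 2 ≤ m) (hcard : (B0 n k p r).card = r)
    (hT0 : ∀ S, S.card = m → ((entry T0 S : ℝ) : ℂ) = ∑ i, evalMon S (y i))
    (h0 : ∀ i, y i 0 ≠ 0)
    (hB0 : LinearIndependent ℂ (fun i (β : ↥(B0 n k p r)) => evalMon β.1 (y i)))
    (hO : ∀ l : ↥(high n k), LinearIndependent ℂ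
      (fun i (γ : ↥(Oset n k (m - p - 1) l.1)) => evalMon γ.1 (y i)))
    (ξ : ↥(high n k) → ℂ)
    (hz : Function.Injective fun i => ∑ l, ξ l * (y i l.1 / y i 0)) :
    ∃ δ > 0, ∀ (T : Tensor ℝ m (n + 1)) (G : Matrix ↥(B0 n k p r) (B1 n k p) ℂ) (ε : ℝ),
      0 ≤ ε → ε < δ → (∀ S : Finset (Fin (n + 1)), |entry T S - entry T0 S| ≤ ε) →
      (∀ α, IsMinOn (fun g : ↥(B0 n k p r) → ℂ =>
        l2norm ((matA r p k T α).mulVec g - vecb p k T α) ^ 2) Set.univ (fun β => G β α)) →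
      ∃ v : Fin r → ↥(B0 n k p r) → ℂ, (∀ i, l2norm (v i) = 1) ∧ LinearIndependent ℂ v ∧
        ∀ i, ∃ c : ℂ, (Nxi ξ G).mulVec (v i) = c • v i := by
  obtain ⟨G0, hG0, hchar⟩ := exists_solvesG hpm hcard hT0 h0 hB0 ξ
  let Q : Type := {s : Tensor ℝ m (n + 1) × Matrix ↥(B0 n k p r) (B1 n k p) ℂ × ℝ //
    (∀ S : Finset (Fin (n + 1)), |entry s.1 S - entry T0 S| ≤ |s.2.2|) ∧
    ∀ α, IsMinOn (fun g : ↥(B0 n k p r) → ℂ =>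
        l2norm ((matA r p k s.1 α).mulVec g - vecb p k s.1 α) ^ 2) Set.univ
        (fun β => s.2.1 β α)}
  have hent : ∀ S, Near (fun s : Q => s.1.2.2) (fun s => ((entry s.1.1 S : ℝ) : ℂ))
      ((entry T0 S : ℝ) : ℂ) := fun S =>
    near_ofReal.2 (near_of_le 1 fun s => by rw [one_mul]; exact s.2.1 S)
  have hG : ∀ α β, Near (fun s : Q => s.1.2.2) (fun s => s.1.2.1 β α) (G0 β α) := by
    intro α
    refine near_of_minimizer (a := fun s : Q => matA r p k s.1.1 α)
      (b := fun s : Q => vecb p k s.1.1 α)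
      (linearIndependent_matA hpm hcard hT0 h0 hB0 α (hO α.2)) (fun γ β => hent _) (fun γ => ?_)
      fun s => ?_
    · have h1 := congrFun (hG0 α) γ
      rw [Matrix.mulVec, dotProduct] at h1
      rw [h1]
      exact hent _
    · have h1 := l2norm_le_of_isMinOn (s.2.2 α) (Set.mem_univ fun β => G0 β α)
      have h2 : ∀ g : ↥(B0 n k p r) → ℂ,
          l2norm (fun γ => vecb p k s.1.1 α γ - ∑ β, matA r p k s.1.1 α γ β * g β)
            = l2norm ((matA r p k s.1.1 α).mulVec g - vecb p k s.1.1 α) := by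
        intro g
        unfold l2norm
        rw [← norm_neg]
        congr 1
        ext γ
        simp [Matrix.mulVec, dotProduct]
      rw [h2, h2]
      exact h1
  have hN : ∀ ν β, Near (fun s : Q => s.1.2.2) (fun s => Nxi ξ s.1.2.1 ν β) (Nxi ξ G0 ν β) := by
    intro ν β
    simp only [Nxi, Matrix.sum_apply, Matrix.smul_apply, smul_eq_mul]
    exact Near.sum fun l _ => (near_const _).mul (hG _ _)
  have hroot : ∀ i, (Nxi ξ G0).charpoly.IsRoot (∑ l, ξ l * (y i l.1 / y i 0)) := by
    intro i
    rw [hchar, Polynomial.IsRoot, Polynomial.eval_prod]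
    exact Finset.prod_eq_zero (Finset.mem_univ i)
      (by rw [Polynomial.eval_sub, Polynomial.eval_X, Polynomial.eval_C, sub_self])
  obtain ⟨δ, hδ, h⟩ := eventually_comap_zero.1
    (eventually_exists_unit_eigenvectors hN hz hroot)
  refine ⟨δ, hδ, fun T G ε hε hεδ hT hG => ?_⟩
  rw [← abs_of_nonneg hε] at hT hεδ
  exact h ⟨(T, G, ε), hT, hG⟩ hεδ

end Generating

/-! ## Nonnegative least squares -/

/-- Finitely generated cones are closed. -/
lemma isClosed_finite_cone {ι E : Type*} [NormedAddCommGroup E]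
    [NormedSpace ℝ E] [FiniteDimensional ℝ E] (a : ι → E) (s : Finset ι) :
    IsClosed {w : E | ∃ x : ι → ℝ, (∀ i, 0 ≤ x i) ∧ ∑ i ∈ s, x i • a i = w} := by
  classical
  induction hN : s.card generalizing s with
  | zero =>
    rw [Finset.card_eq_zero] at hN
    subst hN
    convert! isClosed_singleton (x := (0 : E)) using 1
    ext w
    simp only [Finset.sum_empty, Set.mem_ofPred_eq, Set.mem_singleton_iff]
    exact ⟨fun ⟨_, _, h⟩ => h.symm, fun h => ⟨0, fun _ => le_rfl, h.symm⟩⟩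
  | succ N ih =>
    by_cases hLI : LinearIndepOn ℝ a (s : Set ι)
    -- Independent generators: the cone is the image of the closed orthant under a closed embedding.
    · have hinj := linearIndependent_iff_injective_fintypeLinearCombination.1
        (show LinearIndependent ℝ (fun i : ↥s => a i) from hLI)
      have hemb := LinearMap.isClosedEmbedding_of_injective
        (LinearMap.ker_eq_bot.2 hinj)
      convert! hemb.isClosedMap _ (isClosed_Ici (a := (0 : ↥s → ℝ))) using 1
      ext w
      simp only [Set.mem_ofPred_eq, Set.mem_image, Set.mem_Ici]
      constructor
      · rintro ⟨x, hx, rfl⟩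
        refine ⟨fun i => x i, fun i => hx i, ?_⟩
        rw [Fintype.linearCombination_apply, Finset.univ_eq_attach,
          Finset.sum_attach s fun i => x i • a i]
      · rintro ⟨x, hx, rfl⟩
        refine ⟨fun i => if h : i ∈ s then x ⟨i, h⟩ else 0, fun i => ?_, ?_⟩
        · by_cases h : i ∈ s
          · simpa [h] using hx ⟨i, h⟩
          · simp [h]
        · rw [Fintype.linearCombination_apply, Finset.univ_eq_attach, ← Finset.sum_attach]
          exact Finset.sum_congr rfl fun i _ => by simp
    · rw [linearIndepOn_finset_iff] at hLI
      push Not at hLI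
      obtain ⟨g, hg, i₁, hi₁, hgi₁⟩ := hLI
      obtain ⟨g, hg, i₁, hi₁, hgi₁⟩ : ∃ g : ι → ℝ, ∑ i ∈ s, g i • a i = 0 ∧
          ∃ i ∈ s, 0 < g i := by
        rcases lt_or_gt_of_ne hgi₁ with h | h
        · exact ⟨-g, by simp [hg], i₁, hi₁, by simpa using h⟩
        · exact ⟨g, hg, i₁, hi₁, h⟩
      -- Dependent generators, as in Carathéodory's theorem: the cone is the finite union of the
      -- cones omitting one generator.
      have hcl : IsClosed (⋃ i ∈ s,
          {w : E | ∃ x : ι → ℝ, (∀ i, 0 ≤ x i) ∧ ∑ j ∈ s.erase i, x j • a j = w}) :=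
        s.finite_toSet.isClosed_biUnion fun i hi => ih _ (by
          rw [Finset.card_erase_of_mem hi, hN, Nat.add_sub_cancel])
      convert! hcl using 1
      ext w
      simp only [Set.mem_ofPred_eq, Set.mem_iUnion, exists_prop]
      constructor
      · rintro ⟨x, hx, rfl⟩
        -- Subtracting the relation with the smallest ratio `x_i / g_i` makes one coefficient vanish
        -- and keeps the others nonnegative.
        obtain ⟨i₀, hi₀, hmin⟩ := Finset.exists_min_image (s.filter fun i => 0 < g i)
          (fun i => x i / g i) ⟨i₁, Finset.mem_filter.2 ⟨hi₁, hgi₁⟩⟩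
        obtain ⟨hi₀s, hg₀⟩ := Finset.mem_filter.1 hi₀
        have hc : 0 ≤ x i₀ / g i₀ := div_nonneg (hx _) hg₀.le
        refine ⟨i₀, hi₀s, fun i => if i ∈ s then x i - x i₀ / g i₀ * g i else 0, fun i => ?_, ?_⟩
        · dsimp only
          split_ifs with hi
          · rcases lt_or_ge 0 (g i) with h | h
            · have := hmin i (Finset.mem_filter.2 ⟨hi, h⟩)
              rw [le_div_iff₀ h] at this
              linarith
            · nlinarith [hx i]
          · exact le_rfl
        · have h1 : ∑ i ∈ s, (x i - x i₀ / g i₀ * g i) • a i = ∑ i ∈ s, x i • a i := by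
            simp only [sub_smul, mul_smul, Finset.sum_sub_distrib, ← Finset.smul_sum, hg,
              smul_zero, sub_zero]
          rw [← h1, ← Finset.add_sum_erase s _ hi₀s, div_mul_cancel₀ _ hg₀.ne', sub_self,
            zero_smul, zero_add]
          exact Finset.sum_congr rfl fun i hi => by
            dsimp only
            rw [if_pos (Finset.mem_of_mem_erase hi)]
      · rintro ⟨i, hi, x, hx, rfl⟩
        refine ⟨Function.update x i 0, fun j => ?_, ?_⟩
        · by_cases h : j = i
          · subst h; simp
          · simpa [h] using hx j
        · rw [← Finset.add_sum_erase s _ hi, Function.update_self, zero_smul, zero_add]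
          exact Finset.sum_congr rfl fun j hj => by
            rw [Function.update_of_ne (Finset.ne_of_mem_erase hj)]

lemma exists_isMinOn_nonneg {ι κ : Type*} [Fintype ι] [Fintype κ] (a : κ → ι → ℝ) (b : κ → ℝ) :
    ∃ x : ι → ℝ, (∀ i, 0 ≤ x i) ∧
      IsMinOn (fun c : ι → ℝ => l2norm (fun u => b u - ∑ i, c i * a u i) ^ 2)
        {c | ∀ i, 0 ≤ c i} x := by
  obtain ⟨w, ⟨x, hx, rfl⟩, hw⟩ := (isClosed_finite_cone
    (fun i => (WithLp.toLp 2 fun u => a u i : EuclideanSpace ℝ κ)) Finset.univ).exists_infDist_eq_dist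
    ⟨_, 0, fun _ => le_rfl, rfl⟩ (WithLp.toLp 2 b)
  have hdist : ∀ c : ι → ℝ, l2norm (fun u => b u - ∑ i, c i * a u i)
      = dist (WithLp.toLp 2 b : EuclideanSpace ℝ κ)
        (∑ i, c i • (WithLp.toLp 2 fun u => a u i : EuclideanSpace ℝ κ)) := by
    intro c
    rw [dist_eq_norm]
    unfold l2norm
    congr 1
    ext u
    simp
  refine ⟨x, hx, fun c hc => pow_le_pow_left₀ (l2norm_nonneg _) ?_ 2⟩
  rw [hdist, hdist, ← hw]
  exact Metric.infDist_le_dist_of_mem ⟨c, hc, rfl⟩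

/-! ## Moments of diagonal Gaussian mixtures -/

lemma integrable_pow_gaussianReal (c : ℝ) (v : ℝ≥0) (N : ℕ) :
    Integrable (fun x => x ^ N) (gaussianReal c v) := by
  have h := (memLp_id_gaussianReal' (μ := c) (v := v) (N : ENNReal) (by simp)).integrable_norm_pow'
  refine h.mono (by fun_prop) (Eventually.of_forall fun x => by simp)

lemma integral_sq_gaussianReal (c : ℝ) (v : ℝ≥0) :
    ∫ x, x ^ 2 ∂gaussianReal c v = c ^ 2 + v := by
  have h := variance_eq_sub (μ := gaussianReal c v) (X := id) (memLp_id_gaussianReal 2)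
  rw [variance_id_gaussianReal] at h
  simp only [Pi.pow_apply, id_eq, integral_id_gaussianReal] at h
  linarith

lemma moment_mixture {r d m : ℕ} {ω : Fin r → ℝ} (hω : ∀ i, 0 < ω i) (μ : Fin r → Fin d → ℝ)
    (v : Fin r → Fin d → ℝ≥0) {a : Fin m → Fin d} {c : Fin d → ℕ}
    (hc : ∀ x : Fin d → ℝ, tpow x m a = ∏ j, x j ^ c j) :
    moment (mixture ω μ v) m a
      = ∑ i, ω i * ∏ j, ∫ x, x ^ c j ∂gaussianReal (μ i j) (v i j) := by
  unfold moment mixture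
  simp only [hc]
  have hint : ∀ i, Integrable (fun x : Fin d → ℝ => ∏ j, x j ^ c j)
      (Measure.pi (fun j => gaussianReal (μ i j) (v i j))) := fun i =>
    Integrable.fintype_prod_dep (f := fun j (x : ℝ) => x ^ c j)
      fun j => integrable_pow_gaussianReal _ _ _
  rw [integral_finsetSum_measure fun i _ => (hint i).smul_measure ENNReal.ofReal_ne_top]
  refine Finset.sum_congr rfl fun i _ => ?_
  rw [integral_smul_measure, ENNReal.toReal_ofReal (hω i).le, smul_eq_mul,
    integral_fintype_prod_eq_prod (fun j (x : ℝ) => x ^ c j)]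

/-- Coordinates are independent within a component and none is repeated, so only first moments
occur. -/
lemma moment_of_injective {r d m : ℕ} {ω : Fin r → ℝ} (hω : ∀ i, 0 < ω i)
    (μ : Fin r → Fin d → ℝ) (v : Fin r → Fin d → ℝ≥0) (a : Fin m ↪ Fin d) :
    moment (mixture ω μ v) m a = tensorF ω μ m a := by
  have hc : ∀ x : Fin d → ℝ, tpow x m a
      = ∏ j, x j ^ (if j ∈ Finset.univ.map a then 1 else 0) := by
    intro x
    simp only [pow_ite, pow_one, pow_zero, Finset.prod_ite_mem, Finset.univ_inter,
      Finset.prod_map]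
    rfl
  rw [moment_mixture hω μ v hc]
  refine Finset.sum_congr rfl fun i _ => ?_
  rw [hc]
  congr 1
  refine Finset.prod_congr rfl fun j _ => ?_
  split_ifs
  · simp [integral_id_gaussianReal]
  · simp

lemma tpow_labelL {𝕜 : Type*} [CommRing 𝕜] {m d : ℕ} (hm : 2 ≤ m) (j : Fin d)
    (U : {U : Finset (Fin d) // U.card = m - 2 ∧ j ∉ U}) (x : Fin d → 𝕜) :
    tpow x m (labelL j U) = x j ^ 2 * evalMon U.1 x := by
  obtain ⟨N, rfl⟩ := Nat.exists_eq_add_of_le hm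
  rw [tpow, Fin.prod_univ_add]
  congr 1
  · simp [labelL, pow_two]
  · have h1 := tpow_orderEmbOfFin (m := 2 + N - 2) U.2.1 x
    rw [← h1, tpow]
    refine Fintype.prod_equiv (finCongr (by omega)) _ _ fun b => ?_
    simp only [labelL, Fin.val_natAdd]
    rw [dif_neg (by omega)]
    congr 2
    ext
    simp

lemma prod_eq_mul_prod_of_notMem {d : ℕ} {f : Fin d → ℝ} {j : Fin d} {U : Finset (Fin d)}
    (hj : j ∉ U) (hf : ∀ i, i ≠ j → i ∉ U → f i = 1) : ∏ i, f i = f j * ∏ i ∈ U, f i := by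
  rw [← Finset.mul_prod_erase _ _ (Finset.mem_univ j)]
  congr 1
  symm
  refine Finset.prod_subset (fun i hi => ?_) fun i hi hiU => hf i (Finset.ne_of_mem_erase hi) hiU
  exact Finset.mem_erase.2 ⟨fun h => hj (h ▸ hi), Finset.mem_univ _⟩

/-- Only the repeated label `j` contributes a second moment; this is where the variance enters. -/
lemma moment_labelL {r d m : ℕ} (hm : 2 ≤ m) {ω : Fin r → ℝ} (hω : ∀ i, 0 < ω i)
    (μ : Fin r → Fin d → ℝ) (v : Fin r → Fin d → ℝ≥0) (j : Fin d)
    (U : {U : Finset (Fin d) // U.card = m - 2 ∧ j ∉ U}) :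
    moment (mixture ω μ v) m (labelL j U)
      = ∑ i, ω i * ((μ i j ^ 2 + v i j) * evalMon U.1 (μ i)) := by
  have hc : ∀ x : Fin d → ℝ, tpow x m (labelL j U)
      = ∏ i, x i ^ (if i = j then 2 else if i ∈ U.1 then 1 else 0) := by
    intro x
    rw [tpow_labelL hm, prod_eq_mul_prod_of_notMem U.2.2 fun i hi hiU => by
      rw [if_neg hi, if_neg hiU, pow_zero], if_pos rfl]
    congr 1
    refine Finset.prod_congr rfl fun i hi => ?_
    rw [if_neg (fun h : i = j => U.2.2 (h ▸ hi)), if_pos hi, pow_one]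
  rw [moment_mixture hω μ v hc]
  refine Finset.sum_congr rfl fun i _ => ?_
  congr 1
  rw [prod_eq_mul_prod_of_notMem U.2.2 fun i hi hiU => by
    rw [if_neg hi, if_neg hiU]; simp, if_pos rfl, integral_sq_gaussianReal]
  congr 1
  refine Finset.prod_congr rfl fun l hl => ?_
  rw [if_neg (fun h : l = j => U.2.2 (h ▸ hl)), if_pos hl]
  simp [integral_id_gaussianReal]

/-! ## Real vectors up to roots of unity -/

lemma finite_pow_eq_one {m : ℕ} (hm : m ≠ 0) : {z : ℂ | z ^ m = 1}.Finite := by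
  have h := (Polynomial.nthRootsFinset m (1 : ℂ)).finite_toSet
  refine h.subset fun z hz => ?_
  exact (Polynomial.mem_nthRootsFinset (Nat.pos_of_ne_zero hm) _).2 hz

lemma exists_im_gap {m : ℕ} (hm : m ≠ 0) :
    ∃ c > 0, ∀ z : ℂ, z ^ m = 1 → |z.im| < c → z.im = 0 := by
  by_cases hne : ({z : ℂ | z ^ m = 1} ∩ {z | z.im ≠ 0}).Nonempty
  · obtain ⟨z, hz, hmin⟩ := Set.exists_min_image _ (fun z : ℂ => |z.im|)
      ((finite_pow_eq_one hm).inter_of_left {z | z.im ≠ 0}) hne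
    refine ⟨|z.im|, abs_pos.2 hz.2, fun w hw hwz => ?_⟩
    by_contra h
    exact absurd (hmin w ⟨hw, h⟩) (not_le.2 hwz)
  · refine ⟨1, one_pos, fun w hw _ => ?_⟩
    by_contra h
    exact hne ⟨w, hw, h⟩

/-- If `ζ x` is near the real vector `y` and `x j₀` is nearly real, then `|Im ζ| |y j₀| ≤ 2ε`.
Non-real `m`-th roots of unity have imaginary parts bounded away from `0`, so `ζ` is real, i.e. a
sign. -/
lemma exists_real_root {m d : ℕ} (hm : m ≠ 0) {y : Fin d → ℝ} {j₀ : Fin d} (h0 : y j₀ ≠ 0) :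
    ∃ δ > 0, ∀ (x : Fin d → ℂ) (ζ : ℂ) (ε : ℝ), ζ ^ m = 1 →
      (∀ j, ‖ζ * x j - y j‖ ≤ ε) → |(x j₀).im| ≤ ε → ε < δ →
      ∃ s : ℝ, s ^ m = 1 ∧ s ^ 2 = 1 ∧ ∀ j, |s * (x j).re - y j| ≤ ε := by
  obtain ⟨c, hc, hgap⟩ := exists_im_gap hm
  refine ⟨c * |y j₀| / 2, by positivity, fun x ζ ε hζ hx him hε => ?_⟩
  have hnorm : ‖ζ‖ = 1 := Complex.norm_eq_one_of_pow_eq_one hζ hm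
  have hconj : (starRingEnd ℂ) ζ * ζ = 1 := by
    rw [Complex.conj_mul', hnorm]; norm_num
  have h1 : (x j₀).im = -(ζ.im * y j₀) + ((starRingEnd ℂ) ζ * (ζ * x j₀ - y j₀)).im := by
    have : x j₀ = (starRingEnd ℂ) ζ * y j₀ + (starRingEnd ℂ) ζ * (ζ * x j₀ - y j₀) := by
      rw [← mul_add, add_sub_cancel, ← mul_assoc, hconj, one_mul]
    conv_lhs => rw [this]
    rw [Complex.add_im, Complex.mul_im]
    simp
  have h2 : |((starRingEnd ℂ) ζ * (ζ * x j₀ - y j₀)).im| ≤ ε := by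
    refine (Complex.abs_im_le_norm _).trans ?_
    rw [norm_mul, RCLike.norm_conj, hnorm, one_mul]
    exact hx j₀
  have h3 : |ζ.im| * |y j₀| ≤ 2 * ε := by
    rw [← abs_mul]
    rw [abs_le] at *
    constructor <;> linarith [h2.1, h2.2, him.1, him.2]
  have h4 : ζ.im = 0 := by
    refine hgap ζ hζ ?_
    have hy := abs_pos.2 h0
    nlinarith
  have h5 : ζ = (ζ.re : ℂ) := Complex.ext (by simp) (by simp [h4])
  refine ⟨ζ.re, ?_, ?_, fun j => ?_⟩
  · have := hζ
    rw [h5] at this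
    exact_mod_cast this
  · have := hnorm
    rw [h5, Complex.norm_real, Real.norm_eq_abs] at this
    rw [← sq_abs, this, one_pow]
  · have h6 := (Complex.abs_re_le_norm _).trans (hx j)
    rw [h5] at h6
    simpa using h6

/-! ## Consequences of stability -/

/-- Up to order and `m`-th roots of unity, approximate incomplete decompositions with `r` terms
are close to the decomposition `∑ y_i ^ ⊗m`. -/
def Stable {r d : ℕ} (m : ℕ) (y : Fin r → Fin d → ℝ) (C δ : ℝ) : Prop :=
  ∀ (q : Fin r → Fin d → ℂ) (ε : ℝ), 0 ≤ ε → ε < δ →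
    (∀ a : Fin m ↪ Fin d, ‖∑ i, tpow (q i) m a - ((∑ i, tpow (y i) m a : ℝ) : ℂ)‖ ≤ ε) →
    ∃ (τ : Equiv.Perm (Fin r)) (ζ : Fin r → ℂ), (∀ i, ζ i ^ m = 1) ∧
      ∀ i j, ‖ζ i * q (τ i) j - y i j‖ ≤ C * ε

lemma exists_pos_forall_le {ι : Type*} [Finite ι] {δ : ι → ℝ} (h : ∀ i, 0 < δ i) :
    ∃ δ' > 0, ∀ i, δ' ≤ δ i := by
  obtain ⟨δ', h1, h2⟩ := ((eventually_all.2 fun i => (eventually_le_nhds (h i)).filter_mono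
    nhdsWithin_le_nhds).and (self_mem_nhdsWithin (s := Set.Ioi (0 : ℝ)))).exists
  exact ⟨δ', h2, h1⟩

lemma ofReal_tpow {d m : ℕ} (x : Fin d → ℝ) (a : Fin m → Fin d) :
    ((tpow x m a : ℝ) : ℂ) = tpow (fun j => (x j : ℂ)) m a := by
  simp [tpow]

lemma norm_le_of_l2norm_le {κ E : Type*} [Fintype κ] [NormedAddCommGroup E] {f g : κ → E} {ε : ℝ}
    (h : l2norm f ≤ l2norm g) (hg : ∀ k, ‖g k‖ ≤ ε) (k : κ) :
    ‖f k‖ ≤ Fintype.card κ * ε := by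
  refine ((norm_le_l2norm f k).trans h).trans ((l2norm_le_sum g).trans ?_)
  refine (Finset.sum_le_card_nsmul _ _ ε fun k _ => hg k).trans_eq ?_
  simp

lemma continuous_l2norm {κ E : Type*} [Fintype κ] [NormedAddCommGroup E] :
    Continuous (l2norm : (κ → E) → ℝ) :=
  continuous_norm.comp (PiLp.continuous_toLp 2 _)

lemma continuous_tpow {𝕜 : Type*} [NormedField 𝕜] {d m : ℕ} (a : Fin m → Fin d) :
    Continuous (fun x : Fin d → 𝕜 => tpow x m a) := by
  unfold tpow
  fun_prop

section Stable

variable {r d m : ℕ} {y : Fin r → Fin d → ℝ} {C δ : ℝ}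

lemma sum_tpow_sub_le {T : (Fin m ↪ Fin d) → ℝ} {ε : ℝ}
    (hT : ∀ a, |T a - ∑ i, tpow (y i) m a| ≤ ε) {q : Fin r → Fin d → ℂ}
    (hq : l2norm (fun a => ((T a : ℝ) : ℂ) - ∑ i, onOmega (tpow (q i) m) a)
      ≤ l2norm (fun a => ((T a : ℝ) : ℂ) - ∑ i, onOmega (tpow (fun j => (y i j : ℂ)) m) a))
    (a : Fin m ↪ Fin d) :
    ‖∑ i, tpow (q i) m a - ((∑ i, tpow (y i) m a : ℝ) : ℂ)‖
      ≤ (Fintype.card (Fin m ↪ Fin d) + 1) * ε := by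
  have h1 : ∀ a, ‖((T a : ℝ) : ℂ) - ((∑ i, tpow (y i) m a : ℝ) : ℂ)‖ ≤ ε := fun a => by
    rw [← Complex.ofReal_sub, Complex.norm_real]; exact hT a
  have h2 := norm_le_of_l2norm_le hq (ε := ε) (fun a => by
    refine le_of_eq_of_le ?_ (h1 a)
    simp only [onOmega, Complex.ofReal_sum, ofReal_tpow]) a
  have h3 := norm_add_le (((T a : ℝ) : ℂ) - ((∑ i, tpow (y i) m a : ℝ) : ℂ))
    (-(((T a : ℝ) : ℂ) - ∑ i, onOmega (tpow (q i) m) a))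
  rw [norm_neg] at h3
  have h4 : ((T a : ℝ) : ℂ) - ((∑ i, tpow (y i) m a : ℝ) : ℂ)
      + -(((T a : ℝ) : ℂ) - ∑ i, onOmega (tpow (q i) m) a)
      = ∑ i, tpow (q i) m a - ((∑ i, tpow (y i) m a : ℝ) : ℂ) := by
    simp only [onOmega]; ring
  rw [h4] at h3
  linarith [h1 a]

/-- Points doing better than `y` have residual `O(ε)`, so stability, together with `|ζ| = 1`, places
them in a fixed ball and the minimum is attained. -/
lemma exists_isMinOn_decomposition (hm : m ≠ 0) (hC : 0 < C) (hδ : 0 < δ) (hst : Stable m y C δ) :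
    ∃ δ' > 0, ∀ (T : (Fin m ↪ Fin d) → ℝ) (ε : ℝ), 0 ≤ ε → ε < δ' →
      (∀ a, |T a - ∑ i, tpow (y i) m a| ≤ ε) →
      ∃ q, IsMinOn (fun x : Fin r → Fin d → ℂ =>
        l2norm (fun a => ((T a : ℝ) : ℂ) - ∑ i, onOmega (tpow (x i) m) a) ^ 2) Set.univ q := by
  obtain ⟨N, hN⟩ : ∃ N : ℝ, N = Fintype.card (Fin m ↪ Fin d) + 1 := ⟨_, rfl⟩
  have hNpos : 0 < N := by rw [hN]; positivity
  refine ⟨δ / N, by positivity, fun T ε hε hεδ hT => ?_⟩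
  rw [lt_div_iff₀ hNpos, mul_comm] at hεδ
  have hcont : Continuous (fun x : Fin r → Fin d → ℂ =>
      l2norm (fun a => ((T a : ℝ) : ℂ) - ∑ i, onOmega (tpow (x i) m) a) ^ 2) := by
    refine (continuous_l2norm.comp (continuous_pi fun a => ?_)).pow 2
    refine continuous_const.sub (continuous_finsetSum _ fun i _ => ?_)
    exact (continuous_tpow a).comp (continuous_apply i)
  obtain ⟨q, hq⟩ := hcont.exists_forall_le' (fun i j => (y i j : ℂ)) (by
    filter_upwards [(isCompact_closedBall (0 : Fin r → Fin d → ℂ)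
      (‖y‖ + C * δ)).compl_mem_cocompact] with x hx
    by_contra hlt
    rw [not_le] at hlt
    refine hx ?_
    have h1 := sum_tpow_sub_le hT (le_of_sq_le_sq hlt.le (l2norm_nonneg _))
    rw [← hN] at h1
    obtain ⟨τ, ζ, hζ, hclose⟩ := hst x _ (mul_nonneg hNpos.le hε) hεδ h1
    rw [mem_closedBall_zero_iff]
    have hb : 0 ≤ ‖y‖ + C * δ := by positivity
    refine (pi_norm_le_iff_of_nonneg hb).2 fun i => (pi_norm_le_iff_of_nonneg hb).2 fun j => ?_
    have h2 := hclose (τ.symm i) j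
    rw [Equiv.apply_symm_apply] at h2
    have h3 : ‖ζ (τ.symm i) * x i j‖ = ‖x i j‖ := by
      rw [norm_mul, Complex.norm_eq_one_of_pow_eq_one (hζ _) hm, one_mul]
    have h4 : ‖((y (τ.symm i) j : ℝ) : ℂ)‖ ≤ ‖y‖ := by
      rw [Complex.norm_real]
      exact (norm_le_pi_norm (y (τ.symm i)) j).trans (norm_le_pi_norm y _)
    have h5 := norm_sub_norm_le (ζ (τ.symm i) * x i j) (y (τ.symm i) j)
    have h6 : C * (N * ε) ≤ C * δ := mul_le_mul_of_nonneg_left hεδ.le hC.le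
    linarith)
  exact ⟨q, fun x _ => hq x⟩

/-- The vectors obtained by rotating an optimal decomposition towards the reals. -/
lemma exists_bound_rotated (hm : m ≠ 0) (hC : 0 < C) (hδ : 0 < δ) (hst : Stable m y C δ)
    {j₀ : Fin d} (h0 : ∀ i, y i j₀ ≠ 0) :
    ∃ C' > 0, ∃ δ' > 0, ∀ (T : (Fin m ↪ Fin d) → ℝ) (q : Fin r → Fin d → ℂ) (η : Fin r → ℂ)
      (ε : ℝ), 0 ≤ ε → ε < δ' → (∀ a, |T a - ∑ i, tpow (y i) m a| ≤ ε) →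
      IsMinOn (fun x : Fin r → Fin d → ℂ =>
        l2norm (fun a => ((T a : ℝ) : ℂ) - ∑ i, onOmega (tpow (x i) m) a) ^ 2) Set.univ q →
      (∀ i, η i ^ m = 1) → (∀ i, ∀ z : ℂ, z ^ m = 1 →
        l2norm (fun j => (η i * q i j).im) ≤ l2norm (fun j => (z * q i j).im)) →
      ∃ (τ : Equiv.Perm (Fin r)) (s : Fin r → ℝ), (∀ i, s i ^ m = 1) ∧
        ∀ i j, |s i * (η (τ i) * q (τ i) j).re - y i j| ≤ C' * ε := by
  choose δ₁ hδ₁ hreal using fun i => exists_real_root hm (h0 i)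
  obtain ⟨N, hN⟩ : ∃ N : ℝ, N = Fintype.card (Fin m ↪ Fin d) + 1 := ⟨_, rfl⟩
  have hNpos : 0 < N := by rw [hN]; positivity
  -- `N` passes from data error to residual; `d` comes from bounding the norm of the imaginary parts
  -- by the sum of `d` entries.
  obtain ⟨K, hK⟩ : ∃ K : ℝ, K = (d + 1) * (C * N) := ⟨_, rfl⟩
  have hKpos : 0 < K := by rw [hK]; positivity
  obtain ⟨δ₂, hδ₂, hmin⟩ := exists_pos_forall_le hδ₁
  refine ⟨K, hKpos, min (δ / N) (δ₂ / K), by positivity,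
    fun T q η ε hε hεδ hT hq hη hηmin => ?_⟩
  have hεN : N * ε < δ := by
    have := (lt_div_iff₀ hNpos).1 (hεδ.trans_le (min_le_left _ _))
    linarith
  have hεK : K * ε < δ₂ := by
    have := (lt_div_iff₀ hKpos).1 (hεδ.trans_le (min_le_right _ _))
    linarith
  have hqy : l2norm (fun a => ((T a : ℝ) : ℂ) - ∑ i, onOmega (tpow (q i) m) a)
      ≤ l2norm (fun a => ((T a : ℝ) : ℂ) - ∑ i, onOmega (tpow (fun j => (y i j : ℂ)) m) a) :=
    le_of_sq_le_sq (hq (Set.mem_univ fun i j => (y i j : ℂ))) (l2norm_nonneg _)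
  have h1 := sum_tpow_sub_le hT hqy
  rw [← hN] at h1
  obtain ⟨τ, ζ, hζ, hclose⟩ := hst q _ (mul_nonneg hNpos.le hε) hεN h1
  have hle : C * (N * ε) ≤ K * ε := by
    rw [hK]
    have : 0 ≤ C * (N * ε) := by positivity
    have hd : (0 : ℝ) ≤ d := d.cast_nonneg
    nlinarith
  have h2 : ∀ i, ∃ s : ℝ, s ^ m = 1 ∧ s ^ 2 = 1 ∧
      ∀ j, |s * (η (τ i) * q (τ i) j).re - y i j| ≤ K * ε := by
    intro i
    have hη0 : η (τ i) ≠ 0 := fun h => by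
      have := hη (τ i)
      rw [h, zero_pow hm] at this
      exact zero_ne_one this
    -- By minimality of `η`, the imaginary part is no larger than for the rotation `ζ`, which brings
    -- `q` within `O(ε)` of a real vector.
    refine hreal i (fun j => η (τ i) * q (τ i) j) (ζ i / η (τ i)) (K * ε)
      (by rw [div_pow, hζ, hη, div_one]) (fun j => ?_) ?_ (hεK.trans_le (hmin i))
    · rw [← mul_assoc, div_mul_cancel₀ _ hη0]
      exact (hclose i j).trans hle
    · have h3 := (norm_le_l2norm (fun j => (η (τ i) * q (τ i) j).im) j₀).trans
        ((hηmin (τ i) (ζ i) (hζ i)).trans (l2norm_le_sum _))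
      refine h3.trans ?_
      refine (Finset.sum_le_card_nsmul _ _ (C * (N * ε)) fun j _ => ?_).trans ?_
      · have h4 : (ζ i * q (τ i) j).im = (ζ i * q (τ i) j - y i j).im := by simp
        rw [h4]
        exact (Complex.abs_im_le_norm _).trans (hclose i j)
      · rw [Finset.card_univ, Fintype.card_fin, nsmul_eq_mul, hK]
        have : 0 ≤ C * (N * ε) := by positivity
        nlinarith
  choose s hs hs2 hsy using h2
  exact ⟨τ, s, hs, hsy⟩

end Stable

/-! ## Weights and means -/

/-- The moments of order `t` separate the weights from the means. -/
lemma near_weights_means {Q : Type*} {e : Q → ℝ} {r d m t : ℕ} (htm : t < m) {ρ : Fin r → ℝ}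
    {μ : Fin r → Fin d → ℝ} (hρ : ∀ i, 0 < ρ i)
    (hLI : LinearIndependent ℝ (fun i => onOmega (tpow (μ i) t)))
    {ρ' : Q → Fin r → ℝ} {μ' : Q → Fin r → Fin d → ℝ} {s : Q → Fin r → ℝ}
    (hρ' : ∀ q i, 0 ≤ ρ' q i) (hs : ∀ q i, s q i ^ 2 = 1)
    (hy : ∀ i j, Near e (fun q => s q i * (ρ' q i * μ' q i j)) (ρ i * μ i j))
    (ht : ∀ a : Fin t ↪ Fin d, Near e (fun q => ∑ i, ρ' q i ^ m * tpow (μ' q i) t a)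
      (∑ i, ρ i ^ m * tpow (μ i) t a)) :
    (∀ i, ∀ᶠ q in comap e (𝓝 0), s q i ^ t = 1) ∧
      (∀ i, Near e (fun q => ρ' q i ^ m) (ρ i ^ m)) ∧
      ∀ i j, Near e (fun q => s q i * μ' q i j) (μ i j) := by
  have hmt : m - t ≠ 0 := by omega
  have hsplit : ∀ x : ℝ, x ^ m = x ^ t * x ^ (m - t) := fun x => by
    rw [← pow_add]; congr 1; omega
  have hst : ∀ q i, s q i ^ t * s q i ^ t = 1 := fun q i => by
    rw [← mul_pow, ← pow_two, hs, one_pow]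
  -- Since `s^(2t) = 1`, `ρ'^m μ'^{⊗t} = (s^t ρ'^(m-t)) (s ρ' μ')^{⊗t}`: a linear system for `s^t
  -- ρ'^(m-t)` with nearly known, independent columns.
  have hx : ∀ i, Near e (fun q => s q i ^ t * ρ' q i ^ (m - t)) (ρ i ^ (m - t)) := by
    refine near_of_approx_solve
      (a := fun q (a : Fin t ↪ Fin d) i => tpow (fun j => s q i * (ρ' q i * μ' q i j)) t a)
      (a0 := fun a i => tpow (fun j => ρ i * μ i j) t a) ?_
      (fun a i => Near.tpow (hy i) a) fun a => ?_
    · have h1 : (fun i (a : Fin t ↪ Fin d) => tpow (fun j => ρ i * μ i j) t a)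
          = (fun i => Units.mk0 (ρ i ^ t) (pow_ne_zero t (hρ i).ne'))
            • fun i => onOmega (tpow (μ i) t) := by
        ext i a
        exact tpow_smul _ _ _
      rw [h1]
      exact hLI.units_smul _
    · have h1 : ∑ i, tpow (fun j => ρ i * μ i j) t a * ρ i ^ (m - t)
          = ∑ i, ρ i ^ m * tpow (μ i) t a := Finset.sum_congr rfl fun i _ => by
        rw [tpow_smul, hsplit]; ring
      rw [h1]
      refine (ht a).congr fun q => Finset.sum_congr rfl fun i _ => ?_
      rw [tpow_smul, tpow_smul, hsplit]
      linear_combination (-(ρ' q i ^ t * ρ' q i ^ (m - t) * tpow (μ' q i) t a)) * hst q i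
  -- The limit `ρ^(m-t)` is positive and `ρ' ≥ 0`, which excludes `s^t = -1`.
  have hsign : ∀ i, ∀ᶠ q in comap e (𝓝 0), s q i ^ t = 1 := by
    intro i
    filter_upwards [(hx i).tendsto.eventually_const_lt (pow_pos (hρ i) _)] with q hq
    have h1 : (s q i ^ t - 1) * (s q i ^ t + 1) = 0 := by linear_combination hst q i
    rcases mul_eq_zero.1 h1 with h | h
    · linarith
    · have h2 : s q i ^ t = -1 := by linarith
      rw [h2] at hq
      linarith [pow_nonneg (hρ' q i) (m - t)]
  have hρn : ∀ i, Near e (fun q => ρ' q i) (ρ i) := by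
    intro i
    have h1 := (hx i).map ℝ (F := fun x : ℝ => x ^ (((m - t : ℕ) : ℝ)⁻¹))
      (Real.differentiableAt_rpow_const_of_ne _ (pow_pos (hρ i) _).ne')
    rw [Real.pow_rpow_inv_natCast (hρ i).le hmt] at h1
    refine h1.congr' ((hsign i).mono fun q hq => ?_)
    rw [hq, one_mul, Real.pow_rpow_inv_natCast (hρ' q i) hmt]
  refine ⟨hsign, fun i => (hρn i).pow m, fun i j => ?_⟩
  have h1 := (hy i j).div (hρn i) (hρ i).ne'
  rw [mul_div_cancel_left₀ _ (hρ i).ne'] at h1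
  refine h1.congr' (((hρn i).eventually_ne (hρ i).ne').mono fun q hq => ?_)
  field_simp

/-- Stability of the joint moment equations of orders `m` and `t` on distinct labels. -/
lemma exists_bound_weights_means {r d m t : ℕ} (htm : t < m) {ω ρ : Fin r → ℝ}
    {μ : Fin r → Fin d → ℝ} (hρ : ∀ i, 0 < ρ i) (hρω : ∀ i, ρ i ^ m = ω i) {C δ : ℝ} (hC : 0 < C)
    (hδ : 0 < δ) (hst : Stable m (fun i j => ρ i * μ i j) C δ) {j₀ : Fin d}
    (h0 : ∀ i, μ i j₀ ≠ 0) (hLI : LinearIndependent ℝ (fun i => onOmega (tpow (μ i) t))) :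
    ∃ C' > 0, ∃ δ' > 0, ∀ (ω' : Fin r → ℝ) (μ' : Fin r → Fin d → ℝ) (ε : ℝ), 0 ≤ ε → ε < δ' →
      (∀ i, 0 ≤ ω' i) →
      (∀ a : Fin m ↪ Fin d, |∑ i, ω' i * tpow (μ' i) m a - tensorF ω μ m a| ≤ ε) →
      (∀ a : Fin t ↪ Fin d, |∑ i, ω' i * tpow (μ' i) t a - tensorF ω μ t a| ≤ ε) →
      ∃ (τ : Equiv.Perm (Fin r)) (s : Fin r → ℝ),
        (∀ i, s i ^ m = 1 ∧ s i ^ t = 1 ∧ s i ^ 2 = 1) ∧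
        ∀ i, |ω' (τ i) - ω i| ≤ C' * ε ∧ ∀ j, |s i * μ' (τ i) j - μ i j| ≤ C' * ε := by
  have hm : m ≠ 0 := by omega
  choose δ₁ hδ₁ hreal using fun i =>
    exists_real_root hm (y := fun j => ρ i * μ i j) (mul_ne_zero (hρ i).ne' (h0 i))
  obtain ⟨δ₂, hδ₂, hmin⟩ := exists_pos_forall_le hδ₁
  obtain ⟨hsign, hω, hμ⟩ := near_weights_means
    (Q := {x : (Fin r → ℝ) × (Fin r → Fin d → ℝ) × (Fin r → ℝ) × ℝ // (∀ i, 0 ≤ x.1 i) ∧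
      (∀ i, x.2.2.1 i ^ 2 = 1) ∧
      (∀ i j, |x.2.2.1 i * (x.1 i * x.2.1 i j) - ρ i * μ i j| ≤ C * |x.2.2.2|) ∧
      ∀ a : Fin t ↪ Fin d, |∑ i, x.1 i ^ m * tpow (x.2.1 i) t a - ∑ i, ρ i ^ m * tpow (μ i) t a|
        ≤ 1 * |x.2.2.2|}) (e := fun x => x.1.2.2.2) htm hρ hLI
    (ρ' := fun x => x.1.1) (μ' := fun x => x.1.2.1) (s := fun x => x.1.2.2.1)
    (fun x => x.2.1) (fun x => x.2.2.1) (fun i j => near_of_le C fun x => x.2.2.2.1 i j)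
    (fun a => near_of_le 1 fun x => x.2.2.2.2 a)
  obtain ⟨δ₃, hδ₃, hsign⟩ := eventually_comap_zero.1 (eventually_all.2 hsign)
  obtain ⟨C₄, hC₄, δ₄, hδ₄, hω⟩ := exists_bound_of_near hω
  obtain ⟨C₅, hC₅, δ₅, hδ₅, hμ⟩ := exists_bound_of_near
    (fun ij : Fin r × Fin d => hμ ij.1 ij.2)
  refine ⟨max C₄ C₅, by positivity, min (min δ (δ₂ / C)) (min δ₃ (min δ₄ δ₅)), by positivity,
    fun ω' μ' ε hε hεδ hω' hm' ht' => ?_⟩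
  simp only [lt_min_iff] at hεδ
  obtain ⟨⟨hεδ, hεδ₂⟩, hεδ₃, hεδ₄, hεδ₅⟩ := hεδ
  have hεδ₂' : C * ε < δ₂ := by
    have := (lt_div_iff₀ hC).1 hεδ₂
    linarith
  -- Absorbing the weights into the vectors gives a real decomposition, so the imaginary-part
  -- condition of `hreal` is trivial.
  obtain ⟨ρ', hρ'⟩ : ∃ ρ' : Fin r → ℝ, ∀ i, 0 ≤ ρ' i ∧ ρ' i ^ m = ω' i :=
    ⟨fun i => ω' i ^ ((m : ℝ)⁻¹), fun i => ⟨Real.rpow_nonneg (hω' i) _,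
      Real.rpow_inv_natCast_pow (hω' i) hm⟩⟩
  obtain ⟨τ, ζ, hζ, hclose⟩ := hst (fun i j => ((ρ' i * μ' i j : ℝ) : ℂ)) ε hε hεδ (by
    intro a
    have h1 := hm' a
    have h2 : ∑ i, tpow (fun j => ((ρ' i * μ' i j : ℝ) : ℂ)) m a
        - ((∑ i, tpow (fun j => ρ i * μ i j) m a : ℝ) : ℂ)
        = ((∑ i, ω' i * tpow (μ' i) m a - tensorF ω μ m a : ℝ) : ℂ) := by
      simp only [← ofReal_tpow, ← Complex.ofReal_sum, ← Complex.ofReal_sub, tpow_smul,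
        (hρ' _).2, hρω, tensorF]
    rw [h2, Complex.norm_real]
    exact h1)
  have h2 : ∀ i, ∃ s : ℝ, s ^ m = 1 ∧ s ^ 2 = 1 ∧
      ∀ j, |s * (ρ' (τ i) * μ' (τ i) j) - ρ i * μ i j| ≤ C * ε := by
    intro i
    obtain ⟨s, hs, hs2, h3⟩ := hreal i (fun j => ((ρ' (τ i) * μ' (τ i) j : ℝ) : ℂ)) (ζ i) (C * ε)
      (hζ i) (hclose i) (by rw [Complex.ofReal_im, abs_zero]; positivity)
      (hεδ₂'.trans_le (hmin i))
    exact ⟨s, hs, hs2, fun j => by simpa using h3 j⟩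
  choose s hs hs2 hsy using h2
  rw [← abs_of_nonneg hε] at hsy ht' hεδ₃ hεδ₄ hεδ₅ ⊢
  have hprop : (∀ i, 0 ≤ ρ' (τ i)) ∧ (∀ i, s i ^ 2 = 1) ∧
      (∀ i j, |s i * (ρ' (τ i) * μ' (τ i) j) - ρ i * μ i j| ≤ C * |ε|) ∧
      ∀ a : Fin t ↪ Fin d, |∑ i, ρ' (τ i) ^ m * tpow (μ' (τ i)) t a
        - ∑ i, ρ i ^ m * tpow (μ i) t a| ≤ 1 * |ε| := by
    refine ⟨fun i => (hρ' _).1, hs2, hsy, fun a => ?_⟩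
    have h3 := ht' a
    rw [← Equiv.sum_comp τ] at h3
    simp only [(hρ' _).2, hρω]
    rw [one_mul]
    exact h3
  refine ⟨τ, s, fun i => ⟨hs i, hsign ⟨(fun i => ρ' (τ i), fun i => μ' (τ i), s, ε), hprop⟩
    hεδ₃ i, hs2 i⟩, fun i => ⟨?_, fun j => ?_⟩⟩
  · have h3 := hω ⟨(fun i => ρ' (τ i), fun i => μ' (τ i), s, ε), hprop⟩ hεδ₄ i
    simp only [(hρ' _).2, hρω, Real.norm_eq_abs] at h3
    exact h3.trans (mul_le_mul_of_nonneg_right (le_max_left _ _) (abs_nonneg _))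
  · have h3 := hμ ⟨(fun i => ρ' (τ i), fun i => μ' (τ i), s, ε), hprop⟩ hεδ₅ (i, j)
    exact h3.trans (mul_le_mul_of_nonneg_right (le_max_right _ _) (abs_nonneg _))

/-! ## The nonlinear least squares problem -/

section Nls

variable {r d m t : ℕ} {ω : Fin r → ℝ} {μ : Fin r → Fin d → ℝ} {Mm : Tensor ℝ m d}
  {Mt : Tensor ℝ t d} {ε : ℝ}

lemma abs_residual_le_of_l2norm_sq_le {κ : Type*} [Fintype κ] {f g h : κ → ℝ} {B : ℝ}
    (hε : 0 ≤ ε) (hfg : l2norm (fun k => f k - g k) ^ 2 ≤ B) (hB : B ≤ 2 * (ε * ε))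
    (hfh : ∀ k, |f k - h k| ≤ ε) (k : κ) : |g k - h k| ≤ 3 * ε := by
  have h1 := norm_le_l2norm (fun k => f k - g k) k
  have h2 : l2norm (fun k => f k - g k) ≤ 2 * ε :=
    le_of_sq_le_sq (by nlinarith) (by linarith)
  have h3 : |f k - g k| ≤ 2 * ε := h1.trans h2
  have h4 := hfh k
  rw [abs_le] at *
  constructor <;> linarith [h3.1, h3.2, h4.1, h4.2]

/-- The truth has objective at most `2ε²`, so each residual is at most `2ε`; the data error adds
another `ε`. -/
lemma residual_le_of_nlsObj_le (hε : 0 ≤ ε)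
    (hm : l2norm (fun a : Fin m ↪ Fin d => Mm a - tensorF ω μ m a) ≤ ε)
    (ht : l2norm (fun a : Fin t ↪ Fin d => Mt a - tensorF ω μ t a) ≤ ε)
    {x : (Fin r → ℝ) × (Fin r → Fin d → ℝ)} (hx : nlsObj Mm Mt x ≤ nlsObj Mm Mt (ω, μ)) :
    (∀ a : Fin m ↪ Fin d, |∑ i, x.1 i * tpow (x.2 i) m a - tensorF ω μ m a| ≤ 3 * ε) ∧
    ∀ a : Fin t ↪ Fin d, |∑ i, x.1 i * tpow (x.2 i) t a - tensorF ω μ t a| ≤ 3 * ε := by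
  have hB : nlsObj Mm Mt (ω, μ) ≤ 2 * (ε * ε) := by
    have h1 := mul_le_mul hm hm (l2norm_nonneg _) hε
    have h2 := mul_le_mul ht ht (l2norm_nonneg _) hε
    rw [← pow_two] at h1 h2
    have h3 : nlsObj Mm Mt (ω, μ) = l2norm (fun a : Fin m ↪ Fin d => Mm a - tensorF ω μ m a) ^ 2
      + l2norm (fun a : Fin t ↪ Fin d => Mt a - tensorF ω μ t a) ^ 2 := rfl
    linarith
  have hx' := hx.trans hB
  unfold nlsObj at hx'
  exact ⟨abs_residual_le_of_l2norm_sq_le (f := fun a : Fin m ↪ Fin d => Mm a) hε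
      ((le_add_of_nonneg_right (sq_nonneg _)).trans hx') le_rfl
      fun a => (norm_le_l2norm _ a).trans hm,
    abs_residual_le_of_l2norm_sq_le (f := fun a : Fin t ↪ Fin d => Mt a) hε
      ((le_add_of_nonneg_left (sq_nonneg _)).trans hx') le_rfl
      fun a => (norm_le_l2norm _ a).trans ht⟩

lemma continuous_nlsObj : Continuous (nlsObj (r := r) Mm Mt) := by
  have h : ∀ {N : ℕ} (T : Tensor ℝ N d), Continuous
      (fun x : (Fin r → ℝ) × (Fin r → Fin d → ℝ) => l2norm (fun a : Fin N ↪ Fin d =>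
        onOmega T a - ∑ i, x.1 i * onOmega (tpow (x.2 i) N) a) ^ 2) := by
    intro N T
    refine (continuous_l2norm.comp (continuous_pi fun a => ?_)).pow 2
    refine continuous_const.sub (continuous_finsetSum _ fun i _ => ?_)
    exact ((continuous_apply i).comp continuous_fst).mul ((continuous_tpow a).comp
      ((continuous_apply i).comp continuous_snd))
  exact (h Mm).add (h Mt)

lemma isClosed_feasible : IsClosed (feasible r d) := by
  have h : feasible r d = {x | ∑ i, x.1 i = 1} ∩ ⋂ i, {x | 0 ≤ x.1 i} := by
    ext x; simp [feasible]
  rw [h]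
  refine (isClosed_eq (by fun_prop) continuous_const).inter (isClosed_iInter fun i =>
    isClosed_le continuous_const (by fun_prop))

lemma exists_isMinOn_nlsObj (hω : (ω, μ) ∈ feasible r d) (hε : 0 ≤ ε)
    (hm : l2norm (fun a : Fin m ↪ Fin d => Mm a - tensorF ω μ m a) ≤ ε)
    (ht : l2norm (fun a : Fin t ↪ Fin d => Mt a - tensorF ω μ t a) ≤ ε) {K : ℝ}
    (hbound : ∀ (ω' : Fin r → ℝ) (μ' : Fin r → Fin d → ℝ), (∀ i, 0 ≤ ω' i) →
      (∀ a : Fin m ↪ Fin d, |∑ i, ω' i * tpow (μ' i) m a - tensorF ω μ m a| ≤ 3 * ε) →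
      (∀ a : Fin t ↪ Fin d, |∑ i, ω' i * tpow (μ' i) t a - tensorF ω μ t a| ≤ 3 * ε) →
      ∀ i, |ω' i| ≤ K ∧ ∀ j, |μ' i j| ≤ K) :
    ∃ x ∈ feasible r d, IsMinOn (nlsObj Mm Mt) (feasible r d) x := by
  refine continuous_nlsObj.continuousOn.exists_isMinOn' isClosed_feasible hω ?_
  filter_upwards [mem_inf_of_left (isCompact_closedBall
      (0 : (Fin r → ℝ) × (Fin r → Fin d → ℝ)) |K|).compl_mem_cocompact,
    mem_inf_of_right (mem_principal_self _)] with x hx hxf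
  by_contra hlt
  rw [not_le] at hlt
  refine hx ?_
  obtain ⟨h1, h2⟩ := residual_le_of_nlsObj_le hε hm ht hlt.le
  have h3 := hbound x.1 x.2 hxf.2 h1 h2
  rw [mem_closedBall_zero_iff, Prod.norm_def, max_le_iff]
  have hb := abs_nonneg K
  exact ⟨(pi_norm_le_iff_of_nonneg hb).2 fun i => (h3 i).1.trans (le_abs_self K),
    (pi_norm_le_iff_of_nonneg hb).2 fun i => (pi_norm_le_iff_of_nonneg hb).2 fun j =>
      ((h3 i).2 j).trans (le_abs_self K)⟩

end Nls

/-! ## Variances -/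

/-- Fix `i₀` and a monomial of `B0` nonzero at `μ i₀`. Dropping one of its variables (`x_j` if
present) leaves a factor of degree `p - 1`, and its products with `O_l` have degree `m - 2` and
avoid `j`. A linear relation restricts to one on `O_l`, with coefficients `c_i` times that factor.
-/
lemma linearIndependent_evalMon_pairs {n m r p k : ℕ} (hp : 1 ≤ p) (hpm : p + 2 ≤ m)
    {μ : Fin r → Fin (n + 1) → ℝ}
    (hB0 : LinearIndependent ℝ (fun i (β : ↥(B0 n k p r)) => evalMon β.1 (μ i)))
    (hO : ∀ l : ↥(high n k), LinearIndependent ℝ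
      (fun i (γ : ↥(Oset n k (m - p - 1) l.1)) => evalMon γ.1 (μ i)))
    (hne : (high n k).Nonempty) (j : Fin (n + 1)) :
    LinearIndependent ℝ (fun i (U : {U : Finset (Fin (n + 1)) // U.card = m - 2 ∧ j ∉ U}) =>
      evalMon U.1 (μ i)) := by
  rw [Fintype.linearIndependent_iff]
  intro c hc i₀
  obtain ⟨ν, hν⟩ := Function.ne_iff.1 (hB0.ne_zero i₀)
  have hlow := B0_subset_low ν
  obtain ⟨x, hx, hjx⟩ : ∃ x ∈ ν.1, j ∉ ν.1.erase x := by
    by_cases hj : j ∈ ν.1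
    · exact ⟨j, hj, Finset.notMem_erase _ _⟩
    · obtain ⟨x, hx⟩ : ν.1.Nonempty := Finset.card_pos.1 (by rw [B0_card ν]; omega)
      exact ⟨x, hx, fun h => hj (Finset.mem_of_mem_erase h)⟩
  obtain ⟨l, hl⟩ : ∃ l : ↥(high n k), j ∉ (high n k).erase l.1 := by
    by_cases hj : j ∈ high n k
    · exact ⟨⟨j, hj⟩, Finset.notMem_erase _ _⟩
    · obtain ⟨l, hl⟩ := hne
      exact ⟨⟨l, hl⟩, fun h => hj (Finset.mem_of_mem_erase h)⟩
  have hcard : (ν.1.erase x).card = p - 1 := by rw [Finset.card_erase_of_mem hx, B0_card ν]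
  have hLI := Fintype.linearIndependent_iff.1 (hO l) (fun i => c i * evalMon (ν.1.erase x) (μ i))
    (by
      ext γ
      have hdis : Disjoint (ν.1.erase x) γ.1 :=
        (disjoint_low_high.mono_left ((Finset.erase_subset _ _).trans hlow)).mono_right
          ((Oset_subset γ).trans (Finset.erase_subset _ _))
      have h1 := congrFun hc ⟨ν.1.erase x ∪ γ.1, by
        rw [Finset.card_union_of_disjoint hdis, hcard, Oset_card γ]; omega, by
        rw [Finset.mem_union, not_or]; exact ⟨hjx, fun h => hl (Oset_subset γ h)⟩⟩
      simp only [Finset.sum_apply, Pi.smul_apply, smul_eq_mul, Pi.zero_apply, evalMon,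
        Finset.prod_union hdis] at h1 ⊢
      rw [← h1]
      exact Finset.sum_congr rfl fun i _ => mul_assoc _ _ _) i₀
  refine (mul_eq_zero.1 hLI).resolve_right (Finset.prod_ne_zero_iff.2 fun b hb => ?_)
  exact Finset.prod_ne_zero_iff.1 hν b (Finset.mem_of_mem_erase hb)

/-- Perturbation of the nonnegative least squares problems for the variances. -/
lemma exists_bound_variances {r d m : ℕ} (hm : 2 ≤ m) {ω : Fin r → ℝ} (hω : ∀ i, 0 < ω i)
    {μ y : Fin r → Fin d → ℝ} {v : Fin r → Fin d → ℝ≥0}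
    (hy : ∀ i (a : Fin m → Fin d), tpow (y i) m a = ω i * tpow (μ i) m a)
    (hLI : ∀ j, LinearIndependent ℝ
      (fun i (U : {U : Finset (Fin d) // U.card = m - 2 ∧ j ∉ U}) => evalMon U.1 (μ i))) (K : ℝ) :
    ∃ C > 0, ∃ δ > 0, ∀ (T : Tensor ℝ m d) (q μ' θ : Fin r → Fin d → ℝ) (ω' : Fin r → ℝ) (ε : ℝ),
      0 ≤ ε → ε < δ → (∀ a, |T a - moment (mixture ω μ v) m a| ≤ ε) →
      (∀ i j, |q i j - y i j| ≤ K * ε) → (∀ i, |ω' i - ω i| ≤ K * ε) →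
      (∀ i j, |μ' i j - μ i j| ≤ K * ε) →
      (∀ j, l2norm (fun U : {U : Finset (Fin d) // U.card = m - 2 ∧ j ∉ U} =>
          (T (labelL j U) - ∑ i, tpow (q i) m (labelL j U))
            - ∑ i, ω' i * evalMon U.1 (μ' i) * θ i j)
        ≤ l2norm (fun U : {U : Finset (Fin d) // U.card = m - 2 ∧ j ∉ U} =>
          (T (labelL j U) - ∑ i, tpow (q i) m (labelL j U))
            - ∑ i, ω' i * evalMon U.1 (μ' i) * v i j)) →
      ∀ i j, |θ i j - v i j| ≤ C * ε := by
  let Q := {x : Tensor ℝ m d × (Fin r → Fin d → ℝ) × (Fin r → Fin d → ℝ) ×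
      (Fin r → Fin d → ℝ) × (Fin r → ℝ) × ℝ //
    (∀ a, |x.1 a - moment (mixture ω μ v) m a| ≤ |x.2.2.2.2.2|) ∧
    (∀ i j, |x.2.1 i j - y i j| ≤ K * |x.2.2.2.2.2|) ∧
    (∀ i, |x.2.2.2.2.1 i - ω i| ≤ K * |x.2.2.2.2.2|) ∧
    (∀ i j, |x.2.2.1 i j - μ i j| ≤ K * |x.2.2.2.2.2|) ∧
    ∀ j, l2norm (fun U : {U : Finset (Fin d) // U.card = m - 2 ∧ j ∉ U} =>
          (x.1 (labelL j U) - ∑ i, tpow (x.2.1 i) m (labelL j U))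
            - ∑ i, x.2.2.2.2.1 i * evalMon U.1 (x.2.2.1 i) * x.2.2.2.1 i j)
        ≤ l2norm (fun U : {U : Finset (Fin d) // U.card = m - 2 ∧ j ∉ U} =>
          (x.1 (labelL j U) - ∑ i, tpow (x.2.1 i) m (labelL j U))
            - ∑ i, x.2.2.2.2.1 i * evalMon U.1 (x.2.2.1 i) * v i j)}
  have hθ : ∀ j i, Near (fun x : Q => x.1.2.2.2.2.2) (fun x => x.1.2.2.2.1 i j) (v i j : ℝ) := by
    intro j
    refine near_of_minimizer
      (a := fun (x : Q) (U : {U : Finset (Fin d) // U.card = m - 2 ∧ j ∉ U}) i =>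
        x.1.2.2.2.2.1 i * evalMon U.1 (x.1.2.2.1 i))
      (a0 := fun U i => ω i * evalMon U.1 (μ i))
      (b := fun (x : Q) (U : {U : Finset (Fin d) // U.card = m - 2 ∧ j ∉ U}) =>
        x.1.1 (labelL j U) - ∑ i, tpow (x.1.2.1 i) m (labelL j U))
      (x0 := fun i => (v i j : ℝ)) ?_ (fun U i => ?_) (fun U => ?_) fun x => x.2.2.2.2.2 j
    · exact (hLI j).units_smul fun i => Units.mk0 (ω i) (hω i).ne'
    · exact (near_of_le K fun x => x.2.2.2.1 i).mul
        (Near.evalMon _ fun l _ => near_of_le K fun x => x.2.2.2.2.1 i l)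
    · have h1 : Near (fun x : Q => x.1.2.2.2.2.2) (fun x => x.1.1 (labelL j U))
          (moment (mixture ω μ v) m (labelL j U)) :=
        near_of_le 1 fun x => by rw [one_mul]; exact x.2.1 _
      have h2 : Near (fun x : Q => x.1.2.2.2.2.2)
          (fun x => ∑ i, tpow (x.1.2.1 i) m (labelL j U)) (∑ i, tpow (y i) m (labelL j U)) :=
        Near.sum fun i _ => Near.tpow (fun l => near_of_le K fun x => x.2.2.1 i l) _
      -- Subtracting `∑ y_i^{⊗m}` cancels the `μ_{ij}²` part of the second moments and leaves the
      -- variances.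
      have h3 : moment (mixture ω μ v) m (labelL j U) - ∑ i, tpow (y i) m (labelL j U)
          = ∑ i, ω i * evalMon U.1 (μ i) * v i j := by
        simp only [moment_labelL hm hω, hy, tpow_labelL hm]
        rw [← Finset.sum_sub_distrib]
        exact Finset.sum_congr rfl fun i _ => by ring
      rw [← h3]
      exact h1.sub h2
  obtain ⟨C, hC, δ, hδ, h⟩ := exists_bound_of_near fun ij : Fin r × Fin d => hθ ij.2 ij.1
  refine ⟨C, hC, δ, hδ, fun T q μ' θ ω' ε hε hεδ hT hq hω' hμ' hmin i j => ?_⟩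
  rw [← abs_of_nonneg hε] at hT hq hω' hμ' hεδ ⊢
  exact h ⟨(T, q, μ', θ, ω', ε), hT, hq, hω', hμ', hmin⟩ hεδ (i, j)

/-! ## Existence of runs -/

lemma exists_isMinOn_matA {n m r p k : ℕ} (T : Tensor ℝ m (n + 1)) (α : B1 n k p) :
    ∃ g, IsMinOn (fun g : ↥(B0 n k p r) → ℂ =>
      l2norm ((matA r p k T α).mulVec g - vecb p k T α) ^ 2) Set.univ g := by
  obtain ⟨g, hg⟩ := exists_isMinOn_affine (matA r p k T α).mulVecLin (-vecb p k T α)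
  refine ⟨g, ?_⟩
  have h1 : ∀ g : ↥(B0 n k p r) → ℂ, (matA r p k T α).mulVec g - vecb p k T α
      = fun u => (-vecb p k T α) u + (matA r p k T α).mulVecLin g u := fun g => by
    ext u
    simp [sub_eq_neg_add]
  simp only [h1]
  exact hg

lemma exists_isMinOn_sum_mul {κ ι : Type*} [Fintype κ] [Fintype ι] (b : κ → ℂ) (a : κ → ι → ℂ) :
    ∃ x, IsMinOn (fun c : ι → ℂ => l2norm (fun u => b u - ∑ i, c i * a u i) ^ 2) Set.univ x := by
  exact exists_isMinOn_sub
    { toFun := fun (c : ι → ℂ) u => ∑ i, c i * a u i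
      map_add' := fun c c' => by ext u; simp [add_mul, Finset.sum_add_distrib]
      map_smul' := fun z c => by ext u; simp [Finset.mul_sum, mul_assoc] } b

lemma exists_isMinOn_sum_mul_prod {κ ι ν : Type*} [Fintype κ] [Fintype ι] (b : κ → ℂ)
    (a : κ → ι → ℂ) (f : κ → ν) :
    ∃ x, IsMinOn (fun c : ι → ν → ℂ => l2norm (fun u => b u - ∑ i, c i (f u) * a u i) ^ 2)
      Set.univ x := by
  exact exists_isMinOn_sub
    { toFun := fun (c : ι → ν → ℂ) u => ∑ i, c i (f u) * a u i
      map_add' := fun c c' => by ext u; simp [add_mul, Finset.sum_add_distrib]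
      map_smul' := fun z c => by ext u; simp [Finset.mul_sum, mul_assoc] } b

/-- The linear least squares problems are always solvable; only the eigenvectors and the nonlinear
problem need hypotheses. -/
lemma nonempty_approxRun {n m r p k : ℕ} {T : Tensor ℝ m (n + 1)} {ξ : ↥(high n k) → ℂ}
    (heig : ∀ G : Matrix ↥(B0 n k p r) (B1 n k p) ℂ,
      (∀ α, IsMinOn (fun g : ↥(B0 n k p r) → ℂ =>
        l2norm ((matA r p k T α).mulVec g - vecb p k T α) ^ 2) Set.univ (fun β => G β α)) →
      ∃ v : Fin r → ↥(B0 n k p r) → ℂ, (∀ i, l2norm (v i) = 1) ∧ LinearIndependent ℂ v ∧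
        ∀ i, ∃ c : ℂ, (Nxi ξ G).mulVec (v i) = c • v i)
    (hq : ∃ q, IsMinOn (fun x : Fin r → Fin (n + 1) → ℂ =>
      l2norm (fun a : Fin m ↪ Fin (n + 1) =>
        ((onOmega T a : ℝ) : ℂ) - ∑ i, onOmega (tpow (x i) m) a) ^ 2) Set.univ q) :
    Nonempty (ApproxRun r p k T ξ) := by
  choose g hg using fun α => exists_isMinOn_matA (r := r) (p := p) (k := k) T α
  obtain ⟨e, he1, he2, he3⟩ := heig (fun β α => g α β) hg
  obtain ⟨q, hq⟩ := hq
  obtain ⟨gam, hgam⟩ := exists_isMinOn_sum_mul_prod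
    (fun SU : ↥(J1 n k p) × ↥(J2 n k (m - p - 1)) =>
      ((entry T (insert 0 (SU.1.1 ∪ SU.2.1)) : ℝ) : ℂ))
    (fun SU (i : Fin r) => evalMon SU.2.1 (wVec (fun β α => g α β) (e i))) (fun SU => SU.1)
  choose v hv using fun j : ↥(low n k) => exists_isMinOn_sum_mul
    (fun SU : {S : ↥(J1 n k p) // j.1 ∉ S.1} × ↥(J2 n k (m - p - 1)) =>
      ((entry T (insert j.1 (SU.1.1.1 ∪ SU.2.1)) : ℝ) : ℂ))
    (fun SU (i : Fin r) => gam i SU.1.1 * evalMon SU.2.1 (wVec (fun β α => g α β) (e i)))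
  obtain ⟨lam, hlam⟩ := exists_isMinOn_sum_mul
    (fun a : Fin m ↪ Fin (n + 1) => ((onOmega T a : ℝ) : ℂ))
    (fun a (i : Fin r) => onOmega (tpow (joinVec (fun j => v j i)
      (wVec (fun β α => g α β) (e i))) m) a)
  exact ⟨{
    G := fun β α => g α β
    G_min := hg
    e := e
    e_unit := he1
    e_indep := he2
    e_eigen := he3
    w := fun i => wVec (fun β α => g α β) (e i)
    w_eq := fun _ => rfl
    gam := gam
    gam_min := hgam
    v := fun i j => v j i
    v_min := hv
    lam := lam
    lam_min := hlam
    qHat := _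
    qHat_eq := fun _ => rfl
    q := q
    q_min := hq }⟩

lemma nonempty_learnRun {n m t r p k : ℕ} (hm : m ≠ 0) {Mm : Tensor ℝ m (n + 1)}
    {Mt : Tensor ℝ t (n + 1)} {ξ : ↥(high n k) → ℂ} (hA : Nonempty (ApproxRun r p k Mm ξ))
    (hnls : ∃ x ∈ feasible r (n + 1), IsMinOn (nlsObj Mm Mt) (feasible r (n + 1)) x) :
    Nonempty (LearnRun r p k Mm Mt ξ) := by
  obtain ⟨A⟩ := hA
  obtain ⟨⟨ω, μ⟩, hfeas, hnls⟩ := hnls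
  choose η hη hηmin using fun i => Set.exists_min_image {z : ℂ | z ^ m = 1}
    (fun z => l2norm (fun j => (z * A.q i j).im)) (finite_pow_eq_one hm) ⟨1, one_pow m⟩
  obtain ⟨β, hβ, hβmin⟩ := exists_isMinOn_nonneg
    (fun (a : Fin t ↪ Fin (n + 1)) (i : Fin r) =>
      onOmega (tpow (fun j => (η i * A.q i j).re) t) a) (fun a => onOmega Mt a)
  choose θ hθ hθmin using fun j : Fin (n + 1) => exists_isMinOn_nonneg
    (fun (U : {U : Finset (Fin (n + 1)) // U.card = m - 2 ∧ j ∉ U}) (i : Fin r) =>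
      ω i * tpow (μ i) (m - 2) (U.1.orderEmbOfFin U.2.1))
    (fun U => Mm (labelL j U) - ∑ i, tpow (fun j => (η i * A.q i j).re) m (labelL j U))
  exact ⟨{
    approx := A
    eta := η
    eta_root := hη
    eta_min := hηmin
    qCheck := fun i j => (η i * A.q i j).re
    qCheck_eq := fun _ _ => rfl
    beta := β
    beta_nonneg := hβ
    beta_min := hβmin
    omegaHat := _
    omegaHat_eq := fun _ => rfl
    muHat := _
    muHat_eq := fun _ _ => rfl
    omega := ω
    mu := μ
    feas := hfeas
    nls_min := hnls
    theta := fun i j => θ j i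
    theta_nonneg := fun i j => hθ j i
    theta_min := hθmin }⟩

/-! ## The model -/

lemma linearIndependent_ofReal {ι κ : Type*} [Fintype ι] [Fintype κ] {v : ι → κ → ℝ}
    (h : LinearIndependent ℝ v) : LinearIndependent ℂ (fun i k => ((v i k : ℝ) : ℂ)) := by
  classical
  obtain ⟨B, hB⟩ := exists_dual h
  rw [Fintype.linearIndependent_iff]
  intro c hc i
  have h1 : ∑ k, (B i k : ℂ) * ∑ j, c j * (v j k : ℂ) = 0 := by
    refine Finset.sum_eq_zero fun k _ => ?_
    have h2 := congrFun hc k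
    simp only [Finset.sum_apply, Pi.smul_apply, smul_eq_mul, Pi.zero_apply] at h2
    rw [h2, mul_zero]
  have h3 : ∀ j, ∑ k, (B i k : ℂ) * (c j * (v j k : ℂ)) = c j * (if i = j then 1 else 0) := by
    intro j
    have h4 := congrArg Complex.ofReal (hB i j)
    rw [apply_ite Complex.ofReal] at h4
    push_cast at h4
    rw [← h4, Finset.mul_sum]
    exact Finset.sum_congr rfl fun _ _ => by ring
  simp only [Finset.mul_sum] at h1
  rw [Finset.sum_comm] at h1
  simpa [h3] using h1

lemma linearIndependent_evalMon_scaled {d r N : ℕ} {𝒮 : Finset (Finset (Fin d))}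
    (h𝒮 : ∀ S ∈ 𝒮, S.card = N) {ρ : Fin r → ℝ} (hρ : ∀ i, 0 < ρ i) {μ : Fin r → Fin d → ℝ}
    (h : LinearIndependent ℝ (fun i (S : ↥𝒮) => evalMon S.1 (μ i))) :
    LinearIndependent ℂ (fun i (S : ↥𝒮) => evalMon S.1 (fun j => ((ρ i * μ i j : ℝ) : ℂ))) := by
  have h1 := linearIndependent_ofReal
    (h.units_smul fun i => Units.mk0 (ρ i ^ N) (pow_ne_zero N (hρ i).ne'))
  convert! h1 using 3 with i S
  have h2 : ((fun i => Units.mk0 (ρ i ^ N) (pow_ne_zero N (hρ i).ne')) •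
      fun i (S : ↥𝒮) => evalMon S.1 (μ i)) i S = ρ i ^ N * evalMon S.1 (μ i) := rfl
  rw [h2, ← h𝒮 S.1 S.2, ← evalMon_smul]
  simp [evalMon]

/-- For the explicit solution `G` the roots of the characteristic polynomial are the numbers `∑ ξ_l
y_{il}/y_{i0}` with multiplicity, so (iv) says they are distinct. -/
lemma injective_of_solvesG {n m r p k : ℕ} (hpm : p + 2 ≤ m) (hcard : (B0 n k p r).card = r)
    {T0 : Tensor ℝ m (n + 1)} {y : Fin r → Fin (n + 1) → ℂ}
    (hT0 : ∀ S, S.card = m → ((entry T0 S : ℝ) : ℂ) = ∑ i, evalMon S (y i))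
    (h0 : ∀ i, y i 0 ≠ 0)
    (hB0 : LinearIndependent ℂ (fun i (β : ↥(B0 n k p r)) => evalMon β.1 (y i)))
    {ξ : ↥(high n k) → ℂ}
    (hN : ∀ G : Matrix ↥(B0 n k p r) (B1 n k p) ℂ, SolvesG r p k T0 G →
      (Nxi ξ G).charpoly.roots.Nodup) :
    Function.Injective fun i => ∑ l, ξ l * (y i l.1 / y i 0) := by
  obtain ⟨G, hG, hchar⟩ := exists_solvesG hpm hcard hT0 h0 hB0 ξ
  have h1 := hN G hG
  have h2 := Polynomial.roots_multiset_prod_X_sub_C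
    (Finset.univ.val.map fun i => ∑ l, ξ l * (y i l.1 / y i 0))
  rw [Multiset.map_map] at h2
  rw [hchar] at h1
  replace h1 := h2 ▸ h1
  exact fun i j hij => Multiset.inj_on_of_nodup_map h1 i (Finset.mem_univ i) j
    (Finset.mem_univ j) hij

lemma entry_tensorF {d m r : ℕ} {ω ρ : Fin r → ℝ} (hρω : ∀ i, ρ i ^ m = ω i)
    (μ : Fin r → Fin d → ℝ) {S : Finset (Fin d)} (hS : S.card = m) :
    ((entry (tensorF ω μ m) S : ℝ) : ℂ)
      = ∑ i, evalMon S (fun j => ((ρ i * μ i j : ℝ) : ℂ)) := by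
  rw [entry, dif_pos hS, tensorF, Complex.ofReal_sum]
  refine Finset.sum_congr rfl fun i _ => ?_
  rw [← hρω, ← tpow_smul, ofReal_tpow, tpow_orderEmbOfFin]

lemma abs_entry_sub_le {d m : ℕ} {T T' : Tensor ℝ m d} {ε : ℝ} (hε : 0 ≤ ε)
    (h : ∀ a : Fin m ↪ Fin d, |T a - T' a| ≤ ε) (S : Finset (Fin d)) :
    |entry T S - entry T' S| ≤ ε := by
  unfold entry
  split_ifs with hS
  · exact h (S.orderEmbOfFin hS).toEmbedding
  · simpa using hε

lemma l2norm_comp_le {κ κ' E : Type*} [Fintype κ] [Fintype κ'] [NormedAddCommGroup E]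
    (x : κ → E) {f : κ' → κ} (hf : Function.Injective f) : l2norm (x ∘ f) ≤ l2norm x := by
  unfold l2norm
  rw [PiLp.norm_eq_of_L2, PiLp.norm_eq_of_L2]
  refine Real.sqrt_le_sqrt ?_
  have h := Finset.sum_map Finset.univ ⟨f, hf⟩ (fun i => ‖x i‖ ^ 2)
  refine le_of_eq_of_le h.symm ?_
  exact Finset.sum_le_sum_of_subset_of_nonneg (Finset.subset_univ _) fun _ _ _ => sq_nonneg _

lemma exists_stable_and_eigenvectors {n m r p k : ℕ} (hpm : p + 2 ≤ m)
    (hcard : (B0 n k p r).card = r) (hne : (high n k).Nonempty) {ω ρ : Fin r → ℝ}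
    (hρ : ∀ i, 0 < ρ i) (hρω : ∀ i, ρ i ^ m = ω i) {μ : Fin r → Fin (n + 1) → ℝ}
    (h0 : ∀ i, μ i 0 ≠ 0)
    (hB0 : LinearIndependent ℝ (fun i (β : ↥(B0 n k p r)) => evalMon β.1 (μ i)))
    (hO : ∀ l : ↥(high n k), LinearIndependent ℝ
      (fun i (γ : ↥(Oset n k (m - p - 1) l.1)) => evalMon γ.1 (μ i)))
    {ξ : ↥(high n k) → ℂ}
    (hN : ∀ G : Matrix ↥(B0 n k p r) (B1 n k p) ℂ, SolvesG r p k (tensorF ω μ m) G →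
      (Nxi ξ G).charpoly.roots.Nodup) :
    (∃ C > 0, ∃ δ > 0, Stable m (fun i j => ρ i * μ i j) C δ) ∧
    ∃ δ > 0, ∀ (T : Tensor ℝ m (n + 1)) (ε : ℝ), 0 ≤ ε → ε < δ →
      (∀ a : Fin m ↪ Fin (n + 1), |T a - tensorF ω μ m a| ≤ ε) →
      ∀ G : Matrix ↥(B0 n k p r) (B1 n k p) ℂ,
      (∀ α, IsMinOn (fun g : ↥(B0 n k p r) → ℂ =>
        l2norm ((matA r p k T α).mulVec g - vecb p k T α) ^ 2) Set.univ (fun β => G β α)) →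
      ∃ v : Fin r → ↥(B0 n k p r) → ℂ, (∀ i, l2norm (v i) = 1) ∧ LinearIndependent ℂ v ∧
        ∀ i, ∃ c : ℂ, (Nxi ξ G).mulVec (v i) = c • v i := by
  obtain ⟨y, hy⟩ : ∃ y : Fin r → Fin (n + 1) → ℂ, y = fun i j => ((ρ i * μ i j : ℝ) : ℂ) :=
    ⟨_, rfl⟩
  have hT0 : ∀ S, S.card = m → ((entry (tensorF ω μ m) S : ℝ) : ℂ) = ∑ i, evalMon S (y i) := by
    subst hy; exact fun S hS => entry_tensorF hρω μ hS
  have hy0 : ∀ i, y i 0 ≠ 0 := by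
    subst hy
    exact fun i => Complex.ofReal_ne_zero.2 (mul_ne_zero (hρ i).ne' (h0 i))
  have hyB0 : LinearIndependent ℂ (fun i (β : ↥(B0 n k p r)) => evalMon β.1 (y i)) := by
    subst hy
    exact linearIndependent_evalMon_scaled (N := p) (fun S hS =>
      (Finset.mem_powersetCard.1 (mem_J1_of_mem_B0 hS)).2) hρ hB0
  have hyO : ∀ l : ↥(high n k), LinearIndependent ℂ
      (fun i (γ : ↥(Oset n k (m - p - 1) l.1)) => evalMon γ.1 (y i)) := by
    subst hy
    exact fun l => linearIndependent_evalMon_scaled (N := m - p - 1) (fun S hS =>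
      (Finset.mem_powersetCard.1 hS).2) hρ (hO l)
  have hz := injective_of_solvesG hpm hcard hT0 hy0 hyB0 hN
  constructor
  · obtain ⟨C, hC, δ, hδ, h⟩ := exists_stability hpm hy0 hyB0 hyO hne ξ hz
    refine ⟨C, hC, δ, hδ, fun q ε hε hεδ hq => ?_⟩
    subst hy
    refine h q ε hε hεδ fun a => ?_
    simpa only [Complex.ofReal_sum, ofReal_tpow] using hq a
  · obtain ⟨δ, hδ, h⟩ := exists_forall_unit_eigenvectors hpm hcard hT0 hy0 hyB0 hyO ξ hz
    exact ⟨δ, hδ, fun T ε hε hεδ hT G hG => h T G ε hε hεδ (abs_entry_sub_le hε hT) hG⟩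

/-- Reordering and the signs do not change the variance problem: `s₁^m = 1`, and `s₂^m = s₂² = 1`
gives `s₂^(m-2) = 1`. So minimality transfers to the data aligned with the truth. -/
lemma residual_labelL_eq {r d m : ℕ} {s₁ s₂ : Fin r → ℝ} (hm : 2 ≤ m)
    (hs₁ : ∀ i, s₁ i ^ m = 1) (hs₂ : ∀ i, s₂ i ^ m = 1 ∧ s₂ i ^ 2 = 1)
    (T : Tensor ℝ m d) (q μ : Fin r → Fin d → ℝ) (ω c : Fin r → ℝ) (τ₁ τ₂ : Equiv.Perm (Fin r))
    (j : Fin d) (U : {U : Finset (Fin d) // U.card = m - 2 ∧ j ∉ U}) :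
    (T (labelL j U) - ∑ i, tpow (fun j => s₁ i * q (τ₁ i) j) m (labelL j U))
        - ∑ i, ω (τ₂ i) * evalMon U.1 (fun j => s₂ i * μ (τ₂ i) j) * c (τ₂ i)
      = (T (labelL j U) - ∑ i, tpow (q i) m (labelL j U))
        - ∑ i, c i * (ω i * tpow (μ i) (m - 2) (U.1.orderEmbOfFin U.2.1)) := by
  have hs : ∀ i, s₂ i ^ (m - 2) = 1 := fun i => by
    have h := (hs₂ i).1
    rw [← Nat.sub_add_cancel hm, pow_add, (hs₂ i).2, mul_one] at h
    exact h
  have h1 : ∑ i, tpow (fun j => s₁ i * q (τ₁ i) j) m (labelL j U)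
      = ∑ i, tpow (q i) m (labelL j U) := by
    rw [← Equiv.sum_comp τ₁ (fun i => tpow (q i) m (labelL j U))]
    exact Finset.sum_congr rfl fun i _ => by rw [tpow_smul, hs₁, one_mul]
  have h2 : ∑ i, ω (τ₂ i) * evalMon U.1 (fun j => s₂ i * μ (τ₂ i) j) * c (τ₂ i)
      = ∑ i, c i * (ω i * tpow (μ i) (m - 2) (U.1.orderEmbOfFin U.2.1)) := by
    rw [← Equiv.sum_comp τ₂
      (fun i => c i * (ω i * tpow (μ i) (m - 2) (U.1.orderEmbOfFin U.2.1)))]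
    refine Finset.sum_congr rfl fun i _ => ?_
    rw [tpow_orderEmbOfFin, evalMon_smul, U.2.1, hs, one_mul, mul_comm]
  rw [h1, h2]

lemma l2norm_le_card_mul {κ : Type*} [Fintype κ] {x : κ → ℝ} {B : ℝ} (h : ∀ i, |x i| ≤ B) :
    l2norm x ≤ Fintype.card κ * B := by
  refine (l2norm_le_sum x).trans ((Finset.sum_le_card_nsmul _ _ B fun i _ => h i).trans_eq ?_)
  simp

lemma frobNorm_diagonal_sub_le {d : ℕ} {x y : Fin d → ℝ} {B : ℝ} (hB : 0 ≤ B)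
    (h : ∀ j, |x j - y j| ≤ B) :
    frobNorm (Matrix.diagonal x - Matrix.diagonal y) ≤ (d * d : ℝ) * B := by
  have h1 : ∀ ij : Fin d × Fin d,
      |(Matrix.diagonal x - Matrix.diagonal y) ij.1 ij.2| ≤ B := fun ij => by
    by_cases hij : ij.1 = ij.2
    · rw [hij]; simpa using h ij.2
    · simpa [Matrix.diagonal_apply_ne _ hij] using hB
  refine (l2norm_le_card_mul h1).trans_eq ?_
  simp

lemma l2norm_onOmega_sub_le {n r m : ℕ} {ω : Fin r → ℝ} (hω : ∀ i, 0 < ω i)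
    (μ : Fin r → Fin (n + 1) → ℝ) (v : Fin r → Fin (n + 1) → ℝ≥0) (T : Tensor ℝ m (n + 1)) :
    l2norm (fun a : Fin m ↪ Fin (n + 1) => T a - tensorF ω μ m a)
      ≤ l2norm (T - moment (mixture ω μ v) m) := by
  have h := l2norm_comp_le (T - moment (mixture ω μ v) m)
    (f := fun a : Fin m ↪ Fin (n + 1) => (a : Fin m → Fin (n + 1))) DFunLike.coe_injective
  refine le_of_eq_of_le (congrArg l2norm (funext fun a => ?_)) h
  simp only [Function.comp_apply, Pi.sub_apply, moment_of_injective hω]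

/-- A positive second binomial gives `n - k - 1 ≥ m - p - 1 ≥ 1`. Since `r ≤ C(k,p) ≤ C(n+1,p)`,
minimality of `t` gives `t ≤ p < m`. -/
lemma parameters_of_le_choose {n m r p k t : ℕ} (hr : 0 < r) (hpm : p + 2 ≤ m)
    (hk : r ≤ k.choose p) (hnk : r ≤ (n - k - 1).choose (m - p - 1))
    (ht : IsLeast {s : ℕ | r ≤ (n + 1).choose s} t) :
    k ≤ n ∧ t < m ∧ (J1 n k p).Nonempty ∧ (high n k).Nonempty := by
  have h1 : m - p - 1 ≤ n - k - 1 := by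
    by_contra h
    rw [Nat.choose_eq_zero_of_lt (by omega)] at hnk
    omega
  have hkn : k + 2 ≤ n := by omega
  have h2 : t ≤ p := ht.2 (hk.trans (Nat.choose_le_choose p (by omega)))
  refine ⟨by omega, by omega, ?_, ⟨Fin.last n, ?_⟩⟩
  · rw [← Finset.card_pos, J1, Finset.card_powersetCard, card_low (by omega)]
    omega
  · simp only [high, Finset.mem_filter, Finset.mem_univ, true_and, Fin.val_last]
    omega

/-! ## The algorithm -/

section Algorithm

variable {n m r p k t : ℕ} {ω ρ : Fin r → ℝ} {μ : Fin r → Fin (n + 1) → ℝ}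
  {ξ : ↥(high n k) → ℂ} {C δ : ℝ}

lemma tensorF_eq_sum_tpow (hρω : ∀ i, ρ i ^ m = ω i) (a : Fin m → Fin (n + 1)) :
    tensorF ω μ m a = ∑ i, tpow (fun j => ρ i * μ i j) m a :=
  Finset.sum_congr rfl fun i _ => by rw [tpow_smul, hρω]

lemma exists_forall_nonempty_learnRun (htm : t < m) (hω : ∀ i, 0 < ω i)
    (hω1 : ∑ i, ω i = 1) (hρ : ∀ i, 0 < ρ i) (hρω : ∀ i, ρ i ^ m = ω i) (h0 : ∀ i, μ i 0 ≠ 0)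
    (hC : 0 < C) (hδ : 0 < δ) (hst : Stable m (fun i j => ρ i * μ i j) C δ)
    (heig : ∃ δ > 0, ∀ (T : Tensor ℝ m (n + 1)) (ε : ℝ), 0 ≤ ε → ε < δ →
      (∀ a : Fin m ↪ Fin (n + 1), |T a - tensorF ω μ m a| ≤ ε) →
      ∀ G : Matrix ↥(B0 n k p r) (B1 n k p) ℂ,
      (∀ α, IsMinOn (fun g : ↥(B0 n k p r) → ℂ =>
        l2norm ((matA r p k T α).mulVec g - vecb p k T α) ^ 2) Set.univ (fun β => G β α)) →
      ∃ v : Fin r → ↥(B0 n k p r) → ℂ, (∀ i, l2norm (v i) = 1) ∧ LinearIndependent ℂ v ∧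
        ∀ i, ∃ c : ℂ, (Nxi ξ G).mulVec (v i) = c • v i)
    (hLI : LinearIndependent ℝ (fun i : Fin r => onOmega (tpow (μ i) t))) :
    ∃ δ' > 0, ∀ (Mm : Tensor ℝ m (n + 1)) (Mt : Tensor ℝ t (n + 1)) (ε : ℝ), 0 ≤ ε → ε < δ' →
      l2norm (fun a : Fin m ↪ Fin (n + 1) => Mm a - tensorF ω μ m a) ≤ ε →
      l2norm (fun a : Fin t ↪ Fin (n + 1) => Mt a - tensorF ω μ t a) ≤ ε →
      Nonempty (LearnRun r p k Mm Mt ξ) := by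
  obtain ⟨δ₁, hδ₁, hdec⟩ := exists_isMinOn_decomposition (by omega) hC hδ hst
  obtain ⟨δ₂, hδ₂, heig⟩ := heig
  obtain ⟨C₃, hC₃, δ₃, hδ₃, hwm⟩ := exists_bound_weights_means htm hρ hρω hC hδ hst h0 hLI
  refine ⟨min δ₁ (min δ₂ (δ₃ / 3)), by positivity, fun Mm Mt ε hε hεδ hMm hMt => ?_⟩
  simp only [lt_min_iff] at hεδ
  obtain ⟨hε₁, hε₂, hε₃⟩ := hεδ
  have hT : ∀ a : Fin m ↪ Fin (n + 1), |Mm a - tensorF ω μ m a| ≤ ε := fun a =>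
    (norm_le_l2norm _ a).trans hMm
  refine nonempty_learnRun (by omega)
    (nonempty_approxRun (heig Mm ε hε hε₂ hT) (hdec (fun a => Mm a) ε hε hε₁ fun a => ?_))
    (exists_isMinOn_nlsObj (ω := ω) (μ := μ) ⟨hω1, fun i => (hω i).le⟩ hε hMm hMt
      (K := (‖ω‖ + ‖μ‖) + C₃ * (3 * ε)) fun ω' μ' hω' h₁ h₂ => ?_)
  · rw [← tensorF_eq_sum_tpow hρω]
    exact hT a
  · obtain ⟨τ, s, hs, hb⟩ := hwm ω' μ' (3 * ε) (by positivity) (by linarith) hω' h₁ h₂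
    intro i
    obtain ⟨i, rfl⟩ := τ.surjective i
    have hμi := norm_le_pi_norm μ i
    have hωi : |ω i| ≤ ‖ω‖ := norm_le_pi_norm ω i
    constructor
    · have h3 := abs_add_le (ω' (τ i) - ω i) (ω i)
      rw [sub_add_cancel] at h3
      linarith [(hb i).1, norm_nonneg μ]
    · intro j
      have hs1 : |s i| = 1 := by
        rw [← sq_eq_sq₀ (abs_nonneg _) zero_le_one, sq_abs, (hs i).2.2, one_pow]
      have hμij : |μ i j| ≤ ‖μ i‖ := norm_le_pi_norm (μ i) j
      have h3 := abs_add_le (s i * μ' (τ i) j - μ i j) (μ i j)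
      rw [sub_add_cancel, abs_mul, hs1, one_mul] at h3
      linarith [(hb i).2 j, norm_nonneg ω]

/-- Steps 2 and 4 are aligned with the truth by unrelated permutations and signs. This is harmless
because the rotated vectors enter step 5 only through the symmetric sum of their `m`-th powers; the
variances follow the order of the means. -/
lemma exists_bound_learnRun (hpm : p + 2 ≤ m) (htm : t < m) (hω : ∀ i, 0 < ω i)
    (hω1 : ∑ i, ω i = 1) (hρ : ∀ i, 0 < ρ i) (hρω : ∀ i, ρ i ^ m = ω i) (h0 : ∀ i, μ i 0 ≠ 0)
    (hC : 0 < C) (hδ : 0 < δ) (hst : Stable m (fun i j => ρ i * μ i j) C δ)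
    (hLI : LinearIndependent ℝ (fun i : Fin r => onOmega (tpow (μ i) t)))
    (hLI' : ∀ j, LinearIndependent ℝ
      (fun i (U : {U : Finset (Fin (n + 1)) // U.card = m - 2 ∧ j ∉ U}) => evalMon U.1 (μ i)))
    (v : Fin r → Fin (n + 1) → ℝ≥0) :
    ∃ C' > 0, ∃ δ' > 0, ∀ (Mm : Tensor ℝ m (n + 1)) (Mt : Tensor ℝ t (n + 1)) (ε : ℝ),
      0 ≤ ε → ε < δ' → (∀ a, |Mm a - moment (mixture ω μ v) m a| ≤ ε) →
      l2norm (fun a : Fin m ↪ Fin (n + 1) => Mm a - tensorF ω μ m a) ≤ ε →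
      l2norm (fun a : Fin t ↪ Fin (n + 1) => Mt a - tensorF ω μ t a) ≤ ε →
      ∀ R : LearnRun r p k Mm Mt ξ, ∃ (τ : Equiv.Perm (Fin r)) (s : Fin r → ℝ),
        (∀ i, s i ^ m = 1 ∧ s i ^ t = 1) ∧ ∀ i, |R.omega (τ i) - ω i| ≤ C' * ε ∧
          ∀ j, |s i * R.mu (τ i) j - μ i j| ≤ C' * ε ∧ |R.theta (τ i) j - v i j| ≤ C' * ε := by
  obtain ⟨C₁, hC₁, δ₁, hδ₁, hrot⟩ := exists_bound_rotated (j₀ := 0) (by omega) hC hδ hst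
    fun i => mul_ne_zero (hρ i).ne' (h0 i)
  obtain ⟨C₂, hC₂, δ₂, hδ₂, hwm⟩ := exists_bound_weights_means htm hρ hρω hC hδ hst h0 hLI
  obtain ⟨K, hK⟩ : ∃ K : ℝ, K = C₁ + 3 * C₂ := ⟨_, rfl⟩
  obtain ⟨C₃, hC₃, δ₃, hδ₃, hvar⟩ := exists_bound_variances (by omega) hω
    (y := fun i j => ρ i * μ i j) (v := v) (fun i a => by rw [tpow_smul, hρω]) hLI' K
  refine ⟨K + C₃, by rw [hK]; positivity, min δ₁ (min (δ₂ / 3) δ₃), by positivity,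
    fun Mm Mt ε hε hεδ hmom hMm hMt R => ?_⟩
  simp only [lt_min_iff] at hεδ
  obtain ⟨hε₁, hε₂, hε₃⟩ := hεδ
  have hT : ∀ a : Fin m ↪ Fin (n + 1), |Mm a - tensorF ω μ m a| ≤ ε := fun a =>
    (norm_le_l2norm _ a).trans hMm
  obtain ⟨τ₁, s₁, hs₁, hq⟩ := hrot (fun a => Mm a) R.approx.q R.eta ε hε hε₁
    (fun a => by rw [← tensorF_eq_sum_tpow hρω]; exact hT a) R.approx.q_min R.eta_root R.eta_min
  obtain ⟨hres₁, hres₂⟩ := residual_le_of_nlsObj_le hε hMm hMt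
    (R.nls_min (show (ω, μ) ∈ feasible r (n + 1) from ⟨hω1, fun i => (hω i).le⟩))
  obtain ⟨τ₂, s₂, hs₂, hb⟩ := hwm R.omega R.mu (3 * ε) (by positivity) (by linarith) R.feas.2
    hres₁ hres₂
  have hKε : C₁ * ε ≤ K * ε ∧ C₂ * (3 * ε) ≤ K * ε ∧ K * ε ≤ (K + C₃) * ε ∧
      C₃ * ε ≤ (K + C₃) * ε := by
    have h1 := mul_nonneg hC₁.le hε
    have h2 := mul_nonneg hC₂.le hε
    have h3 := mul_nonneg hC₃.le hε
    rw [hK]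
    refine ⟨?_, ?_, ?_, ?_⟩ <;> linarith
  have hθ := hvar Mm (fun i j => s₁ i * R.qCheck (τ₁ i) j) (fun i j => s₂ i * R.mu (τ₂ i) j)
    (fun i j => R.theta (τ₂ i) j) (fun i => R.omega (τ₂ i)) ε hε hε₃ hmom
    (fun i j => by rw [R.qCheck_eq]; exact (hq i j).trans hKε.1)
    (fun i => (hb i).1.trans hKε.2.1) (fun i j => ((hb i).2 j).trans hKε.2.1)
    (fun j => by
      -- The competitor is the list of true variances, reordered to match the output.
      have h1 := R.theta_min j (show (fun i => (v (τ₂.symm i) j : ℝ)) ∈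
        {c : Fin r → ℝ | ∀ i, 0 ≤ c i} from fun i => (v (τ₂.symm i) j).2)
      have h2 := le_of_sq_le_sq h1 (l2norm_nonneg _)
      have hs : ∀ i, s₂ i ^ m = 1 ∧ s₂ i ^ 2 = 1 := fun i => ⟨(hs₂ i).1, (hs₂ i).2.2⟩
      have h3 := residual_labelL_eq (by omega) hs₁ hs Mm R.qCheck R.mu R.omega
        (fun i => R.theta i j) τ₁ τ₂ j
      have h4 := residual_labelL_eq (by omega) hs₁ hs Mm R.qCheck R.mu R.omega
        (fun i => (v (τ₂.symm i) j : ℝ)) τ₁ τ₂ j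
      simp only [Equiv.symm_apply_apply] at h4
      rw [funext h3, funext h4]
      exact h2)
  exact ⟨τ₂, s₂, fun i => ⟨(hs₂ i).1, (hs₂ i).2.1⟩, fun i =>
    ⟨((hb i).1.trans hKε.2.1).trans hKε.2.2.1, fun j =>
      ⟨(((hb i).2 j).trans hKε.2.1).trans hKε.2.2.1, (hθ i j).trans hKε.2.2.2⟩⟩⟩

end Algorithm

end GMM

/-! ### Assembly of the stability theorem -/

theorem theorem5p1
    (n m r p k t : ℕ)
    (hp : 1 ≤ p) (hpm : p + 2 ≤ m)
    (hk : r ≤ k.choose p) (hnk : r ≤ (n - k - 1).choose (m - p - 1))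
    (ht : IsLeast {s : ℕ | r ≤ (n + 1).choose s} t)
    (ω : Fin r → ℝ) (μ : Fin r → Fin (n + 1) → ℝ) (v : Fin r → Fin (n + 1) → ℝ≥0)
    (hω : ∀ i, 0 < ω i) (hω1 : ∑ i, ω i = 1) (hv : ∀ i j, 0 < v i j)
    (ξ : ↥(GMM.high n k) → ℂ)
    (hlead : ∀ i, μ i 0 ≠ 0)
    (hB0 : LinearIndependent ℝ
      (fun (i : Fin r) (β : ↥(GMM.B0 n k p r)) => GMM.evalMon β.1 (μ i)))
    (hO : ∀ α : GMM.B1 n k p, LinearIndependent ℝ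
      (fun (i : Fin r) (γ : ↥(GMM.Oset n k (m - p - 1) α.2.1)) => GMM.evalMon γ.1 (μ i)))
    (hN : ∀ G : Matrix ↥(GMM.B0 n k p r) (GMM.B1 n k p) ℂ,
      GMM.SolvesG r p k (GMM.tensorF ω μ m) G → (GMM.Nxi ξ G).charpoly.roots.Nodup)
    (hΩt : LinearIndependent ℝ (fun i : Fin r => GMM.onOmega (GMM.tpow (μ i) t))) :
    ∃ C ε₀ : ℝ, 0 < C ∧ 0 < ε₀ ∧
      ∀ (Mm : GMM.Tensor ℝ m (n + 1)) (Mt : GMM.Tensor ℝ t (n + 1)) (ε : ℝ),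
        GMM.IsSymmTensor Mm → GMM.IsSymmTensor Mt →
        ε = max (GMM.l2norm (Mm - GMM.moment (GMM.mixture ω μ v) m))
          (GMM.l2norm (Mt - GMM.moment (GMM.mixture ω μ v) t)) →
        ε < ε₀ →
        Nonempty (GMM.LearnRun r p k Mm Mt ξ) ∧
        ∀ R : GMM.LearnRun r p k Mm Mt ξ,
          ∃ (τ : Equiv.Perm (Fin r)) (s : Fin r → ℝ),
            (∀ i, s i ^ m = 1 ∧ s i ^ t = 1) ∧
            ∀ i,
              GMM.l2norm (s i • R.mu (τ i) - μ i) ≤ C * ε ∧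
              |R.omega (τ i) - ω i| ≤ C * ε ∧
              GMM.frobNorm (Matrix.diagonal (R.theta (τ i))
                - Matrix.diagonal (fun j => (v i j : ℝ))) ≤ C * ε := by
  have hm0 : m ≠ 0 := by omega
  have hr : 0 < r := by
    rcases Nat.eq_zero_or_pos r with rfl | h
    · simp at hω1
    · exact h
  obtain ⟨hkn, htm, ⟨S, hS⟩, hne⟩ := GMM.parameters_of_le_choose hr hpm hk hnk ht
  -- `O_α` depends only on the high variable of `α`, so any fixed element of `J1` can be paired with
  -- it.
  have hO' : ∀ l : ↥(GMM.high n k), LinearIndependent ℝ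
      (fun (i : Fin r) (γ : ↥(GMM.Oset n k (m - p - 1) l.1)) => GMM.evalMon γ.1 (μ i)) :=
    fun l => hO (⟨S, hS⟩, l)
  obtain ⟨ρ, hρ, hρω⟩ : ∃ ρ : Fin r → ℝ, (∀ i, 0 < ρ i) ∧ ∀ i, ρ i ^ m = ω i :=
    ⟨fun i => ω i ^ ((m : ℝ)⁻¹), fun i => Real.rpow_pos_of_pos (hω i) _,
      fun i => Real.rpow_inv_natCast_pow (hω i).le hm0⟩
  obtain ⟨⟨C, hC, δ, hδ, hst⟩, heig⟩ := GMM.exists_stable_and_eigenvectors hpm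
    (GMM.card_B0 hkn hk) hne hρ hρω hlead hB0 hO' hN
  obtain ⟨δ₁, hδ₁, hrun⟩ := GMM.exists_forall_nonempty_learnRun htm hω hω1 hρ hρω hlead hC hδ
    hst heig hΩt
  obtain ⟨K, hK, δ₂, hδ₂, hbound⟩ := GMM.exists_bound_learnRun (p := p) (k := k) (ξ := ξ) hpm htm
    hω hω1 hρ hρω hlead hC hδ hst hΩt
    (GMM.linearIndependent_evalMon_pairs hp hpm hB0 hO' hne) v
  -- The factor is the number of entries of a covariance matrix, which converts entrywise bounds
  -- into Frobenius bounds and dominates the factor `n + 1` for vectors.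
  refine ⟨((n + 1 : ℕ) * (n + 1 : ℕ) : ℝ) * K, min δ₁ δ₂, by positivity, by positivity,
    fun Mm Mt ε _ _ hε hεδ => ?_⟩
  obtain ⟨hε₁, hε₂⟩ := lt_min_iff.1 hεδ
  have hMm : GMM.l2norm (Mm - GMM.moment (GMM.mixture ω μ v) m) ≤ ε := hε ▸ le_max_left _ _
  have hMt : GMM.l2norm (Mt - GMM.moment (GMM.mixture ω μ v) t) ≤ ε := hε ▸ le_max_right _ _
  have hε0 : 0 ≤ ε := (GMM.l2norm_nonneg _).trans hMm
  have hMm' := (GMM.l2norm_onOmega_sub_le hω μ v Mm).trans hMm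
  have hMt' := (GMM.l2norm_onOmega_sub_le hω μ v Mt).trans hMt
  refine ⟨hrun Mm Mt ε hε0 hε₁ hMm' hMt', fun R => ?_⟩
  obtain ⟨τ, s, hs, hb⟩ := hbound Mm Mt ε hε0 hε₂
    (fun a => (GMM.norm_le_l2norm (Mm - GMM.moment (GMM.mixture ω μ v) m) a).trans hMm)
    hMm' hMt' R
  have hKε : 0 ≤ K * ε := by positivity
  have hn : (1 : ℝ) ≤ (n + 1 : ℕ) := by exact_mod_cast Nat.succ_pos n
  have hnn : ((n + 1 : ℕ) : ℝ) ≤ (n + 1 : ℕ) * (n + 1 : ℕ) :=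
    le_mul_of_one_le_left (by positivity) hn
  rw [mul_assoc]
  refine ⟨τ, s, hs, fun i => ⟨?_, ?_, ?_⟩⟩
  · refine (GMM.l2norm_le_card_mul (B := K * ε) fun j => ((hb i).2 j).1).trans ?_
    rw [Fintype.card_fin]
    exact mul_le_mul_of_nonneg_right hnn hKε
  · exact (hb i).1.trans (le_mul_of_one_le_left hKε (hn.trans hnn))
  · exact GMM.frobNorm_diagonal_sub_le hKε fun j => ((hb i).2 j).2
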